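/- Notation. Let $n\ge 1$, let $D=C_c^\infty(\mathbb R^n;\mathbb C)$ be the space of test functions and $D'$ the space of distributions on $\mathbb R^n$. For $s\in\mathbb R$ and $1\le p\le\infty$ let $H^s_p=H^s_p(\mathbb R^n)$ be the Bessel potential (Sobolev) space of tempered distributions $u$ with $J^su\in L_p(\mathbb R^n)$, normed by $\|u\|_{s,p}=\|J^su\|_{L_p}$, where $J^s$ is the Fourier multiplier with symbol $(1+|\xi|^2)^{s/2}$ (Fourier transform $\int e^{-2\pi i x\cdot\xi}u(x)\,dx$), and put $$H^s_{p,\mathrm{loc}}=\{u\in D' : u\varphi\in H^s_p\ \ \forall\varphi\in D\}.$$ Fix a nonnegative function $\eta\in D$ with $\eta(x)=1$ for $|x|\le 1$, and let $H^s_{p,\mathrm{unif}}$ be the space of all $u\in H^s_{p,\mathrm{loc}}$ with $$\|u\|_{s,p,\mathrm{unif}}=\sup_{z\in\mathbb R^n}\|\eta(\cdot-z)\,u\|_{s,p}<\infty .$$ For $\alpha\ge 0$ and $1\le p<\infty$ let $M_p^\alpha$ be the space of multipliers from $H^\alpha_p$ to $H^{-\alpha}_p$, that is, of all $\mu\in H^{-\alpha}_{p,\mathrm{loc}}$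 for which there is a constant $C\ge 0$ with $\|\mu\varphi\|_{-\alpha,p}\le C\|\varphi\|_{\alpha,p}$ for all $\varphi\in D$; the norm $\|\mu\|_{M_p^\alpha}$ is the infimum of all such $C$. Let $p'$ be the conjugate exponent, $1/p+1/p'=1$, and $\hat p=\max\{p,p'\}$. Theorem. Let $\alpha\ge 0$ and $1\le p<\infty$. (1) One has $M_p^\alpha\subset H^{-\alpha}_{\hat p,\mathrm{unif}}$, and there is a constant $C$ such that $\|\mu\|_{-\alpha,\hat p,\mathrm{unif}}\le C\|\mu\|_{M_p^\alpha}$ for all $\mu\in M_p^\alpha$. (2) Let $\gamma\in\mathbb R$ and $r,r'\in[1,\infty]$ with $1/r+1/r'=1$. Then the following are equivalent: (a) $H^{-\gamma}_{r,\mathrm{unif}}\subset M_p^\alpha$, and there is a constant $C$ such that $\|\mu\|_{M_p^\alpha}\le C\|\mu\|_{-\gamma,r,\mathrm{unif}}$ for all $\mu\in H^{-\gamma}_{r,\mathrm{unif}}$; (b) there is a constant $C$ such that $\|\varphi\psi\|_{\gamma,r'}\le C\|\varphi\|_{\alpha,p}\|\psi\|_{\alpha,p'}$ for all $\varphi,\psi\in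 D$. -/

import Mathlib

open MeasureTheory TopologicalSpace
open scoped ENNReal NNReal Distributions SchwartzMap

noncomputable section

/-- The space `D` of complex-valued smooth compactly supported functions on `ℝⁿ`, with its
canonical LF topology. -/
abbrev TestFn (n : ℕ) : Type :=
  𝓓((⊤ : Opens (EuclideanSpace ℝ (Fin n))), ℂ)

/-- The space `D'` of (complex) distributions on `ℝⁿ`: continuous complex-linear functionals
on `D`. -/
abbrev Distr (n : ℕ) : Type :=
  TestFn n →L[ℂ] ℂ

namespace TestFn

variable {n : ℕ}

/-- Multiplication by a test function, as a continuous linear map `D → D`. -/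
def mulCLM (φ : TestFn n) : TestFn n →L[ℂ] TestFn n :=
  TestFunction.limitCLM ℂ
    (fun ψ => ⟨fun x => φ x * ψ x, φ.contDiff.mul ψ.contDiff,
      ψ.hasCompactSupport.mul_left, Set.subset_univ _⟩)
    (fun _ hK => TestFunction.ofSupportedInCLM ℂ hK ∘L
      ContDiffMapSupportedIn.bilinLeftCLM (ContinuousLinearMap.mul ℂ ℂ) φ.contDiff)
    (fun _ _ ψ => by
      ext x
      exact mul_comm (φ x) (ψ x))

@[simp]
theorem mulCLM_apply (φ ψ : TestFn n) (x : EuclideanSpace ℝ (Fin n)) :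
    mulCLM φ ψ x = φ x * ψ x :=
  rfl

/-- The translate `x ↦ φ (x - z)` of a test function. -/
def translate (z : EuclideanSpace ℝ (Fin n)) (φ : TestFn n) : TestFn n where
  toFun x := φ (x - z)
  contDiff' := φ.contDiff.comp (contDiff_id.sub contDiff_const)
  hasCompactSupport' := by
    simpa [sub_eq_add_neg, Function.comp_def] using
      φ.hasCompactSupport.comp_homeomorph (Homeomorph.addRight (-z))
  tsupport_subset' := Set.subset_univ _

@[simp]
theorem translate_apply (z : EuclideanSpace ℝ (Fin n)) (φ : TestFn n)
    (x : EuclideanSpace ℝ (Fin n)) : translate z φ x = φ (x - z) :=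
  rfl

/-- A test function, seen as a Schwartz function. -/
def toSchwartz (φ : TestFn n) : 𝓢(EuclideanSpace ℝ (Fin n), ℂ) :=
  φ.hasCompactSupport.toSchwartzMap φ.contDiff

@[simp]
theorem toSchwartz_apply (φ : TestFn n) (x : EuclideanSpace ℝ (Fin n)) :
    φ.toSchwartz x = φ x :=
  rfl

/-- `η ∈ D` is real and nonnegative everywhere, and `η = 1` on the closed unit ball. -/
structure IsCutoff (η : TestFn n) : Prop where
  nonneg : ∀ x, ∃ t : ℝ, 0 ≤ t ∧ η x = (t : ℂ)
  eq_one : ∀ x, ‖x‖ ≤ 1 → η x = 1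

end TestFn

/-- The norm `‖T‖_{s,p}` of a tempered distribution in the (Bessel potential) Sobolev space
`H^s_p(ℝⁿ)`, i.e. the `L_p` norm of `J^s T`, where `J^s` is the Fourier multiplier with symbol
`(1 + |ξ|²)^{s/2}`; it is `∞` when `J^s T` is not an `L_p` function. -/
def temperedSobolevNorm {n : ℕ} (s : ℝ) (p : ℝ≥0∞) [Fact (1 ≤ p)]
    (T : 𝓢'(EuclideanSpace ℝ (Fin n), ℂ)) : ℝ≥0∞ :=
  ⨅ (f : Lp ℂ p (volume : Measure (EuclideanSpace ℝ (Fin n))))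
    (_ : TemperedDistribution.besselPotential (EuclideanSpace ℝ (Fin n)) ℂ s T =
      (f : 𝓢'(EuclideanSpace ℝ (Fin n), ℂ))), ‖f‖ₑ

/-- The norm `‖φ‖_{s,p}` of a test function. -/
def TestFn.sobolevNorm {n : ℕ} (s : ℝ) (p : ℝ≥0∞) [Fact (1 ≤ p)] (φ : TestFn n) : ℝ≥0∞ :=
  temperedSobolevNorm s p (φ.toSchwartz : 𝓢'(EuclideanSpace ℝ (Fin n), ℂ))

namespace Distr

variable {n : ℕ}

/-- The product `φ u` of a distribution `u` and a test function `φ`, `(φ u)(ψ) = u(φ ψ)`. -/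
def mulTest (φ : TestFn n) (u : Distr n) : Distr n :=
  u ∘L TestFn.mulCLM φ

/-- The distribution `u` is the restriction to `D` of the tempered distribution `T`.
(As `D` is dense in the Schwartz space, `u` determines `T`.) -/
def IsRestrictionOf (u : Distr n) (T : 𝓢'(EuclideanSpace ℝ (Fin n), ℂ)) : Prop :=
  ∀ φ : TestFn n, u φ = T φ.toSchwartz

/-- Membership of a distribution in the Sobolev space `H^s_p(ℝⁿ)`. -/
def MemSobolev (s : ℝ) (p : ℝ≥0∞) [Fact (1 ≤ p)] (u : Distr n) : Prop :=
  ∃ T : 𝓢'(EuclideanSpace ℝ (Fin n), ℂ),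
    u.IsRestrictionOf T ∧ TemperedDistribution.MemSobolev s p T

/-- The norm `‖u‖_{s,p}` of a distribution, `∞` if `u` is not in `H^s_p(ℝⁿ)`. -/
def sobolevNorm (s : ℝ) (p : ℝ≥0∞) [Fact (1 ≤ p)] (u : Distr n) : ℝ≥0∞ :=
  ⨅ (T : 𝓢'(EuclideanSpace ℝ (Fin n), ℂ)) (_ : u.IsRestrictionOf T), temperedSobolevNorm s p T

/-- Membership in `H^s_{p,loc}(ℝⁿ)`. -/
def MemSobolevLoc (s : ℝ) (p : ℝ≥0∞) [Fact (1 ≤ p)] (u : Distr n) : Prop :=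
  ∀ φ : TestFn n, MemSobolev s p (mulTest φ u)

/-- The norm `‖u‖_{s,p,unif} = sup_z ‖η(· - z) u‖_{s,p}`. -/
def unifNorm (η : TestFn n) (s : ℝ) (p : ℝ≥0∞) [Fact (1 ≤ p)] (u : Distr n) : ℝ≥0∞ :=
  ⨆ z : EuclideanSpace ℝ (Fin n), sobolevNorm s p (mulTest (TestFn.translate z η) u)

/-- The space `H^s_{p,unif}(ℝⁿ)`. -/
def unifSpace (η : TestFn n) (s : ℝ) (p : ℝ≥0∞) [Fact (1 ≤ p)] : Set (Distr n) :=
  {u | MemSobolevLoc s p u ∧ unifNorm η s p u < ∞}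

/-- `‖μ φ‖_{-α,p} ≤ C ‖φ‖_{α,p}` for all `φ ∈ D`. -/
def IsMultiplierBound (α : ℝ) (p : ℝ≥0∞) [Fact (1 ≤ p)] (μ : Distr n) (C : ℝ≥0) : Prop :=
  ∀ φ : TestFn n, sobolevNorm (-α) p (mulTest φ μ) ≤ C * φ.sobolevNorm α p

/-- The space `M_p^α` of multipliers from `H^α_p(ℝⁿ)` to `H^{-α}_p(ℝⁿ)`. -/
def multiplierSpace (n : ℕ) (α : ℝ) (p : ℝ≥0∞) [Fact (1 ≤ p)] : Set (Distr n) :=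
  {μ | MemSobolevLoc (-α) p μ ∧ ∃ C : ℝ≥0, IsMultiplierBound α p μ C}

/-- The norm of `M_p^α`: the infimum of all constants `C` in the multiplier inequality. -/
def multiplierNorm (α : ℝ) (p : ℝ≥0∞) [Fact (1 ≤ p)] (μ : Distr n) : ℝ≥0∞ :=
  ⨅ (C : ℝ≥0) (_ : IsMultiplierBound α p μ C), (C : ℝ≥0∞)

/-- `A ⊆ B` with an estimate of norms `N_B(u) ≤ C N_A(u)`, `u ∈ A`. -/
def ContinuouslyEmbedded (A : Set (Distr n)) (NA : Distr n → ℝ≥0∞)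
    (B : Set (Distr n)) (NB : Distr n → ℝ≥0∞) : Prop :=
  A ⊆ B ∧ ∃ C : ℝ≥0, ∀ u ∈ A, NB u ≤ C * NA u

end Distr

instance fact_one_le_max (p q : ℝ≥0∞) [hp : Fact (1 ≤ p)] : Fact (1 ≤ max p q) :=
  ⟨hp.out.trans (le_max_left p q)⟩

end

/-!
Throughout, a multiplier `μ` is studied through the symmetric bilinear form `μ(φψ)` on test
functions, and `H^{-α}_p` is paired with `H^α_{p'}`.

**Multipliers are uniformly local.** By the symmetry of the form, a multiplier for the exponent `p`
is one for the conjugate exponent `p'` too (`sobolevNorm_mulTest_conj_le`). Applying it to the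
translates of `η`, which all have the same norm, bounds the uniform norm of `μ` in both exponents.

**The embedding implies the product inequality.** For a Schwartz function `h`, the function
`μ = J^γ h` has uniform norm at most a constant times `‖h‖_{L^r}`, because multiplication by the
translates of `η` is uniformly bounded on `H^{-γ}_r` (`exists_eLpNorm_besselS_mulS_le`). Since
`μ(φψ) = ∫ J^γ(φψ) h`, the embedding bounds the pairing of `J^γ(φψ)` with every `h`, and the converse
of Hölder's inequality (`eLpNorm_le_of_schwartz_pairing`) gives the claim.

**The product inequality implies the embedding.** Let `χ_k` be a smooth partition of unity made of
the translates of one function to the points of a lattice, and `η_k` the same translates of `η`, so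
that `η_k = 1` on the support of `χ_k`. Then `u(φψ) = ∑_k (η_k u)((χ_k φ)(η_k ψ))`, and by the product
inequality each term is at most a multiple of
`‖u‖_{-γ,r,unif} ‖χ_k φ‖_{α,p} ‖η_k ψ‖_{α,p'}`. Hölder's inequality for sums and the localization
bound `(∑_k ‖χ_k φ‖_{α,p}^p)^{1/p} ≤ C ‖φ‖_{α,p}` (a supremum if the exponent is `∞`) show that the form
is bounded (`exists_enorm_apply_mulCLM_le`). A bound of the form yields `J^{-α}(φu) ∈ L^p` by duality.
For `p = 1` the dual of `L^∞` is larger than `L^1`, and duality suffices only if `J^{-α}(φu)` is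
already known to be a function. It is one if `γ ≤ α`, because
`J^{-α}(φu) = J^{-(α-γ)} J^{-γ}(φu)` and `J^{-(α-γ)}` maps `L^r` to itself
(`exists_besselPotential_memLp`, `sobolevNorm_le_of_pairing`). The product inequality does force
`γ ≤ α`, as one sees by letting one factor oscillate at a frequency that tends to infinity
(`le_of_product_inequality`).

**Localization for all `1 ≤ q ≤ ∞`.** The endpoints exclude the usual multiplier theorems, so the
bound `(∑_k ‖χ_k φ‖_{α,q}^q)^{1/q} ≤ C ‖φ‖_{α,q}` (`locBdd`) is derived without singular integrals. For
`0 < s < 2` the operator `J^s` is an integral over the heat semigroup, and this expresses the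
commutator of `J^s` with multiplication by `χ` through a first-order term `∑_j ∂_jχ · J^{s-2}∂_j u` and
an integral operator whose kernel contains the second-order Taylor remainder of `χ`
(`besselS_mulS_eq`). With `u = J^{-s} f` the first-order term becomes `∑_j ∂_jχ · J^{-2}∂_j f`. Both
terms are bounded by Schur's test (`eLpNorm_le_of_schur`), uniformly for families of translates of
finite overlap. The step from `s` to `s + 2` uses `J² = 1 - Δ/(4π²)` and the Leibniz rule, and
negative orders are needed for a single multiplication only, where they follow by duality.
-/

open FourierTransform Real Filter Topology

set_option linter.unusedSectionVars false

section Analysis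

variable {E : Type*} [NormedAddCommGroup E] [InnerProductSpace ℝ E] [FiniteDimensional ℝ E]
  [MeasurableSpace E] [BorelSpace E]

/-! ### Bessel potentials of Schwartz functions -/

/-- The symbol `(1 + |ξ|²)^{s/2}` of the Bessel potential of order `s`. -/
noncomputable def besselSymbol (s : ℝ) (ξ : E) : ℝ := (1 + ‖ξ‖ ^ 2) ^ (s / 2)

theorem besselSymbol_pos (s : ℝ) (ξ : E) : 0 < besselSymbol s ξ := by
  unfold besselSymbol; positivity

theorem besselSymbol_add (s t : ℝ) (ξ : E) :
    besselSymbol (s + t) ξ = besselSymbol s ξ * besselSymbol t ξ := by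
  unfold besselSymbol
  rw [← Real.rpow_add (by positivity)]
  congr 1; ring

@[simp]
theorem besselSymbol_zero (ξ : E) : besselSymbol 0 ξ = 1 := by simp [besselSymbol]

theorem besselSymbol_neg (s : ℝ) (ξ : E) : besselSymbol (-s) ξ = (besselSymbol s ξ)⁻¹ := by
  have h := besselSymbol_add s (-s) ξ
  rw [add_neg_cancel, besselSymbol_zero] at h
  exact (inv_eq_of_mul_eq_one_right h.symm).symm

theorem besselSymbol_hasTemperateGrowth (s : ℝ) :
    (fun ξ : E => ((besselSymbol s ξ : ℝ) : ℂ)).HasTemperateGrowth := by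
  unfold besselSymbol; fun_prop

theorem continuous_besselSymbol (s : ℝ) : Continuous (besselSymbol s : E → ℝ) := by
  unfold besselSymbol
  refine Continuous.rpow_const (by fun_prop) fun x => Or.inl (by positivity)

variable (E) in
/-- The Bessel potential `J^s` on Schwartz functions. -/
noncomputable def besselS (s : ℝ) : 𝓢(E, ℂ) →L[ℂ] 𝓢(E, ℂ) :=
  SchwartzMap.fourierMultiplierCLM ℂ (fun ξ : E => ((besselSymbol s ξ : ℝ) : ℂ))

@[simp]
theorem besselS_zero (f : 𝓢(E, ℂ)) : besselS E 0 f = f := by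
  simp [besselS]

@[simp]
theorem besselS_besselS (s t : ℝ) (f : 𝓢(E, ℂ)) :
    besselS E s (besselS E t f) = besselS E (s + t) f := by
  unfold besselS
  rw [SchwartzMap.fourierMultiplierCLM_fourierMultiplierCLM_apply
    (besselSymbol_hasTemperateGrowth s) (besselSymbol_hasTemperateGrowth t)]
  congr 2
  ext ξ
  simp [besselSymbol_add]

theorem fourier_besselS (s : ℝ) (f : 𝓢(E, ℂ)) (ξ : E) :
    𝓕 (besselS E s f) ξ = besselSymbol s ξ * 𝓕 f ξ := by
  rw [besselS, SchwartzMap.fourierMultiplierCLM_apply, FourierTransform.fourier_fourierInv_eq,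
    SchwartzMap.smulLeftCLM_apply_apply (besselSymbol_hasTemperateGrowth s)]
  simp

/-- The character `x ↦ e^{2πi⟨ξ, x⟩}`. -/
noncomputable def fchar (ξ x : E) : ℂ := Complex.exp ((2 * π * inner ℝ ξ x : ℝ) * Complex.I)

theorem norm_fchar (ξ x : E) : ‖fchar ξ x‖ = 1 := Complex.norm_exp_ofReal_mul_I _

theorem fchar_add_right (ξ x y : E) : fchar ξ (x + y) = fchar ξ x * fchar ξ y := by
  simp only [fchar, inner_add_right, ← Complex.exp_add]; congr 1; push_cast; ring

theorem fchar_add_left (ξ η x : E) : fchar (ξ + η) x = fchar ξ x * fchar η x := by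
  simp only [fchar, inner_add_left, ← Complex.exp_add]; congr 1; push_cast; ring

theorem fchar_neg_right (ξ x : E) : fchar ξ (-x) = fchar (-ξ) x := by
  simp [fchar]

theorem fchar_neg_mul (ξ x : E) : fchar (-ξ) x * fchar ξ x = 1 := by
  rw [← fchar_add_left]; simp [fchar]

theorem fchar_comm (ξ x : E) : fchar ξ x = fchar x ξ := by
  simp only [fchar, real_inner_comm]

theorem continuous_fchar : Continuous fun q : E × E => fchar q.1 q.2 := by
  unfold fchar; fun_prop

theorem continuous_fchar_left (x : E) : Continuous fun ξ : E => fchar ξ x := by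
  unfold fchar; fun_prop

theorem continuous_fchar_right (ξ : E) : Continuous fun x : E => fchar ξ x := by
  unfold fchar; fun_prop

/-- Fourier inversion for Schwartz functions. -/
theorem schwartz_eq_integral_fourier (f : 𝓢(E, ℂ)) (x : E) :
    f x = ∫ ξ, fchar ξ x * 𝓕 f ξ := by
  conv_lhs => rw [← FourierTransform.fourierInv_fourier_eq (E := 𝓢(E, ℂ)) (F := 𝓢(E, ℂ)) f, SchwartzMap.fourierInv_coe,
    Real.fourierInv_eq']
  rfl

theorem fourier_eq_integral_fchar (f : 𝓢(E, ℂ)) (ξ : E) :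
    𝓕 f ξ = ∫ x, fchar (-ξ) x * f x := by
  rw [SchwartzMap.fourier_coe, Real.fourier_eq']
  refine integral_congr_ae (.of_forall fun x => ?_)
  simp only [fchar, smul_eq_mul, inner_neg_left, real_inner_comm]
  congr 2; push_cast; ring

theorem besselS_apply (s : ℝ) (f : 𝓢(E, ℂ)) (x : E) :
    besselS E s f x = ∫ ξ, fchar ξ x * (besselSymbol s ξ * 𝓕 f ξ) := by
  rw [schwartz_eq_integral_fourier]
  simp only [fourier_besselS]

/-- Weighted Fourier transforms of Schwartz functions are integrable. -/
theorem integrable_besselSymbol_mul_fourier (s : ℝ) (f : 𝓢(E, ℂ)) :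
    Integrable fun ξ => (besselSymbol s ξ : ℂ) * 𝓕 f ξ := by
  have := (𝓕 (besselS E s f)).integrable (μ := volume)
  refine this.congr (.of_forall fun ξ => ?_)
  simp only [fourier_besselS]

theorem integral_besselS_mul (s : ℝ) (f g : 𝓢(E, ℂ)) :
    ∫ x, besselS E s f x * g x = ∫ x, f x * besselS E s g x := by
  have key : ∀ u v : 𝓢(E, ℂ), ∫ x, u x * v x = ∫ ξ, 𝓕 u ξ * 𝓕 v (-ξ) := by
    intro u v
    have h1 := SchwartzMap.integral_fourier_mul_eq u (𝓕⁻ v)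
    rw [FourierTransform.fourier_fourierInv_eq] at h1
    rw [← h1]
    refine integral_congr_ae (.of_forall fun x => ?_)
    simp only
    congr 1
  rw [key, key]
  refine integral_congr_ae (.of_forall fun ξ => ?_)
  simp only [fourier_besselS, besselSymbol, norm_neg]
  ring

/-- On tempered distributions, `J^s` is the transpose of `J^s` on Schwartz functions, because the
symbol is even. -/
theorem besselPotential_apply_apply (s : ℝ) (T : 𝓢'(E, ℂ)) (g : 𝓢(E, ℂ)) :
    TemperedDistribution.besselPotential E ℂ s T g = T (besselS E s g) := by
  rw [TemperedDistribution.besselPotential,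
    TemperedDistribution.fourierMultiplierCLM_apply_apply]
  congr 1
  ext x
  have hm := besselSymbol_hasTemperateGrowth (E := E) s
  rw [besselS_apply, fourier_eq_integral_fchar,
    ← integral_neg_eq_self (fun ξ => fchar ξ x * (besselSymbol s ξ * 𝓕 g ξ))]
  refine integral_congr_ae (.of_forall fun ξ => ?_)
  have : (SchwartzMap.smulLeftCLM ℂ (fun x : E => (((1 + ‖x‖ ^ 2) ^ (s / 2) : ℝ) : ℂ)) (𝓕⁻ g)) ξ
      = besselSymbol s ξ * 𝓕⁻ g ξ := by
    rw [SchwartzMap.smulLeftCLM_apply_apply (by simpa only [besselSymbol] using hm)]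
    rfl
  simp only [this]
  rw [SchwartzMap.fourierInv_coe, SchwartzMap.fourier_coe, Real.fourierInv_eq_fourier_neg]
  simp only [besselSymbol, norm_neg]
  rw [show fchar (-x) ξ = fchar (-ξ) x by rw [← fchar_neg_right, fchar_comm]]

theorem besselPotential_coe (s : ℝ) (f : 𝓢(E, ℂ)) :
    TemperedDistribution.besselPotential E ℂ s (f : 𝓢'(E, ℂ)) = (besselS E s f : 𝓢'(E, ℂ)) := by
  ext g
  rw [besselPotential_apply_apply, SchwartzMap.coe_apply, SchwartzMap.coe_apply]
  simp only [smul_eq_mul]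
  exact integral_besselS_mul s g f

/-- The translate `x ↦ f (x - z)` of a Schwartz function. -/
noncomputable abbrev shiftS (z : E) : 𝓢(E, ℂ) →L[ℂ] 𝓢(E, ℂ) := SchwartzMap.compSubConstCLM ℂ z

theorem fourier_shiftS (z : E) (f : 𝓢(E, ℂ)) (ξ : E) :
    𝓕 (shiftS z f) ξ = fchar (-ξ) z * 𝓕 f ξ := by
  rw [fourier_eq_integral_fchar, fourier_eq_integral_fchar, ← integral_const_mul,
    ← integral_add_right_eq_self _ z]
  refine integral_congr_ae (.of_forall fun x => ?_)
  simp only [SchwartzMap.compSubConstCLM_apply, add_sub_cancel_right, fchar_add_right]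
  ring

theorem besselS_shiftS (s : ℝ) (z : E) (f : 𝓢(E, ℂ)) :
    besselS E s (shiftS z f) = shiftS z (besselS E s f) := by
  ext x
  rw [SchwartzMap.compSubConstCLM_apply, besselS_apply, besselS_apply]
  refine integral_congr_ae (.of_forall fun ξ => ?_)
  simp only [fourier_shiftS, sub_eq_add_neg, fchar_add_right, fchar_neg_right]
  ring

theorem eLpNorm_shiftS (z : E) (f : 𝓢(E, ℂ)) (q : ℝ≥0∞) :
    eLpNorm (shiftS z f) q volume = eLpNorm f q volume := by
  have := eLpNorm_comp_measurePreserving (p := q) (g := f) (f := fun x : E => x - z)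
    (μ := volume) (ν := volume) f.continuous.aestronglyMeasurable
    (measurePreserving_sub_right volume z)
  rw [← this]; rfl

/-- The pointwise product of Schwartz functions. -/
noncomputable def mulS (f g : 𝓢(E, ℂ)) : 𝓢(E, ℂ) :=
  SchwartzMap.pairing (ContinuousLinearMap.mul ℂ ℂ) f g

@[simp]
theorem mulS_apply (f g : 𝓢(E, ℂ)) (x : E) : mulS f g x = f x * g x := rfl

end Analysis

/-! ### Schur's test -/

section Schur

variable {X Y : Type*} [MeasurableSpace X] [MeasurableSpace Y]

/-- Hölder's inequality in the form `(∫ k g)^r ≤ (∫ k)^(r-1) ∫ k g^r`, with the first factor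
replaced by a bound. -/
theorem lintegral_mul_rpow_le {ν : Measure Y} {k g : Y → ℝ≥0∞} (hk : AEMeasurable k ν)
    (hg : AEMeasurable g ν) {A : ℝ≥0∞} (hA : ∫⁻ y, k y ∂ν ≤ A) {r : ℝ} (hr : 1 ≤ r) :
    (∫⁻ y, k y * g y ∂ν) ^ r ≤ A ^ (r - 1) * ∫⁻ y, k y * g y ^ r ∂ν := by
  rcases hr.eq_or_lt with rfl | hr
  · simp
  have hr0 : 0 < r := by linarith
  set r' := r.conjExponent with hr'
  have hc : r'.HolderConjugate r := (Real.HolderConjugate.conjExponent hr).symm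
  have h1 : ∫⁻ y, k y * g y ∂ν = ∫⁻ y, ((fun y => k y ^ (1 / r')) *
      ((fun y => k y ^ (1 / r)) * g)) y ∂ν := by
    refine lintegral_congr fun y => ?_
    simp only [Pi.mul_apply]
    rw [← mul_assoc, ← ENNReal.rpow_add_of_nonneg _ _ hc.one_div_nonneg
      hc.symm.one_div_nonneg, one_div, one_div, hc.inv_add_inv_eq_one, ENNReal.rpow_one]
  have h2 := ENNReal.lintegral_mul_le_Lp_mul_Lq ν hc (hk.pow_const (1 / r'))
    ((hk.pow_const (1 / r)).mul hg)
  rw [← h1] at h2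
  have h3 : ∀ y, (k y ^ (1 / r')) ^ r' = k y := fun y => by
    rw [← ENNReal.rpow_mul, one_div_mul_cancel hc.ne_zero, ENNReal.rpow_one]
  have h4 : ∀ y, (k y ^ (1 / r) * g y) ^ r = k y * g y ^ r := fun y => by
    rw [ENNReal.mul_rpow_of_nonneg _ _ hr0.le, ← ENNReal.rpow_mul,
      one_div_mul_cancel hr0.ne', ENNReal.rpow_one]
  simp only [h3, Pi.mul_apply, h4] at h2
  calc (∫⁻ y, k y * g y ∂ν) ^ r
      ≤ ((∫⁻ y, k y ∂ν) ^ (1 / r') * (∫⁻ y, k y * g y ^ r ∂ν) ^ (1 / r)) ^ r := by gcongr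
    _ = (∫⁻ y, k y ∂ν) ^ (r - 1) * ∫⁻ y, k y * g y ^ r ∂ν := by
        rw [ENNReal.mul_rpow_of_nonneg _ _ hr0.le, ← ENNReal.rpow_mul, ← ENNReal.rpow_mul,
          one_div_mul_cancel hr0.ne', ENNReal.rpow_one]
        congr 2
        have := hc.inv_add_inv_eq_one
        have h5 : 1 / r' = 1 - r⁻¹ := by rw [one_div]; linarith
        rw [h5]; field_simp
    _ ≤ _ := by
        have : 0 ≤ r - 1 := by linarith
        gcongr

/-- **Schur's test** on all `L^q`, `1 ≤ q ≤ ∞`: an operator dominated by a nonnegative kernel with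
marginals at most `A` has norm at most `A`. -/
theorem eLpNorm_le_of_schur {μ : Measure X} {ν : Measure Y} [SFinite μ] [SFinite ν]
    {K : X → Y → ℝ≥0∞} (hK : Measurable (Function.uncurry K)) {A : ℝ≥0∞} (hA0 : A ≠ ∞)
    (hA : ∀ x, ∫⁻ y, K x y ∂ν ≤ A) (hB : ∀ y, ∫⁻ x, K x y ∂μ ≤ A)
    {f : Y → ℂ} (hf : AEStronglyMeasurable f ν) {F : X → ℂ}
    (hF : ∀ᵐ x ∂μ, ‖F x‖ₑ ≤ ∫⁻ y, K x y * ‖f y‖ₑ ∂ν) {q : ℝ≥0∞} (hq : 1 ≤ q) :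
    eLpNorm F q μ ≤ A * eLpNorm f q ν := by
  have hKx : ∀ x, Measurable (K x) := fun x => hK.comp measurable_prodMk_left
  by_cases hqt : q = ∞
  · subst hqt
    rw [eLpNorm_exponent_top, eLpNorm_exponent_top]
    refine essSup_le_of_ae_le _ ?_
    filter_upwards [hF] with x hx
    refine hx.trans ?_
    calc ∫⁻ y, K x y * ‖f y‖ₑ ∂ν ≤ ∫⁻ y, K x y * eLpNormEssSup f ν ∂ν := by
          refine lintegral_mono_ae ?_
          filter_upwards [ae_le_eLpNormEssSup (f := f) (μ := ν)] with y hy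
          gcongr
      _ = (∫⁻ y, K x y ∂ν) * eLpNormEssSup f ν := lintegral_mul_const _ (hKx x)
      _ ≤ _ := by gcongr; exact hA x
  have hq0 : q ≠ 0 := (zero_lt_one.trans_le hq).ne'
  set r := q.toReal with hr
  have hr1 : 1 ≤ r := by
    rw [hr, ← ENNReal.toReal_one]; exact ENNReal.toReal_mono hqt hq
  have hr0 : 0 < r := by linarith
  rw [eLpNorm_eq_lintegral_rpow_enorm_toReal hq0 hqt,
    eLpNorm_eq_lintegral_rpow_enorm_toReal hq0 hqt, ← hr]
  have key : ∫⁻ x, ‖F x‖ₑ ^ r ∂μ ≤ A ^ r * ∫⁻ y, ‖f y‖ₑ ^ r ∂ν := by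
    have hfm : AEMeasurable (fun y => ‖f y‖ₑ ^ r) ν := hf.enorm.pow_const r
    calc ∫⁻ x, ‖F x‖ₑ ^ r ∂μ
        ≤ ∫⁻ x, A ^ (r - 1) * ∫⁻ y, K x y * ‖f y‖ₑ ^ r ∂ν ∂μ := by
          refine lintegral_mono_ae ?_
          filter_upwards [hF] with x hx
          calc ‖F x‖ₑ ^ r ≤ (∫⁻ y, K x y * ‖f y‖ₑ ∂ν) ^ r := by gcongr
            _ ≤ _ := lintegral_mul_rpow_le (hKx x).aemeasurable hf.enorm (hA x) hr1
      _ = A ^ (r - 1) * ∫⁻ x, ∫⁻ y, K x y * ‖f y‖ₑ ^ r ∂ν ∂μ := by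
          rw [lintegral_const_mul' _ _ (ENNReal.rpow_ne_top_of_nonneg (by linarith) hA0)]
      _ = A ^ (r - 1) * ∫⁻ y, ∫⁻ x, K x y * ‖f y‖ₑ ^ r ∂μ ∂ν := by
          rw [lintegral_lintegral_swap]
          exact hK.aemeasurable.mul hfm.comp_snd
      _ ≤ A ^ (r - 1) * ∫⁻ y, A * ‖f y‖ₑ ^ r ∂ν := by
          gcongr with y
          rw [lintegral_mul_const _ (hK.of_uncurry_right (y := y))]
          gcongr
          exact hB y
      _ = A ^ (r - 1) * A * ∫⁻ y, ‖f y‖ₑ ^ r ∂ν := by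
          rw [lintegral_const_mul' _ _ hA0, mul_assoc]
      _ = _ := by
          congr 1
          conv_lhs => rw [← ENNReal.rpow_one A, ← ENNReal.rpow_mul, one_mul,
            ← ENNReal.rpow_add_of_nonneg _ _ (by linarith) zero_le_one]
          congr 1; ring
  calc (∫⁻ x, ‖F x‖ₑ ^ r ∂μ) ^ (1 / r) ≤ (A ^ r * ∫⁻ y, ‖f y‖ₑ ^ r ∂ν) ^ (1 / r) := by gcongr
    _ = _ := by
      rw [ENNReal.mul_rpow_of_nonneg _ _ (by positivity), ← ENNReal.rpow_mul,
        mul_one_div_cancel hr0.ne', ENNReal.rpow_one]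

/-- Multiplication by a family of functions which are bounded by `B` and supported in the slices of
a set `S` of overlap at most `M` is bounded from `L^q(Y)` to `L^q(ι × Y)`, for all `1 ≤ q ≤ ∞`. -/
theorem eLpNorm_family_mul_le {ι : Type*} [Countable ι] [MeasurableSpace ι]
    [DiscreteMeasurableSpace ι] {ν : Measure Y} [SFinite ν] {S : Set (ι × Y)}
    (hSm : MeasurableSet S) {B M : ℝ≥0} (hS : ∀ y, Measure.count {i | (i, y) ∈ S} ≤ M)
    {f : Y → ℂ} (hf : AEStronglyMeasurable f ν) {F : ι × Y → ℂ}
    (hF : ∀ x, ‖F x‖ₑ ≤ B * S.indicator (fun _ => 1) x * ‖f x.2‖ₑ)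
    {q : ℝ≥0∞} (hq : 1 ≤ q) :
    eLpNorm F q ((Measure.count : Measure ι).prod ν) ≤ (B * max 1 M : ℝ≥0) * eLpNorm f q ν := by
  have hF' : ∀ x, ‖F x‖ₑ ≤ B * ‖f x.2‖ₑ := fun x => by
    refine (hF x).trans ?_
    gcongr
    refine mul_le_of_le_one_right (by simp) ?_
    exact Set.indicator_le_self' (by simp) x
  by_cases hqt : q = ∞
  · subst hqt
    rw [eLpNorm_exponent_top, eLpNorm_exponent_top]
    refine essSup_le_of_ae_le _ ?_
    have h1 : ∀ᵐ x ∂((Measure.count : Measure ι).prod ν), ‖f x.2‖ₑ ≤ eLpNormEssSup f ν :=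
      Measure.quasiMeasurePreserving_snd.ae (ae_le_eLpNormEssSup (f := f) (μ := ν))
    filter_upwards [h1] with x hx
    refine (hF' x).trans ?_
    push_cast
    gcongr
    exact le_mul_of_one_le_right (by simp) (by simp)
  have hq0 : q ≠ 0 := (zero_lt_one.trans_le hq).ne'
  set r := q.toReal with hr
  have hr1 : 1 ≤ r := by
    rw [hr, ← ENNReal.toReal_one]; exact ENNReal.toReal_mono hqt hq
  have hr0 : 0 < r := by linarith
  rw [eLpNorm_eq_lintegral_rpow_enorm_toReal hq0 hqt,
    eLpNorm_eq_lintegral_rpow_enorm_toReal hq0 hqt, ← hr]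
  have key : ∫⁻ x, ‖F x‖ₑ ^ r ∂((Measure.count : Measure ι).prod ν) ≤
      (B * max 1 M : ℝ≥0) ^ r * ∫⁻ y, ‖f y‖ₑ ^ r ∂ν := by
    have hfm : AEMeasurable (fun y => ‖f y‖ₑ ^ r) ν := hf.enorm.pow_const r
    calc ∫⁻ x, ‖F x‖ₑ ^ r ∂((Measure.count : Measure ι).prod ν)
        ≤ ∫⁻ i, ∫⁻ y, ‖F (i, y)‖ₑ ^ r ∂ν ∂Measure.count := lintegral_prod_le _
      _ ≤ ∫⁻ i, ∫⁻ y, (B : ℝ≥0∞) ^ r * ({i | (i, y) ∈ S}.indicator (fun _ => 1) i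
            * ‖f y‖ₑ ^ r) ∂ν ∂(Measure.count : Measure ι) := by
          gcongr with i y
          refine (ENNReal.rpow_le_rpow (hF (i, y)) hr0.le).trans ?_
          by_cases h : (i, y) ∈ S
          · rw [Set.indicator_of_mem h, Set.indicator_of_mem (by exact h), mul_one, one_mul,
              ENNReal.mul_rpow_of_nonneg _ _ hr0.le]
          · rw [Set.indicator_of_notMem h]
            simp [hr0]
      _ = ∫⁻ y, ∫⁻ i, (B : ℝ≥0∞) ^ r * ({i | (i, y) ∈ S}.indicator (fun _ => 1) i
            * ‖f y‖ₑ ^ r) ∂(Measure.count : Measure ι) ∂ν := by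
          rw [lintegral_lintegral_swap]
          refine AEMeasurable.const_mul (AEMeasurable.mul ?_ hfm.comp_snd) _
          exact ((measurable_const (a := (1 : ℝ≥0∞))).indicator hSm).aemeasurable
      _ ≤ ∫⁻ y, (B : ℝ≥0∞) ^ r * (M * ‖f y‖ₑ ^ r) ∂ν := by
          gcongr with y
          rw [lintegral_const_mul' _ _ (ENNReal.rpow_ne_top_of_nonneg hr0.le (by simp)),
            lintegral_mul_const' _ _ (ENNReal.rpow_ne_top_of_nonneg hr0.le (by simp)),
            lintegral_indicator_const (Set.to_countable _).measurableSet, one_mul]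
          gcongr
          exact hS y
      _ = (B : ℝ≥0∞) ^ r * (M * ∫⁻ y, ‖f y‖ₑ ^ r ∂ν) := by
          rw [lintegral_const_mul' _ _ (ENNReal.rpow_ne_top_of_nonneg hr0.le (by simp)),
            lintegral_const_mul' _ _ (by simp)]
      _ ≤ _ := by
          rw [← mul_assoc]
          gcongr
          push_cast
          rw [ENNReal.mul_rpow_of_nonneg _ _ hr0.le]
          gcongr
          calc (M : ℝ≥0∞) ≤ max 1 (M : ℝ≥0∞) := le_max_right _ _
            _ = (max 1 (M : ℝ≥0∞)) ^ (1 : ℝ) := (ENNReal.rpow_one _).symm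
            _ ≤ _ := ENNReal.rpow_le_rpow_of_exponent_le (le_max_left _ _) hr1
  calc (∫⁻ x, ‖F x‖ₑ ^ r ∂((Measure.count : Measure ι).prod ν)) ^ (1 / r)
      ≤ ((B * max 1 M : ℝ≥0) ^ r * ∫⁻ y, ‖f y‖ₑ ^ r ∂ν) ^ (1 / r) := by gcongr
    _ = _ := by
      rw [ENNReal.mul_rpow_of_nonneg _ _ (by positivity), ← ENNReal.rpow_mul,
        mul_one_div_cancel hr0.ne', ENNReal.rpow_one]

end Schur

section Family

variable {ι Y : Type*} [Countable ι] [MeasurableSpace ι] [DiscreteMeasurableSpace ι]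
  [MeasurableSpace Y] {ν : Measure Y} [SFinite ν]

theorem eLpNorm_component_le {G : ι × Y → ℂ}
    (hG : AEStronglyMeasurable G ((Measure.count : Measure ι).prod ν)) (q : ℝ≥0∞) (i : ι) :
    eLpNorm (fun y => G (i, y)) q ν ≤ eLpNorm G q ((Measure.count : Measure ι).prod ν) := by
  have h1 : (Measure.dirac i).prod ν ≤ (Measure.count : Measure ι).prod ν := by
    refine Measure.le_iff.2 fun s hs => ?_
    rw [Measure.prod_apply hs, Measure.prod_apply hs, lintegral_dirac, lintegral_count]
    exact ENNReal.le_tsum i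
  refine le_trans (le_of_eq ?_) (eLpNorm_mono_measure G h1)
  rw [Measure.dirac_prod, eLpNorm_map_measure _ measurable_prodMk_left.aemeasurable]
  · rfl
  · rw [← Measure.dirac_prod]; exact hG.mono_measure h1

theorem sum_eLpNorm_rpow_le {G : ι × Y → ℂ}
    (hG : AEStronglyMeasurable G ((Measure.count : Measure ι).prod ν)) {q : ℝ≥0∞}
    (hq0 : q ≠ 0) (hqt : q ≠ ∞) (s : Finset ι) :
    (∑ i ∈ s, eLpNorm (fun y => G (i, y)) q ν ^ q.toReal) ^ (1 / q.toReal) ≤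
      eLpNorm G q ((Measure.count : Measure ι).prod ν) := by
  have hr := ENNReal.toReal_pos hq0 hqt
  rw [eLpNorm_eq_lintegral_rpow_enorm_toReal hq0 hqt,
    lintegral_prod _ (hG.enorm.pow_const _), lintegral_count]
  gcongr
  refine le_trans (Finset.sum_le_sum fun i _ => ?_) (ENNReal.sum_le_tsum s)
  rw [eLpNorm_eq_lintegral_rpow_enorm_toReal hq0 hqt, ← ENNReal.rpow_mul,
    one_div_mul_cancel hr.ne', ENNReal.rpow_one]

/-- Hölder's inequality for sums of products of component norms. -/
theorem sum_eLpNorm_mul_le {G H : ι × Y → ℂ}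
    (hG : AEStronglyMeasurable G ((Measure.count : Measure ι).prod ν))
    (hH : AEStronglyMeasurable H ((Measure.count : Measure ι).prod ν))
    {p p' : ℝ≥0∞} (hp1 : 1 ≤ p) (hp : p ≠ ∞) (hpp' : p⁻¹ + p'⁻¹ = 1) (s : Finset ι) :
    ∑ i ∈ s, eLpNorm (fun y => G (i, y)) p ν * eLpNorm (fun y => H (i, y)) p' ν ≤
      eLpNorm G p ((Measure.count : Measure ι).prod ν) *
        eLpNorm H p' ((Measure.count : Measure ι).prod ν) := by
  have hp0 : p ≠ 0 := (zero_lt_one.trans_le hp1).ne'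
  by_cases hp't : p' = ∞
  · have hp1 : p = 1 := by simpa [hp't] using hpp'
    subst hp1
    have h1 := sum_eLpNorm_rpow_le hG one_ne_zero ENNReal.one_ne_top s
    simp only [ENNReal.toReal_one, ENNReal.rpow_one, one_div, inv_one] at h1
    calc _ ≤ ∑ i ∈ s, eLpNorm (fun y => G (i, y)) 1 ν *
          eLpNorm H p' ((Measure.count : Measure ι).prod ν) := by
            gcongr with i; exact eLpNorm_component_le hH _ i
      _ ≤ _ := by rw [← Finset.sum_mul]; gcongr
  have hpos : p'⁻¹ ≠ 0 := by simpa using hp't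
  have hp'0 : p' ≠ 0 := by
    rintro rfl
    simp at hpp'
  have hc : p.toReal.HolderConjugate p'.toReal := by
    have : ENNReal.HolderConjugate p p' := ENNReal.holderConjugate_iff.2 hpp'
    refine Real.holderConjugate_iff.2 ⟨?_, ?_⟩
    · rw [← ENNReal.toReal_one]
      refine (ENNReal.toReal_lt_toReal ENNReal.one_ne_top hp).2 (lt_of_le_of_ne hp1 ?_)
      rintro rfl
      simp [hp't] at hpp'
    · rw [← ENNReal.toReal_inv, ← ENNReal.toReal_inv, ← ENNReal.toReal_add (by simpa) (by simpa),
        hpp', ENNReal.toReal_one]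
  refine (ENNReal.inner_le_Lp_mul_Lq s _ _ hc).trans ?_
  gcongr
  · exact sum_eLpNorm_rpow_le hG hp0 hp s
  · exact sum_eLpNorm_rpow_le hH hp'0 hp't s

end Family

section ConverseHolder

variable {E : Type*} [NormedAddCommGroup E] [InnerProductSpace ℝ E] [FiniteDimensional ℝ E]
  [MeasurableSpace E] [BorelSpace E]

/-! ### Young's inequality -/

/-- **Young's inequality** for an integrable kernel. -/
theorem eLpNorm_le_of_convolution_bound {κ : E → ℝ≥0∞} (hκ : Measurable κ) {A : ℝ≥0∞}
    (hA0 : A ≠ ∞) (hA : ∫⁻ y, κ y ≤ A) {f F : E → ℂ} (hf : AEStronglyMeasurable f volume)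
    (hF : ∀ᵐ x, ‖F x‖ₑ ≤ ∫⁻ y, κ (x - y) * ‖f y‖ₑ) {q : ℝ≥0∞} (hq : 1 ≤ q) :
    eLpNorm F q volume ≤ A * eLpNorm f q volume := by
  refine eLpNorm_le_of_schur (K := fun x y => κ (x - y)) ?_ hA0 (fun x => ?_) (fun y => ?_) hf hF hq
  · exact hκ.comp (measurable_fst.sub measurable_snd)
  · rwa [lintegral_sub_left_eq_self]
  · rwa [lintegral_sub_right_eq_self κ y]

/-! ### The converse of Hölder's inequality -/

/-- Bounded functions of bounded support are approximated by test functions, without increasing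
the `L^q` norms. -/
theorem exists_schwartz_approx {h : E → ℂ} (hm : Measurable h) {B R : ℝ} (hB : ∀ x, ‖h x‖ ≤ B)
    (hR : ∀ x, R < ‖x‖ → h x = 0) :
    ∃ φ : ℕ → 𝓢(E, ℂ), (∀ k, HasCompactSupport (φ k)) ∧ (∀ k x, ‖φ k x‖ ≤ B) ∧
      (∀ k x, R + 1 < ‖x‖ → φ k x = 0) ∧ (∀ᵐ x, Tendsto (fun k => φ k x) atTop (𝓝 (h x))) ∧
      ∀ k (q : ℝ≥0∞), 1 ≤ q → eLpNorm (φ k) q volume ≤ eLpNorm h q volume := by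
  have hB0 : 0 ≤ B := (norm_nonneg _).trans (hB 0)
  have hsupp : ∀ x, x ∉ Metric.closedBall (0 : E) R → h x = 0 := fun x hx => hR x (by simpa using hx)
  have hint : Integrable h := by
    refine (Measure.integrableOn_of_bounded (s := Metric.closedBall (0 : E) R) (M := B)
      measure_closedBall_lt_top.ne hm.aestronglyMeasurable
      (.of_forall hB)).integrable_of_forall_notMem_eq_zero hsupp
  have hcs : HasCompactSupport h := HasCompactSupport.intro (isCompact_closedBall (0 : E) R) hsupp
  let b : ℕ → ContDiffBump (0 : E) := fun k =>
    ⟨1 / (k + 2), 2 / (k + 2), by positivity, by gcongr; norm_num⟩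
  have hb1 : ∀ k, (b k).rOut ≤ 1 := fun k => by
    change (2 : ℝ) / (k + 2) ≤ 1
    rw [div_le_one (by positivity)]; linarith [(Nat.cast_nonneg k : (0 : ℝ) ≤ k)]
  let c : ℕ → E → ℂ := fun k => MeasureTheory.convolution ((b k).normed volume) h
    (ContinuousLinearMap.lsmul ℝ ℝ) volume
  have hc_def : ∀ k x, c k x = ∫ t, (b k).normed volume t • h (x - t) := fun k x => rfl
  have hcd : ∀ k, ContDiff ℝ (⊤ : ℕ∞) (c k) := fun k =>
    (b k).hasCompactSupport_normed.contDiff_convolution_left _ (b k).contDiff_normed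
      hint.locallyIntegrable
  have hcc : ∀ k, HasCompactSupport (c k) := fun k =>
    HasCompactSupport.convolution _ (b k).hasCompactSupport_normed hcs
  have hbound : ∀ k x, ‖c k x‖ ≤ B := fun k x => by
    rw [hc_def]
    calc ‖∫ t, (b k).normed volume t • h (x - t)‖
        ≤ ∫ t, (b k).normed volume t * B := by
          refine norm_integral_le_of_norm_le ((b k).integrable_normed.mul_const B)
            (.of_forall fun t => ?_)
          rw [norm_smul, Real.norm_of_nonneg ((b k).nonneg_normed t)]
          exact mul_le_mul_of_nonneg_left (hB _) ((b k).nonneg_normed t)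
      _ = B := by rw [integral_mul_const, (b k).integral_normed, one_mul]
  refine ⟨fun k => (hcc k).toSchwartzMap (hcd k), hcc, hbound, fun k x hx => ?_, ?_, fun k q hq => ?_⟩
  · change c k x = 0
    rw [hc_def]
    refine integral_eq_zero_of_ae (.of_forall fun t => ?_)
    by_cases ht : t ∈ Function.support ((b k).normed volume)
    · rw [(b k).support_normed_eq] at ht
      have h1 : ‖t‖ < 1 := by
        have := Metric.mem_ball.1 ht
        rw [dist_zero_right] at this
        exact this.trans_le (hb1 k)
      have : h (x - t) = 0 := hR _ (by
        have := norm_sub_norm_le x t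
        linarith)
      simp [this]
    · simp [Function.notMem_support.1 ht]
  · refine ContDiffBump.ae_convolution_tendsto_right_of_locallyIntegrable (K := 2) ?_
      (.of_forall fun k => ?_) hint.locallyIntegrable
    · change Tendsto (fun k : ℕ => (2 : ℝ) / (k + 2)) atTop (𝓝 0)
      exact tendsto_const_nhds.div_atTop (tendsto_atTop_add_const_right _ _
        tendsto_natCast_atTop_atTop)
    · change (2 : ℝ) / (k + 2) ≤ 2 * (1 / (k + 2))
      rw [mul_one_div]
  · have h1 : ∫⁻ y, ENNReal.ofReal ((b k).normed volume y) = 1 := by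
      rw [← ofReal_integral_eq_lintegral_ofReal (b k).integrable_normed
        (.of_forall (b k).nonneg_normed), (b k).integral_normed, ENNReal.ofReal_one]
    have := eLpNorm_le_of_convolution_bound (q := q) (F := c k)
      (κ := fun y => ENNReal.ofReal ((b k).normed volume y))
      ((b k).continuous_normed.measurable.ennreal_ofReal) ENNReal.one_ne_top h1.le
      hm.aestronglyMeasurable (.of_forall fun x => ?_) hq
    · rwa [one_mul] at this
    · rw [hc_def]
      refine (enorm_integral_le_lintegral_enorm _).trans (le_of_eq ?_)
      rw [← lintegral_sub_left_eq_self _ x]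
      refine lintegral_congr fun y => ?_
      rw [enorm_smul, sub_sub_cancel, Real.enorm_eq_ofReal ((b k).nonneg_normed _)]

/-- A bound for the pairing of `g` with test functions extends to nonnegative bounded weights of
bounded support. -/
theorem lintegral_mul_le_of_schwartz_pairing {g : E → ℂ} (hg : LocallyIntegrable g volume)
    (hgm : Measurable g) {q' : ℝ≥0∞} (hq' : 1 ≤ q') {C : ℝ≥0}
    (h : ∀ φ : 𝓢(E, ℂ), HasCompactSupport φ →
      ‖∫ x, g x * φ x‖ₑ ≤ C * eLpNorm φ q' volume)
    {w : E → ℝ} (hw : Measurable w) (hw0 : ∀ x, 0 ≤ w x) {B R : ℝ} (hB : ∀ x, w x ≤ B)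
    (hR : ∀ x, R < ‖x‖ → w x = 0) :
    ∫⁻ x, ‖g x‖ₑ * ENNReal.ofReal (w x) ≤ C * eLpNorm w q' volume := by
  -- the conjugate phase of `g`; it is `0` where `g` vanishes
  let σ : E → ℂ := fun x => (starRingEnd ℂ) (g x) / ‖g x‖
  have hσ1 : ∀ x, ‖σ x‖ ≤ 1 := fun x => by
    simp only [σ, norm_div, RCLike.norm_conj, Complex.norm_real, norm_norm]
    exact div_self_le_one _
  have hgσ : ∀ x, g x * σ x = (‖g x‖ : ℂ) := fun x => by
    simp only [σ]
    by_cases h0 : g x = 0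
    · simp [h0]
    · rw [mul_div_assoc', Complex.mul_conj, Complex.normSq_eq_norm_sq]
      push_cast
      rw [sq, mul_div_assoc, div_self (by simpa using h0), mul_one]
  let k : E → ℂ := fun x => σ x * w x
  have hσm : Measurable σ := by
    refine Measurable.div ?_ ?_
    · exact Complex.continuous_conj.measurable.comp hgm
    · exact Complex.measurable_ofReal.comp hgm.norm
  have hkm : Measurable k := hσm.mul (Complex.measurable_ofReal.comp hw)
  have hkw : ∀ x, ‖k x‖ ≤ w x := fun x => by
    simp only [k, norm_mul, Complex.norm_real, Real.norm_of_nonneg (hw0 x)]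
    exact mul_le_of_le_one_left (hw0 x) (hσ1 x)
  have hk0 : ∀ x, R < ‖x‖ → k x = 0 := fun x hx => by simp [k, hR x hx]
  obtain ⟨φ, hφc, hφB, hφR, hφt, hφq⟩ :=
    exists_schwartz_approx hkm (fun x => (hkw x).trans (hB x)) hk0
  have hgB : Integrable ((Metric.closedBall (0 : E) (R + 1)).indicator fun x => ‖g x‖ * B) := by
    rw [integrable_indicator_iff measurableSet_closedBall]
    exact (hg.integrableOn_isCompact (isCompact_closedBall _ _)).norm.mul_const B
  have hlim : Tendsto (fun n => ∫ x, g x * φ n x) atTop (𝓝 (∫ x, g x * k x)) := by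
    refine tendsto_integral_of_dominated_convergence _ (fun n => ?_) hgB
      (fun n => .of_forall fun x => ?_) ?_
    · exact (hgm.mul (φ n).continuous.measurable).aestronglyMeasurable
    · by_cases hx : x ∈ Metric.closedBall (0 : E) (R + 1)
      · rw [Set.indicator_of_mem hx, norm_mul]
        exact mul_le_mul_of_nonneg_left (hφB n x) (norm_nonneg _)
      · rw [Set.indicator_of_notMem hx, hφR n x (by simpa using hx)]; simp
    · filter_upwards [hφt] with x hx
      exact hx.const_mul _
  have hle : ‖∫ x, g x * k x‖ₑ ≤ C * eLpNorm w q' volume := by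
    refine le_of_tendsto (hlim.enorm) (.of_forall fun n => ?_)
    refine (h _ (hφc n)).trans ?_
    gcongr
    refine (hφq n q' hq').trans (eLpNorm_mono_real hkw)
  have heq : ∫ x, g x * k x = ((∫ x, ‖g x‖ * w x : ℝ) : ℂ) := by
    rw [← integral_complex_ofReal]
    refine integral_congr_ae (.of_forall fun x => ?_)
    simp only [k, ← mul_assoc, hgσ]; push_cast; rfl
  have hi : Integrable fun x => ‖g x‖ * w x := by
    refine hgB.mono' (hgm.norm.mul hw).aestronglyMeasurable (.of_forall fun x => ?_)
    rw [norm_mul, norm_norm, Real.norm_of_nonneg (hw0 x)]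
    by_cases hx : x ∈ Metric.closedBall (0 : E) (R + 1)
    · rw [Set.indicator_of_mem hx]
      exact mul_le_mul_of_nonneg_left (hB x) (norm_nonneg _)
    · rw [Set.indicator_of_notMem hx, hR x (by
        have : R + 1 < ‖x‖ := by simpa using hx
        linarith), mul_zero]
  have h0 : 0 ≤ᵐ[volume] fun x => ‖g x‖ * w x :=
    .of_forall fun x => mul_nonneg (norm_nonneg _) (hw0 x)
  rw [heq, ← ofReal_norm, Complex.norm_real, Real.norm_of_nonneg (integral_nonneg_of_ae h0),
    ofReal_integral_eq_lintegral_ofReal hi h0] at hle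
  refine le_trans (le_of_eq ?_) hle
  refine lintegral_congr fun x => ?_
  rw [ENNReal.ofReal_mul (norm_nonneg _), ofReal_norm]

/-- **Converse of Hölder's inequality**, for all exponents `1 ≤ q ≤ ∞`, tested on smooth functions
of compact support only. That `g` is known in advance to be a function is what makes the
statement true for `q = 1`. -/
theorem eLpNorm_le_of_schwartz_pairing {g : E → ℂ} (hg : LocallyIntegrable g volume)
    {q q' : ℝ≥0∞} (hqq' : q⁻¹ + q'⁻¹ = 1) {C : ℝ≥0}
    (h : ∀ φ : 𝓢(E, ℂ), HasCompactSupport φ →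
      ‖∫ x, g x * φ x‖ₑ ≤ C * eLpNorm φ q' volume) :
    eLpNorm g q volume ≤ C := by
  wlog hgm : Measurable g generalizing g
  · have hae := hg.aestronglyMeasurable.ae_eq_mk
    rw [eLpNorm_congr_ae hae]
    refine this (g := hg.aestronglyMeasurable.mk g) ?_ (fun φ hφ => ?_)
      hg.aestronglyMeasurable.stronglyMeasurable_mk.measurable
    · exact hg.congr hae
    · refine le_of_eq_of_le ?_ (h φ hφ)
      congr 1
      exact integral_congr_ae (hae.mono fun x hx => by simp only [← hx])
  have hconj : ENNReal.HolderConjugate q q' := ENNReal.holderConjugate_iff.2 hqq'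
  have hq1 : 1 ≤ q := hconj.one_le
  have hq'1 : 1 ≤ q' := hconj.symm.one_le
  by_cases hqt : q = ∞
  · have hq'1 : q' = 1 := by simpa [hqt] using hqq'
    subst hqt hq'1
    rw [eLpNorm_exponent_top]
    refine essSup_le_of_ae_le _ ?_
    -- the weight is the indicator of a bounded part of the set where `|g|` exceeds `C`
    let A : ℕ → Set E := fun m => {x | ‖x‖ ≤ m ∧ C < ‖g x‖ₑ}
    have hAm : ∀ m, MeasurableSet (A m) := fun m =>
      (measurableSet_le measurable_norm measurable_const).inter
        (measurableSet_lt measurable_const hgm.enorm)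
    have hA0 : ∀ m, volume (A m) = 0 := by
      intro m
      have h1 := lintegral_mul_le_of_schwartz_pairing hg hgm le_rfl h
        (w := (A m).indicator fun _ => 1) (measurable_const.indicator (hAm m))
        (fun x => Set.indicator_nonneg (by simp) x) (B := 1) (R := m)
        (fun x => Set.indicator_le_self' (by simp) x)
        (fun x hx => Set.indicator_of_notMem (fun hxA => absurd hxA.1 (by linarith)) _)
      have h2 : ∀ x, ‖g x‖ₑ * ENNReal.ofReal ((A m).indicator (fun _ => (1 : ℝ)) x) =
          (A m).indicator (fun x => ‖g x‖ₑ) x := fun x => by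
        by_cases hx : x ∈ A m <;> simp [hx]
      have hfin : volume (A m) ≠ ∞ := by
        refine ((measure_mono fun x hx => ?_).trans_lt
          (measure_closedBall_lt_top (x := (0 : E)) (r := m))).ne
        simpa using hx.1
      simp only [h2] at h1
      rw [lintegral_indicator (hAm m), eLpNorm_indicator_const (hAm m) one_ne_zero
        ENNReal.one_ne_top] at h1
      by_contra hne
      have h3 : ∫⁻ _ in A m, (C : ℝ≥0∞) < ∫⁻ x in A m, ‖g x‖ₑ := by
        refine setLIntegral_strict_mono (hAm m) hne hgm.enorm ?_ (.of_forall fun x hx => hx.2)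
        simp only [lintegral_const, Measure.restrict_apply MeasurableSet.univ, Set.univ_inter]
        exact ENNReal.mul_ne_top (by simp) hfin
      rw [lintegral_const, Measure.restrict_apply MeasurableSet.univ, Set.univ_inter] at h3
      simp only [enorm_one, ENNReal.toReal_one, div_one, ENNReal.rpow_one, one_mul] at h1
      exact absurd h3 (not_lt.2 h1)
    have hU : volume (⋃ m, A m) = 0 := measure_iUnion_null hA0
    refine measure_mono_null (fun x hx => ?_) hU
    obtain ⟨m, hm⟩ := exists_nat_ge ‖x‖
    exact Set.mem_iUnion.2 ⟨m, hm, not_le.1 hx⟩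
  have hq0 : q ≠ 0 := (zero_lt_one.trans_le hq1).ne'
  set r := q.toReal with hr
  have hr1 : 1 ≤ r := by
    rw [hr, ← ENNReal.toReal_one]; exact ENNReal.toReal_mono hqt hq1
  have hr0 : 0 < r := by linarith
  rw [eLpNorm_eq_lintegral_rpow_enorm_toReal hq0 hqt, ← hr]
  -- the weight is `|g|^{r-1}`, truncated to a bounded set on which `g` is bounded; the truncation
  -- makes the integral of `|g|^r` finite, so that it can be cancelled
  let A : ℕ → Set E := fun m => {x | ‖x‖ ≤ m ∧ ‖g x‖ ≤ m}
  have hAm : ∀ m, MeasurableSet (A m) := fun m =>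
    (measurableSet_le measurable_norm measurable_const).inter
      (measurableSet_le hgm.norm measurable_const)
  have hI : ∀ m, (∫⁻ x in A m, ‖g x‖ₑ ^ r) ^ (1 / r) ≤ C := by
    intro m
    set I := ∫⁻ x in A m, ‖g x‖ₑ ^ r with hIdef
    have h1 := lintegral_mul_le_of_schwartz_pairing hg hgm hq'1 h
      (w := (A m).indicator fun x => ‖g x‖ ^ (r - 1)) ((hgm.norm.pow_const _).indicator (hAm m))
      (fun x => Set.indicator_nonneg (fun x _ => by positivity) x) (B := (m : ℝ) ^ (r - 1)) (R := m)
      (fun x => by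
        by_cases hx : x ∈ A m
        · rw [Set.indicator_of_mem hx]
          exact Real.rpow_le_rpow (norm_nonneg _) hx.2 (by linarith)
        · rw [Set.indicator_of_notMem hx]; positivity)
      (fun x hx => Set.indicator_of_notMem (fun hxA => absurd hxA.1 (by linarith)) _)
    have h2 : ∀ x, ‖g x‖ₑ * ENNReal.ofReal ((A m).indicator (fun x => ‖g x‖ ^ (r - 1)) x) =
        (A m).indicator (fun x => ‖g x‖ₑ ^ r) x := fun x => by
      by_cases hx : x ∈ A m
      · rw [Set.indicator_of_mem hx, Set.indicator_of_mem hx,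
          ← ENNReal.ofReal_rpow_of_nonneg (norm_nonneg _) (by linarith), ofReal_norm]
        conv_lhs => rw [← ENNReal.rpow_one ‖g x‖ₑ, ← ENNReal.rpow_mul, one_mul,
          ← ENNReal.rpow_add_of_nonneg _ _ zero_le_one (by linarith)]
        congr 1; ring
      · simp [hx]
    simp only [h2] at h1
    rw [lintegral_indicator (hAm m), ← hIdef] at h1
    have hIfin : I ≠ ∞ := by
      refine (lt_of_le_of_lt (setLIntegral_mono_ae' (g := fun _ => (ENNReal.ofReal m) ^ r)
        (hAm m) (.of_forall fun x hx => ?_)) ?_).ne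
      · gcongr
        rw [← ofReal_norm]
        exact ENNReal.ofReal_le_ofReal hx.2
      · rw [lintegral_const, Measure.restrict_apply MeasurableSet.univ, Set.univ_inter]
        refine ENNReal.mul_lt_top (ENNReal.rpow_lt_top_of_nonneg hr0.le (by simp)) ?_
        refine (measure_mono fun x hx => ?_).trans_lt
          (measure_closedBall_lt_top (x := (0 : E)) (r := m))
        simpa using hx.1
    by_cases hq't : q' = ∞
    · have hqe : q = 1 := by simpa [hq't] using hqq'
      have hre : r = 1 := by rw [hr, hqe, ENNReal.toReal_one]
      have h3 : eLpNorm ((A m).indicator fun x => ‖g x‖ ^ (r - 1)) q' volume ≤ 1 := by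
        rw [hq't, eLpNorm_exponent_top]
        refine essSup_le_of_ae_le _ (.of_forall fun x => ?_)
        by_cases hx : x ∈ A m <;> simp [hx, hre]
      rw [hre, div_one, ENNReal.rpow_one]
      calc I ≤ _ := h1
        _ ≤ C * 1 := by gcongr
        _ = C := mul_one _
    · have hq'0 : q' ≠ 0 := (zero_lt_one.trans_le hq'1).ne'
      set r' := q'.toReal with hr'
      have hr'0 : 0 < r' := ENNReal.toReal_pos hq'0 hq't
      have hsum : r⁻¹ + r'⁻¹ = 1 := by
        rw [hr, hr', ← ENNReal.toReal_inv, ← ENNReal.toReal_inv,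
          ← ENNReal.toReal_add (by simpa) (by simpa), hqq', ENNReal.toReal_one]
      have h3 : eLpNorm ((A m).indicator fun x => ‖g x‖ ^ (r - 1)) q' volume = I ^ (1 / r') := by
        rw [eLpNorm_eq_lintegral_rpow_enorm_toReal hq'0 hq't, ← hr', hIdef,
          ← lintegral_indicator (hAm m)]
        congr 1
        refine lintegral_congr fun x => ?_
        by_cases hx : x ∈ A m
        · rw [Set.indicator_of_mem hx, Set.indicator_of_mem hx, ← ofReal_norm,
            Real.norm_of_nonneg (by positivity),
            ← ENNReal.ofReal_rpow_of_nonneg (norm_nonneg _) (by linarith), ofReal_norm,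
            ← ENNReal.rpow_mul]
          congr 1
          field_simp at hsum
          linarith
        · simp [hx, hr'0]
      rw [h3] at h1
      by_cases hI0 : I = 0
      · rw [hI0, ENNReal.zero_rpow_of_pos (by positivity)]; exact zero_le
      have hIr : I ^ (1 / r') ≠ 0 := by
        simp [hI0, hIfin]
      have hIrt : I ^ (1 / r') ≠ ∞ := ENNReal.rpow_ne_top_of_nonneg (by positivity) hIfin
      have h4 : I ^ (1 / r) * I ^ (1 / r') = I := by
        rw [← ENNReal.rpow_add_of_nonneg _ _ (by positivity) (by positivity), one_div, one_div,
          hsum, ENNReal.rpow_one]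
      exact (ENNReal.mul_le_mul_iff_left hIr hIrt).1 (h4.le.trans h1)
  have hmono : Monotone A := fun i j hij x hx =>
    ⟨hx.1.trans (by exact_mod_cast hij), hx.2.trans (by exact_mod_cast hij)⟩
  have hUn : ⋃ m, A m = Set.univ := Set.eq_univ_of_forall fun x => by
    obtain ⟨m, hm⟩ := exists_nat_ge (max ‖x‖ ‖g x‖)
    exact Set.mem_iUnion.2 ⟨m, (le_max_left _ _).trans hm, (le_max_right _ _).trans hm⟩
  have hsup : ∫⁻ x, ‖g x‖ₑ ^ r = ⨆ m, ∫⁻ x in A m, ‖g x‖ₑ ^ r := by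
    rw [← setLIntegral_univ, ← hUn, setLIntegral_iUnion_of_directed _ hmono.directed_le]
  rw [one_div, ENNReal.rpow_inv_le_iff hr0, hsup]
  refine iSup_le fun m => ?_
  have := hI m
  rwa [one_div, ENNReal.rpow_inv_le_iff hr0] at this

end ConverseHolder

section Heat

variable {E : Type*} [NormedAddCommGroup E] [InnerProductSpace ℝ E] [FiniteDimensional ℝ E]
  [MeasurableSpace E] [BorelSpace E]

/-! ### The heat semigroup -/

/-- The Gaussian with Fourier transform `e^{-τ|ξ|²}`. -/
noncomputable def heatKernel (τ : ℝ) (y : E) : ℝ :=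
  (π / τ) ^ (Module.finrank ℝ E / 2 : ℝ) * rexp (-(π ^ 2 / τ) * ‖y‖ ^ 2)

theorem heatKernel_nonneg {τ : ℝ} (hτ : 0 < τ) (y : E) : 0 ≤ heatKernel τ y := by
  unfold heatKernel; positivity

theorem measurable_heatKernel : Measurable fun q : ℝ × E => heatKernel q.1 q.2 := by
  unfold heatKernel; fun_prop

theorem continuous_heatKernel (τ : ℝ) : Continuous (heatKernel τ : E → ℝ) := by
  unfold heatKernel; fun_prop

theorem integral_heatKernel {τ : ℝ} (hτ : 0 < τ) : ∫ y : E, heatKernel τ y = 1 := by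
  simp only [heatKernel]
  rw [integral_const_mul, GaussianFourier.integral_rexp_neg_mul_sq_norm (by positivity),
    ← Real.mul_rpow (by positivity) (by positivity)]
  rw [show π / τ * (π / (π ^ 2 / τ)) = 1 by field_simp, Real.one_rpow]

theorem integrable_heatKernel {τ : ℝ} (hτ : 0 < τ) : Integrable (heatKernel τ : E → ℝ) :=
  .of_integral_ne_zero (by rw [integral_heatKernel hτ]; exact one_ne_zero)

theorem lintegral_heatKernel {τ : ℝ} (hτ : 0 < τ) :
    ∫⁻ y : E, ENNReal.ofReal (heatKernel τ y) = 1 := by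
  rw [← ofReal_integral_eq_lintegral_ofReal (integrable_heatKernel hτ)
    (.of_forall (heatKernel_nonneg hτ)), integral_heatKernel hτ, ENNReal.ofReal_one]

theorem integral_heatKernel_fchar {τ : ℝ} (hτ : 0 < τ) (ξ : E) :
    ∫ y : E, (heatKernel τ y : ℂ) * fchar (-ξ) y = rexp (-τ * ‖ξ‖ ^ 2) := by
  have h := GaussianFourier.integral_cexp_neg_mul_sq_norm_add (V := E) (b := ((π ^ 2 / τ : ℝ) : ℂ))
    (by rw [Complex.ofReal_re]; positivity) (-(2 * π * Complex.I)) ξ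
  have h1 : ∀ y : E, (heatKernel τ y : ℂ) * fchar (-ξ) y =
      (((π / τ) ^ (Module.finrank ℝ E / 2 : ℝ) : ℝ) : ℂ) *
      Complex.exp (-((π ^ 2 / τ : ℝ) : ℂ) * ‖y‖ ^ 2 + -(2 * π * Complex.I) * inner ℝ ξ y) := by
    intro y
    simp only [heatKernel, fchar, inner_neg_left, Complex.ofReal_mul, Complex.ofReal_exp]
    rw [mul_assoc, ← Complex.exp_add]
    congr 2; push_cast; ring
  simp only [h1]
  rw [integral_const_mul, h]
  have h2 : ((π : ℂ) / ((π ^ 2 / τ : ℝ) : ℂ)) ^ ((Module.finrank ℝ E : ℂ) / 2) =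
      (((τ / π) ^ (Module.finrank ℝ E / 2 : ℝ) : ℝ) : ℂ) := by
    rw [Complex.ofReal_cpow (by positivity)]
    push_cast
    congr 1
    have : (π : ℂ) ≠ 0 := by exact_mod_cast Real.pi_ne_zero
    have : (τ : ℂ) ≠ 0 := by exact_mod_cast hτ.ne'
    field_simp
  rw [h2, ← mul_assoc, ← Complex.ofReal_mul, ← Real.mul_rpow (by positivity) (by positivity),
    show π / τ * (τ / π) = 1 by field_simp, Real.one_rpow, Complex.ofReal_one, one_mul,
    Complex.ofReal_exp]
  congr 1
  have : (π : ℂ) ≠ 0 := by exact_mod_cast Real.pi_ne_zero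
  have : (τ : ℂ) ≠ 0 := by exact_mod_cast hτ.ne'
  push_cast
  have hI : (-(2 * (π : ℂ) * Complex.I)) ^ 2 = -(4 * π ^ 2) := by
    rw [neg_sq, mul_pow, Complex.I_sq]; ring
  rw [hI]
  field_simp

/-- The constant in the moment bounds of the heat kernel. -/
noncomputable def heatConst (E : Type*) [NormedAddCommGroup E] [InnerProductSpace ℝ E] : ℝ :=
  2 ^ (Module.finrank ℝ E / 2 : ℝ)

theorem heatConst_pos : 0 < heatConst E := by unfold heatConst; positivity

/-- Moments of the heat kernel are dominated by the heat kernel at the doubled time. -/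
theorem sq_norm_mul_heatKernel_le {τ : ℝ} (hτ : 0 < τ) (y : E) :
    ‖y‖ ^ 2 * heatKernel τ y ≤ heatConst E * τ * heatKernel (2 * τ) y := by
  have h1 : (π / τ) ^ (Module.finrank ℝ E / 2 : ℝ) = heatConst E *
      (π / (2 * τ)) ^ (Module.finrank ℝ E / 2 : ℝ) := by
    rw [heatConst, ← Real.mul_rpow (by positivity) (by positivity)]
    congr 1; field_simp
  set t := π ^ 2 / (2 * τ) * ‖y‖ ^ 2 with ht
  have h2 : -(π ^ 2 / τ) * ‖y‖ ^ 2 = -t + -t := by rw [ht]; field_simp; ring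
  have h3 : ‖y‖ ^ 2 = 2 * τ / π ^ 2 * t := by rw [ht]; field_simp
  have h4 : t * rexp (-t) ≤ 1 := by
    rw [Real.exp_neg, ← div_eq_mul_inv, div_le_one (Real.exp_pos _)]
    linarith [Real.add_one_le_exp t]
  have h5 : 2 / π ^ 2 ≤ 1 := by
    rw [div_le_one (by positivity)]
    nlinarith [Real.pi_gt_three]
  have ht0 : 0 ≤ t := by positivity
  unfold heatKernel
  rw [show -(π ^ 2 / (2 * τ)) * ‖y‖ ^ 2 = -t by rw [ht]; ring, h2, Real.exp_add, h1]
  calc ‖y‖ ^ 2 * (heatConst E * (π / (2 * τ)) ^ (Module.finrank ℝ E / 2 : ℝ) *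
        (rexp (-t) * rexp (-t)))
      = (heatConst E * τ * ((π / (2 * τ)) ^ (Module.finrank ℝ E / 2 : ℝ) * rexp (-t))) *
        ((2 / π ^ 2) * (t * rexp (-t))) := by rw [h3]; ring
    _ ≤ (heatConst E * τ * ((π / (2 * τ)) ^ (Module.finrank ℝ E / 2 : ℝ) * rexp (-t))) * 1 := by
        have := heatConst_pos (E := E)
        refine mul_le_mul_of_nonneg_left ?_ (by positivity)
        exact mul_le_one₀ h5 (by positivity) h4
    _ = _ := mul_one _

theorem norm_mul_heatKernel_le {τ : ℝ} (hτ : 0 < τ) (y : E) :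
    ‖y‖ * heatKernel τ y ≤ √τ * (heatConst E * heatKernel (2 * τ) y + heatKernel τ y) := by
  have h0 := heatKernel_nonneg hτ y
  have h1 := sq_norm_mul_heatKernel_le hτ y
  have hs : 0 < √τ := Real.sqrt_pos.2 hτ
  have hsq : √τ * √τ = τ := Real.mul_self_sqrt hτ.le
  have h2 : √τ * ‖y‖ ≤ ‖y‖ ^ 2 + τ := by nlinarith [sq_nonneg (‖y‖ - √τ), norm_nonneg y]
  have h3 : √τ * (‖y‖ * heatKernel τ y) ≤
      √τ * (√τ * (heatConst E * heatKernel (2 * τ) y + heatKernel τ y)) := by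
    calc √τ * (‖y‖ * heatKernel τ y) = (√τ * ‖y‖) * heatKernel τ y := by ring
      _ ≤ (‖y‖ ^ 2 + τ) * heatKernel τ y := by gcongr
      _ ≤ heatConst E * τ * heatKernel (2 * τ) y + τ * heatKernel τ y := by rw [add_mul]; gcongr
      _ = √τ * √τ * (heatConst E * heatKernel (2 * τ) y + heatKernel τ y) := by rw [hsq]; ring
      _ = _ := by ring
  exact le_of_mul_le_mul_left h3 hs

theorem lintegral_sq_norm_mul_heatKernel_le {τ : ℝ} (hτ : 0 < τ) :
    ∫⁻ y : E, ENNReal.ofReal (‖y‖ ^ 2 * heatKernel τ y) ≤ ENNReal.ofReal (heatConst E * τ) := by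
  have hc := heatConst_pos (E := E)
  calc ∫⁻ y : E, ENNReal.ofReal (‖y‖ ^ 2 * heatKernel τ y)
      ≤ ∫⁻ y : E, ENNReal.ofReal (heatConst E * τ) * ENNReal.ofReal (heatKernel (2 * τ) y) := by
        gcongr with y
        rw [← ENNReal.ofReal_mul (by positivity)]
        exact ENNReal.ofReal_le_ofReal (sq_norm_mul_heatKernel_le hτ y)
    _ = _ := by
        rw [lintegral_const_mul' _ _ ENNReal.ofReal_ne_top, lintegral_heatKernel (by positivity),
          mul_one]

theorem lintegral_norm_mul_heatKernel_le {τ : ℝ} (hτ : 0 < τ) :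
    ∫⁻ y : E, ENNReal.ofReal (‖y‖ * heatKernel τ y) ≤
      ENNReal.ofReal ((heatConst E + 1) * √τ) := by
  have hc := heatConst_pos (E := E)
  have h2 : 0 < 2 * τ := by positivity
  calc ∫⁻ y : E, ENNReal.ofReal (‖y‖ * heatKernel τ y)
      ≤ ∫⁻ y : E, ENNReal.ofReal (√τ * (heatConst E * heatKernel (2 * τ) y + heatKernel τ y)) := by
        exact lintegral_mono fun y => ENNReal.ofReal_le_ofReal (norm_mul_heatKernel_le hτ y)
    _ = ENNReal.ofReal (∫ y : E, √τ * (heatConst E * heatKernel (2 * τ) y + heatKernel τ y)) := by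
        rw [ofReal_integral_eq_lintegral_ofReal]
        · exact (((integrable_heatKernel h2).const_mul _).add (integrable_heatKernel hτ)).const_mul _
        · refine .of_forall fun y => ?_
          have := heatKernel_nonneg hτ y
          have := heatKernel_nonneg h2 y
          simp only [Pi.zero_apply]
          positivity
    _ = _ := by
        rw [integral_const_mul, integral_add ((integrable_heatKernel h2).const_mul _)
          (integrable_heatKernel hτ), integral_const_mul, integral_heatKernel h2,
          integral_heatKernel hτ]
        congr 1; ring

theorem integrable_norm_mul_heatKernel {τ : ℝ} (hτ : 0 < τ) :
    Integrable fun y : E => ‖y‖ * heatKernel τ y := by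
  refine ⟨(continuous_norm.mul (continuous_heatKernel τ)).aestronglyMeasurable, ?_⟩
  rw [hasFiniteIntegral_iff_ofReal (.of_forall fun y =>
    mul_nonneg (norm_nonneg y) (heatKernel_nonneg hτ y))]
  exact (lintegral_norm_mul_heatKernel_le hτ).trans_lt ENNReal.ofReal_lt_top

/-- The heat operator `e^{τΔ/(4π²)}` applied to a Schwartz function. -/
noncomputable def heat (τ : ℝ) (u : 𝓢(E, ℂ)) (x : E) : ℂ :=
  ∫ y, heatKernel τ y * u (x - y)

theorem exists_norm_le_schwartz (u : 𝓢(E, ℂ)) : ∃ B, 0 ≤ B ∧ ∀ x, ‖u x‖ ≤ B :=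
  ⟨SchwartzMap.seminorm ℝ 0 0 u, apply_nonneg _ _, SchwartzMap.norm_le_seminorm ℝ u⟩

theorem integrable_mul_schwartz {κ : E → ℝ} (hκ : Integrable κ) (u : 𝓢(E, ℂ)) (x : E) :
    Integrable fun y => (κ y : ℂ) * u (x - y) := by
  obtain ⟨B, -, hB⟩ := exists_norm_le_schwartz u
  refine hκ.ofReal.mul_bdd (c := B) ?_ (.of_forall fun y => hB _)
  exact (u.continuous.comp (continuous_const.sub continuous_id)).aestronglyMeasurable

theorem heat_eq_fourier {τ : ℝ} (hτ : 0 < τ) (u : 𝓢(E, ℂ)) (x : E) :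
    heat τ u x = ∫ ξ, rexp (-τ * ‖ξ‖ ^ 2) * (fchar ξ x * 𝓕 u ξ) := by
  have hi : Integrable (fun q : E × E => (heatKernel τ q.1 : ℂ) * (fchar q.2 (x - q.1) * 𝓕 u q.2))
      (volume.prod volume) := by
    have h1 := (integrable_heatKernel (E := E) hτ).ofReal (𝕜 := ℂ) |>.mul_prod
      ((𝓕 u).integrable (μ := volume))
    have h2 : Continuous fun q : E × E => fchar q.2 (x - q.1) :=
      continuous_fchar.comp (continuous_snd.prodMk (continuous_const.sub continuous_fst))
    refine (h1.bdd_mul (c := 1) h2.aestronglyMeasurable (.of_forall fun q => (norm_fchar _ _).le)).congr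
      (.of_forall fun q => ?_)
    simp only [Complex.coe_algebraMap]; ring
  have h1 : heat τ u x = ∫ y, ∫ ξ, (heatKernel τ y : ℂ) * (fchar ξ (x - y) * 𝓕 u ξ) := by
    unfold heat
    refine integral_congr_ae (.of_forall fun y => ?_)
    simp only
    rw [integral_const_mul, ← schwartz_eq_integral_fourier]
  rw [h1, integral_integral_swap hi]
  refine integral_congr_ae (.of_forall fun ξ => ?_)
  simp only
  rw [← integral_heatKernel_fchar hτ, ← integral_mul_const]
  refine integral_congr_ae (.of_forall fun y => ?_)
  simp only [sub_eq_add_neg, fchar_add_right, fchar_neg_right]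
  ring

open LineDeriv in
/-- The first moment of the heat kernel against a Schwartz function is the heat flow of a
derivative: `y g_τ(y)` is a multiple of `τ ∇g_τ(y)`. -/
theorem integral_inner_mul_heatKernel {τ : ℝ} (hτ : 0 < τ) (u : 𝓢(E, ℂ)) (v x : E) :
    ∫ y, ((inner ℝ y v * heatKernel τ y : ℝ) : ℂ) * u (x - y) =
      -(τ / (2 * π ^ 2) : ℝ) * heat τ (∂_{v} u) x := by
  have hd : ∀ y : E, HasFDerivAt (heatKernel τ : E → ℝ)
      ((heatKernel τ y * (-(2 * π ^ 2 / τ))) • (innerSL ℝ y)) y := by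
    intro y
    have h1 : HasFDerivAt (fun y : E => -(π ^ 2 / τ) * ‖y‖ ^ 2)
        ((-(π ^ 2 / τ)) • (2 • innerSL ℝ y)) y :=
      (hasStrictFDerivAt_norm_sq y).hasFDerivAt.const_mul _
    have h2 := (h1.exp.const_mul ((π / τ) ^ (Module.finrank ℝ E / 2 : ℝ)))
    refine h2.congr_fderiv ?_
    ext z
    simp [heatKernel]
    ring
  have hdc : ∀ y : E, HasFDerivAt (fun y : E => (heatKernel τ y : ℂ))
      (Complex.ofRealCLM.comp ((heatKernel τ y * (-(2 * π ^ 2 / τ))) • (innerSL ℝ y))) y :=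
    fun y => Complex.ofRealCLM.hasFDerivAt.comp y (hd y)
  have hu : ∀ y : E, HasFDerivAt (fun y : E => u (x - y)) (-(fderiv ℝ u (x - y))) y := by
    intro y
    have h1 : HasFDerivAt (fun y : E => x - y) (-ContinuousLinearMap.id ℝ E) y :=
      (hasFDerivAt_id y).const_sub x
    have h2 := (u.hasFDerivAt (x - y)).comp y h1
    refine h2.congr_fderiv ?_
    ext z; simp
  have hm1 : Integrable fun y : E => inner ℝ y v * heatKernel τ y := by
    refine ((integrable_norm_mul_heatKernel hτ).const_mul ‖v‖).mono' ?_ (.of_forall fun y => ?_)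
    · exact ((continuous_id.inner continuous_const).mul
        (continuous_heatKernel τ)).aestronglyMeasurable
    · rw [norm_mul, Real.norm_of_nonneg (heatKernel_nonneg hτ y), ← mul_assoc]
      gcongr
      · exact heatKernel_nonneg hτ y
      · rw [mul_comm]; exact norm_inner_le_norm y v
  have hip := integral_bilinear_hasFDerivAt_right_eq_neg_left_of_integrable (μ := volume)
    (f := fun y : E => (heatKernel τ y : ℂ)) (g := fun y : E => u (x - y)) (v := v)
    (B := ContinuousLinearMap.mul ℝ ℂ)
    (f' := fun y => Complex.ofRealCLM.comp ((heatKernel τ y * (-(2 * π ^ 2 / τ))) • (innerSL ℝ y)))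
    (g' := fun y => -(fderiv ℝ u (x - y))) ?_ ?_ ?_ (fun y _ => hdc y) (fun y _ => hu y)
  · simp only [ContinuousLinearMap.mul_apply', neg_apply, mul_neg,
      integral_neg, neg_inj] at hip
    have h1 : heat τ (∂_{v} u) x = ∫ y, (heatKernel τ y : ℂ) * fderiv ℝ u (x - y) v := by
      unfold heat
      simp only [SchwartzMap.lineDerivOp_apply_eq_fderiv]
    rw [h1, hip, ← integral_const_mul]
    refine integral_congr_ae (.of_forall fun y => ?_)
    simp only [ContinuousLinearMap.comp_apply, smul_apply, innerSL_apply_apply,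
      Complex.ofRealCLM_apply, smul_eq_mul]
    push_cast
    have : (π : ℂ) ≠ 0 := by exact_mod_cast Real.pi_ne_zero
    have : (τ : ℂ) ≠ 0 := by exact_mod_cast hτ.ne'
    field_simp
  · refine (integrable_mul_schwartz (hm1.const_mul (-(2 * π ^ 2 / τ))) u x).congr
      (.of_forall fun y => ?_)
    simp only [ContinuousLinearMap.comp_apply, smul_apply, innerSL_apply_apply,
      Complex.ofRealCLM_apply, smul_eq_mul, ContinuousLinearMap.mul_apply']
    push_cast; ring
  · refine (integrable_mul_schwartz (integrable_heatKernel hτ) (-(∂_{v} u)) x).congr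
      (.of_forall fun y => ?_)
    simp [SchwartzMap.lineDerivOp_apply_eq_fderiv]
  · exact integrable_mul_schwartz (integrable_heatKernel hτ) u x

end Heat

section Subordination

variable {E : Type*} [NormedAddCommGroup E] [InnerProductSpace ℝ E] [FiniteDimensional ℝ E]
  [MeasurableSpace E] [BorelSpace E]

/-! ### Bessel potentials through the heat semigroup -/

/-- Superpositions of heat flows, evaluated on the Fourier side. -/
theorem integral_superposition {k : ℝ → E → ℝ} (hk : Measurable (Function.uncurry k))
    {w : ℝ → ℝ} (hw : IntegrableOn w (Set.Ioi 0)) {s : ℝ}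
    (hkw : ∀ τ, 0 < τ → ∀ ξ, |k τ ξ| ≤ w τ * besselSymbol s ξ) (u : 𝓢(E, ℂ)) (x : E) :
    IntegrableOn (fun τ => ∫ ξ, (k τ ξ : ℂ) * (fchar ξ x * 𝓕 u ξ)) (Set.Ioi 0) ∧
    ∫ τ in Set.Ioi 0, ∫ ξ, (k τ ξ : ℂ) * (fchar ξ x * 𝓕 u ξ) =
      ∫ ξ, ((∫ τ in Set.Ioi 0, k τ ξ : ℝ) : ℂ) * (fchar ξ x * 𝓕 u ξ) := by
  have hi : Integrable (fun q : ℝ × E => (k q.1 q.2 : ℂ) * (fchar q.2 x * 𝓕 u q.2))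
      ((volume.restrict (Set.Ioi 0)).prod volume) := by
    have h1 := hw.norm.mul_prod (integrable_besselSymbol_mul_fourier s u).norm
    refine h1.mono' ?_ ?_
    · refine Measurable.aestronglyMeasurable ?_
      refine (Complex.measurable_ofReal.comp hk).mul ?_
      exact (((continuous_fchar_left x).mul (𝓕 u).continuous).measurable).comp measurable_snd
    · have hpos : ∀ᵐ q : ℝ × E ∂((volume.restrict (Set.Ioi 0)).prod volume), 0 < q.1 :=
        Measure.quasiMeasurePreserving_fst.ae (ae_restrict_mem measurableSet_Ioi)
      filter_upwards [hpos] with q hq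
      have hs := besselSymbol_pos s q.2
      rw [norm_mul, norm_mul, norm_fchar, one_mul, Complex.norm_real, norm_mul, Complex.norm_real,
        Real.norm_of_nonneg hs.le, ← mul_assoc]
      refine mul_le_mul_of_nonneg_right ?_ (norm_nonneg _)
      refine (hkw q.1 hq q.2).trans ?_
      gcongr
      exact le_abs_self _
  refine ⟨hi.integral_prod_left, ?_⟩
  rw [integral_integral_swap hi]
  refine integral_congr_ae (.of_forall fun ξ => ?_)
  simp only
  rw [integral_mul_const, integral_complex_ofReal]

theorem one_le_one_add_sq_norm (ξ : E) : 1 ≤ 1 + ‖ξ‖ ^ 2 := by nlinarith [norm_nonneg ξ]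

theorem integrableOn_rpow_mul_exp_neg {a : ℝ} (ha : 0 < a) :
    IntegrableOn (fun τ : ℝ => τ ^ (a - 1) * rexp (-τ)) (Set.Ioi 0) := by
  have h := Real.integral_rpow_mul_exp_neg_mul_Ioi ha one_pos
  simp only [one_mul] at h
  refine Integrable.of_integral_ne_zero ?_
  rw [h]
  have := Real.Gamma_pos_of_pos ha
  positivity

theorem integral_rpow_mul_exp_neg {a : ℝ} (ha : 0 < a) :
    ∫ τ in Set.Ioi 0, τ ^ (a - 1) * rexp (-τ) = Gamma a := by
  have h := Real.integral_rpow_mul_exp_neg_mul_Ioi ha one_pos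
  simpa using h

/-- `J^{-b}` as a superposition of heat flows. -/
theorem besselS_neg_eq_integral_heat {b : ℝ} (hb : 0 < b) (u : 𝓢(E, ℂ)) (x : E) :
    IntegrableOn (fun τ => ((τ ^ (b / 2 - 1) * rexp (-τ) : ℝ) : ℂ) * heat τ u x) (Set.Ioi 0) ∧
    ∫ τ in Set.Ioi 0, ((τ ^ (b / 2 - 1) * rexp (-τ) : ℝ) : ℂ) * heat τ u x =
      Gamma (b / 2) * besselS E (-b) u x := by
  have hb2 : 0 < b / 2 := by positivity
  have h := integral_superposition (E := E)
    (k := fun τ ξ => τ ^ (b / 2 - 1) * rexp (-((1 + ‖ξ‖ ^ 2) * τ)))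
    (by unfold Function.uncurry; fun_prop) (integrableOn_rpow_mul_exp_neg hb2) (s := 0)
    (fun τ hτ ξ => by
      rw [abs_of_nonneg (by positivity), besselSymbol_zero, mul_one]
      gcongr
      nlinarith [one_le_one_add_sq_norm ξ]) u x
  have h1 : Set.EqOn (fun τ => ∫ ξ, ((τ ^ (b / 2 - 1) * rexp (-((1 + ‖ξ‖ ^ 2) * τ)) : ℝ) : ℂ) *
      (fchar ξ x * 𝓕 u ξ)) (fun τ => ((τ ^ (b / 2 - 1) * rexp (-τ) : ℝ) : ℂ) * heat τ u x)
      (Set.Ioi 0) := by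
    intro τ hτ
    simp only
    rw [heat_eq_fourier hτ, ← integral_const_mul]
    refine integral_congr_ae (.of_forall fun ξ => ?_)
    simp only
    rw [show -((1 + ‖ξ‖ ^ 2) * τ) = -τ + -τ * ‖ξ‖ ^ 2 by ring, Real.exp_add]
    push_cast; ring
  refine ⟨h.1.congr_fun h1 measurableSet_Ioi, ?_⟩
  rw [← setIntegral_congr_fun measurableSet_Ioi h1, h.2, besselS_apply, ← integral_const_mul]
  refine integral_congr_ae (.of_forall fun ξ => ?_)
  simp only
  rw [Real.integral_rpow_mul_exp_neg_mul_Ioi hb2 (by positivity), besselSymbol, one_div,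
    ← Real.rpow_neg_one, ← Real.rpow_mul (by positivity),
    show -1 * (b / 2) = -b / 2 by ring]
  push_cast; ring

/-- The normalizing constant in the formula for `J^s`, `0 < s < 2`; it is negative. -/
noncomputable def fracConst (s : ℝ) : ℝ := ∫ τ in Set.Ioi 0, τ ^ (-(s / 2) - 1) * (rexp (-τ) - 1)

theorem integrableOn_rpow_mul_min {s : ℝ} (hs0 : 0 < s) (hs2 : s < 2) :
    IntegrableOn (fun τ : ℝ => τ ^ (-(s / 2) - 1) * min 1 τ) (Set.Ioi 0) := by
  rw [← Set.Ioc_union_Ioi_eq_Ioi zero_le_one]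
  refine IntegrableOn.union ?_ ?_
  · have : IntegrableOn (fun τ : ℝ => τ ^ (-(s / 2))) (Set.Ioc 0 1) := by
      rw [← intervalIntegrable_iff_integrableOn_Ioc_of_le zero_le_one]
      exact intervalIntegral.intervalIntegrable_rpow' (by linarith)
    refine this.congr_fun (fun τ hτ => ?_) measurableSet_Ioc
    simp only
    rw [min_eq_right hτ.2]
    conv_rhs => rw [← Real.rpow_one τ, ← Real.rpow_mul hτ.1.le, one_mul, ← Real.rpow_add hτ.1]
    congr 1; ring
  · refine (integrableOn_Ioi_rpow_of_lt (a := -(s / 2) - 1) (by linarith) one_pos).congr_fun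
      (fun τ hτ => ?_) measurableSet_Ioi
    simp only
    rw [min_eq_left (le_of_lt hτ), mul_one]

theorem abs_exp_neg_sub_one_le {τ : ℝ} (hτ : 0 < τ) {l : ℝ} (hl : 1 ≤ l) :
    |rexp (-(l * τ)) - 1| ≤ min 1 τ * l := by
  have h0 : 0 < l * τ := by positivity
  rw [abs_of_nonpos (by linarith [Real.exp_le_one_iff.2 (by linarith : -(l * τ) ≤ 0)])]
  rcases le_total τ 1 with h | h
  · rw [min_eq_right h]; nlinarith [Real.add_one_le_exp (-(l * τ))]
  · rw [min_eq_left h]; linarith [Real.exp_pos (-(l * τ))]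

theorem integral_rpow_mul_exp_sub_one {s l : ℝ} (hl : 0 < l) :
    ∫ τ in Set.Ioi 0, τ ^ (-(s / 2) - 1) * (rexp (-(l * τ)) - 1) = l ^ (s / 2) * fracConst s := by
  have h := integral_comp_mul_left_Ioi (fun τ => τ ^ (-(s / 2) - 1) * (rexp (-τ) - 1)) 0 hl
  simp only [mul_zero] at h
  change _ = l⁻¹ • fracConst s at h
  have h2 : ∫ τ in Set.Ioi 0, (l * τ) ^ (-(s / 2) - 1) * (rexp (-(l * τ)) - 1) =
      l ^ (-(s / 2) - 1) * ∫ τ in Set.Ioi 0, τ ^ (-(s / 2) - 1) * (rexp (-(l * τ)) - 1) := by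
    rw [← integral_const_mul]
    refine setIntegral_congr_fun measurableSet_Ioi fun τ hτ => ?_
    rw [Real.mul_rpow hl.le (le_of_lt hτ)]; ring
  rw [h2, smul_eq_mul, Real.rpow_sub hl, Real.rpow_neg hl.le, Real.rpow_one] at h
  have : l ^ (s / 2) ≠ 0 := (Real.rpow_pos_of_pos hl _).ne'
  generalize ∫ τ in Set.Ioi 0, τ ^ (-(s / 2) - 1) * (rexp (-(l * τ)) - 1) = I at h ⊢
  field_simp at h
  linarith

theorem fracConst_ne_zero {s : ℝ} (hs0 : 0 < s) (hs2 : s < 2) : fracConst s ≠ 0 := by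
  have hpos : 0 < ∫ τ in Set.Ioi 0, -(τ ^ (-(s / 2) - 1) * (rexp (-τ) - 1)) := by
    have h0 : ∀ τ ∈ Set.Ioi (0 : ℝ), 0 < -(τ ^ (-(s / 2) - 1) * (rexp (-τ) - 1)) := by
      intro τ hτ
      have hτ' : (0 : ℝ) < τ := hτ
      have : rexp (-τ) < 1 := Real.exp_lt_one_iff.2 (by linarith)
      have := Real.rpow_pos_of_pos hτ' (-(s / 2) - 1)
      nlinarith
    rw [setIntegral_pos_iff_support_of_nonneg_ae]
    · have : Function.support (fun τ : ℝ => -(τ ^ (-(s / 2) - 1) * (rexp (-τ) - 1))) ∩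
          Set.Ioi 0 = Set.Ioi 0 := Set.inter_eq_right.2 fun τ hτ => (h0 τ hτ).ne'
      rw [this]; simp
    · filter_upwards [ae_restrict_mem measurableSet_Ioi] with τ hτ using (h0 τ hτ).le
    · refine (integrableOn_rpow_mul_min hs0 hs2).mono' (by fun_prop) ?_
      filter_upwards [ae_restrict_mem measurableSet_Ioi] with τ hτ
      have hτ' : (0 : ℝ) < τ := hτ
      have h1 := abs_exp_neg_sub_one_le hτ' le_rfl
      rw [one_mul, mul_one] at h1
      rw [norm_neg, norm_mul, Real.norm_of_nonneg (by positivity)]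
      gcongr
      exact h1
  rw [integral_neg] at hpos
  unfold fracConst
  intro h
  rw [h] at hpos
  simp at hpos

/-- `J^s`, `0 < s < 2`, as a superposition of differences of heat flows. -/
theorem besselS_eq_integral_heat_sub {s : ℝ} (hs0 : 0 < s) (hs2 : s < 2) (u : 𝓢(E, ℂ)) (x : E) :
    IntegrableOn (fun τ => ((τ ^ (-(s / 2) - 1) : ℝ) : ℂ) * (rexp (-τ) * heat τ u x - u x))
      (Set.Ioi 0) ∧
    ∫ τ in Set.Ioi 0, ((τ ^ (-(s / 2) - 1) : ℝ) : ℂ) * (rexp (-τ) * heat τ u x - u x) =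
      fracConst s * besselS E s u x := by
  have h := integral_superposition (E := E)
    (k := fun τ ξ => τ ^ (-(s / 2) - 1) * (rexp (-((1 + ‖ξ‖ ^ 2) * τ)) - 1))
    (by unfold Function.uncurry; fun_prop) (integrableOn_rpow_mul_min hs0 hs2) (s := 2)
    (fun τ hτ ξ => by
      rw [abs_mul, abs_of_nonneg (by positivity), mul_assoc]
      gcongr
      simpa [besselSymbol] using abs_exp_neg_sub_one_le hτ (one_le_one_add_sq_norm ξ)) u x
  have h1 : Set.EqOn (fun τ => ∫ ξ, ((τ ^ (-(s / 2) - 1) *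
      (rexp (-((1 + ‖ξ‖ ^ 2) * τ)) - 1) : ℝ) : ℂ) * (fchar ξ x * 𝓕 u ξ))
      (fun τ => ((τ ^ (-(s / 2) - 1) : ℝ) : ℂ) * (rexp (-τ) * heat τ u x - u x))
      (Set.Ioi 0) := by
    intro τ hτ
    have hτ' : (0 : ℝ) < τ := hτ
    have hu : Integrable fun ξ => fchar ξ x * 𝓕 u ξ :=
      ((𝓕 u).integrable (μ := volume)).bdd_mul (c := 1)
        (continuous_fchar_left x).aestronglyMeasurable (.of_forall fun ξ => (norm_fchar _ _).le)
    have hg : Integrable fun ξ => ((rexp (-τ * ‖ξ‖ ^ 2) : ℝ) : ℂ) * (fchar ξ x * 𝓕 u ξ) := by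
      refine hu.bdd_mul (c := 1) (by fun_prop) (.of_forall fun ξ => ?_)
      rw [Complex.norm_real, Real.norm_of_nonneg (Real.exp_pos _).le]
      exact Real.exp_le_one_iff.2 (by nlinarith [sq_nonneg ‖ξ‖])
    simp only
    rw [heat_eq_fourier hτ', schwartz_eq_integral_fourier u x, ← integral_const_mul,
      ← integral_sub (hg.const_mul _) hu, ← integral_const_mul]
    refine integral_congr_ae (.of_forall fun ξ => ?_)
    simp only
    rw [show -((1 + ‖ξ‖ ^ 2) * τ) = -τ + -τ * ‖ξ‖ ^ 2 by ring, Real.exp_add]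
    push_cast; ring
  refine ⟨h.1.congr_fun h1 measurableSet_Ioi, ?_⟩
  rw [← setIntegral_congr_fun measurableSet_Ioi h1, h.2, besselS_apply, ← integral_const_mul]
  refine integral_congr_ae (.of_forall fun ξ => ?_)
  simp only
  rw [integral_rpow_mul_exp_sub_one (by positivity), besselSymbol]
  push_cast; ring

/-- The convolution kernel of `J^{-b}`, `b > 0`. -/
noncomputable def besselKernel (b : ℝ) (y : E) : ℝ :=
  (Gamma (b / 2))⁻¹ * ∫ τ in Set.Ioi 0, τ ^ (b / 2 - 1) * rexp (-τ) * heatKernel τ y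

theorem besselKernel_nonneg {b : ℝ} (hb : 0 < b) (y : E) : 0 ≤ besselKernel b y := by
  have := Real.Gamma_pos_of_pos (half_pos hb)
  refine mul_nonneg (by positivity) (setIntegral_nonneg measurableSet_Ioi fun τ hτ => ?_)
  have hτ' : (0 : ℝ) < τ := hτ
  have := heatKernel_nonneg hτ' y
  positivity

theorem integrable_rpow_mul_exp_mul_heatKernel {b : ℝ} (hb : 0 < b) :
    Integrable (fun q : ℝ × E => q.1 ^ (b / 2 - 1) * rexp (-q.1) * heatKernel q.1 q.2)
      ((volume.restrict (Set.Ioi 0)).prod volume) := by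
  have hm : Measurable (fun q : ℝ × E => q.1 ^ (b / 2 - 1) * rexp (-q.1) * heatKernel q.1 q.2) :=
    Measurable.mul (by fun_prop) measurable_heatKernel
  refine (integrable_prod_iff hm.aestronglyMeasurable).2 ⟨?_, ?_⟩
  · filter_upwards [ae_restrict_mem measurableSet_Ioi] with τ hτ
    exact (integrable_heatKernel hτ).const_mul _
  · refine (integrableOn_rpow_mul_exp_neg (half_pos hb)).congr_fun (fun τ hτ => ?_)
      measurableSet_Ioi
    have hτ' : (0 : ℝ) < τ := hτ
    have h1 : ∀ y : E, ‖τ ^ (b / 2 - 1) * rexp (-τ) * heatKernel τ y‖ =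
        τ ^ (b / 2 - 1) * rexp (-τ) * heatKernel τ y := fun y => by
      have := heatKernel_nonneg hτ' y
      exact Real.norm_of_nonneg (by positivity)
    simp only [h1]
    rw [integral_const_mul, integral_heatKernel hτ', mul_one]

theorem integrable_besselKernel {b : ℝ} (hb : 0 < b) :
    Integrable (besselKernel b : E → ℝ) :=
  ((integrable_rpow_mul_exp_mul_heatKernel hb).integral_prod_right).const_mul _

theorem integral_besselKernel {b : ℝ} (hb : 0 < b) : ∫ y : E, besselKernel b y = 1 := by
  unfold besselKernel
  rw [integral_const_mul, ← integral_integral_swap (integrable_rpow_mul_exp_mul_heatKernel hb)]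
  have h1 : ∫ τ in Set.Ioi 0, ∫ y : E, τ ^ (b / 2 - 1) * rexp (-τ) * heatKernel τ y =
      ∫ τ in Set.Ioi 0, τ ^ (b / 2 - 1) * rexp (-τ) := by
    refine setIntegral_congr_fun measurableSet_Ioi fun τ hτ => ?_
    rw [integral_const_mul, integral_heatKernel hτ, mul_one]
  rw [h1, integral_rpow_mul_exp_neg (half_pos hb),
    inv_mul_cancel₀ (Real.Gamma_pos_of_pos (half_pos hb)).ne']

/-- `J^{-b}`, `b > 0`, is convolution with the Bessel kernel, an integral of heat kernels. -/
theorem besselS_neg_eq_convolution {b : ℝ} (hb : 0 < b) (u : 𝓢(E, ℂ)) (x : E) :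
    besselS E (-b) u x = ∫ y, besselKernel b y * u (x - y) := by
  have hG : (Gamma (b / 2) : ℂ) ≠ 0 := by
    exact_mod_cast (Real.Gamma_pos_of_pos (half_pos hb)).ne'
  have h := (besselS_neg_eq_integral_heat hb u x).2
  obtain ⟨B, -, hB⟩ := exists_norm_le_schwartz u
  have hi : Integrable (fun q : ℝ × E =>
      ((q.1 ^ (b / 2 - 1) * rexp (-q.1) * heatKernel q.1 q.2 : ℝ) : ℂ) * u (x - q.2))
      ((volume.restrict (Set.Ioi 0)).prod volume) := by
    refine (integrable_rpow_mul_exp_mul_heatKernel hb).ofReal.mul_bdd (c := B) ?_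
      (.of_forall fun q => hB _)
    exact (u.continuous.comp (continuous_const.sub continuous_snd)).aestronglyMeasurable
  have h1 : ∫ τ in Set.Ioi 0, ((τ ^ (b / 2 - 1) * rexp (-τ) : ℝ) : ℂ) * heat τ u x =
      ∫ y, (∫ τ in Set.Ioi 0, ((τ ^ (b / 2 - 1) * rexp (-τ) * heatKernel τ y : ℝ) : ℂ)) *
        u (x - y) := by
    simp only [← integral_mul_const]
    rw [← integral_integral_swap hi]
    refine setIntegral_congr_fun measurableSet_Ioi fun τ hτ => ?_
    simp only [heat]
    rw [← integral_const_mul]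
    refine integral_congr_ae (.of_forall fun y => ?_)
    simp only
    push_cast; ring
  rw [h1] at h
  rw [← mul_right_inj' hG, ← h, ← integral_const_mul]
  refine integral_congr_ae (.of_forall fun y => ?_)
  simp only [besselKernel]
  rw [integral_complex_ofReal]
  push_cast
  field_simp

theorem besselKernel_neg (b : ℝ) (y : E) : besselKernel b (-y) = besselKernel b y := by
  simp [besselKernel, heatKernel]

theorem lintegral_besselKernel {b : ℝ} (hb : 0 < b) :
    ∫⁻ y : E, ENNReal.ofReal (besselKernel b y) = 1 := by
  rw [← ofReal_integral_eq_lintegral_ofReal (integrable_besselKernel hb)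
    (.of_forall (besselKernel_nonneg hb)), integral_besselKernel hb, ENNReal.ofReal_one]

theorem measurable_besselKernel (b : ℝ) : Measurable (besselKernel b : E → ℝ) := by
  unfold besselKernel
  have hm : StronglyMeasurable
      (fun q : E × ℝ => q.2 ^ (b / 2 - 1) * rexp (-q.2) * heatKernel q.2 q.1) :=
    (Measurable.mul (by fun_prop) (measurable_heatKernel.comp measurable_swap)).stronglyMeasurable
  exact (hm.integral_prod_right (ν := volume.restrict (Set.Ioi 0))).measurable.const_mul _

/-- `J^{-b}`, `b ≥ 0`, is a contraction on all `L^q`. -/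
theorem eLpNorm_besselS_neg_le {b : ℝ} (hb : 0 ≤ b) (u : 𝓢(E, ℂ)) {q : ℝ≥0∞} (hq : 1 ≤ q) :
    eLpNorm (besselS E (-b) u) q volume ≤ eLpNorm u q volume := by
  rcases hb.eq_or_lt with rfl | hb
  · simp
  have := eLpNorm_le_of_convolution_bound (q := q) (F := besselS E (-b) u) (f := u)
    (κ := fun y => ENNReal.ofReal (besselKernel b y))
    (measurable_besselKernel b).ennreal_ofReal ENNReal.one_ne_top (lintegral_besselKernel hb).le
    u.continuous.aestronglyMeasurable (.of_forall fun x => ?_) hq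
  · rwa [one_mul] at this
  · rw [besselS_neg_eq_convolution hb]
    refine (enorm_integral_le_lintegral_enorm _).trans (le_of_eq ?_)
    rw [← lintegral_sub_left_eq_self _ x]
    refine lintegral_congr fun y => ?_
    rw [enorm_mul, sub_sub_cancel, ← ofReal_norm, Complex.norm_real,
      Real.norm_of_nonneg (besselKernel_nonneg hb _)]

end Subordination

section Commutator

variable {E : Type*} [NormedAddCommGroup E] [InnerProductSpace ℝ E] [FiniteDimensional ℝ E]
  [MeasurableSpace E] [BorelSpace E]

open LineDeriv

/-! ### Commutators of Bessel potentials with multiplications -/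

theorem besselS_lineDeriv (s : ℝ) (v : E) (f : 𝓢(E, ℂ)) :
    besselS E s (∂_{v} f) = ∂_{v} (besselS E s f) := by
  have hg : (fun ξ : E => ((inner ℝ ξ v : ℝ) : ℂ)).HasTemperateGrowth := by fun_prop
  have h : ∀ f : 𝓢(E, ℂ), ∂_{v} f = (2 * π * Complex.I) •
      SchwartzMap.fourierMultiplierCLM ℂ (fun ξ : E => ((inner ℝ ξ v : ℝ) : ℂ)) f := fun f => by
    rw [SchwartzMap.lineDeriv_eq_fourierMultiplierCLM]
    congr 1
    exact (SchwartzMap.fourierMultiplierCLM_ofReal ℂ (by fun_prop) f).symm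
  rw [h, h, map_smul, besselS,
    SchwartzMap.fourierMultiplierCLM_fourierMultiplierCLM_apply (besselSymbol_hasTemperateGrowth s)
      hg, SchwartzMap.fourierMultiplierCLM_fourierMultiplierCLM_apply hg
      (besselSymbol_hasTemperateGrowth s)]
  congr 3
  exact mul_comm _ _

/-- An integral of convolutions over a time parameter is the convolution with the integral of the
kernels. -/
theorem lintegral_subordination {k : ℝ → E → ℝ≥0∞} (hk : Measurable (Function.uncurry k))
    {h : E → ℝ≥0∞} (hh : Measurable h) (x : E) :
    ∫⁻ τ in Set.Ioi 0, ∫⁻ y, k τ y * h (x - y) =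
      ∫⁻ y, (∫⁻ τ in Set.Ioi 0, k τ (x - y)) * h y := by
  rw [lintegral_lintegral_swap (by
    refine (hk.mul ?_).aemeasurable
    exact hh.comp (measurable_const.sub measurable_snd))]
  rw [← lintegral_sub_left_eq_self _ x]
  refine lintegral_congr fun y => ?_
  rw [sub_sub_cancel, lintegral_mul_const _ (hk.of_uncurry_right)]

theorem measurable_lintegral_subordination {k : ℝ → E → ℝ≥0∞}
    (hk : Measurable (Function.uncurry k)) :
    Measurable fun y => ∫⁻ τ in Set.Ioi 0, k τ y := by
  have : Measurable (fun q : E × ℝ => k q.2 q.1) := hk.comp measurable_swap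
  exact this.lintegral_prod_right'

/-- `∇J^{-2}` is bounded on all `L^q`, including the endpoints. -/
theorem exists_eLpNorm_besselS_neg_two_lineDeriv_le (v : E) :
    ∃ C : ℝ≥0, ∀ q : ℝ≥0∞, 1 ≤ q → ∀ f : 𝓢(E, ℂ),
      eLpNorm (besselS E (-2) (∂_{v} f)) q volume ≤ C * eLpNorm f q volume := by
  let k : ℝ → E → ℝ≥0∞ := fun τ y =>
    ENNReal.ofReal (rexp (-τ) * (2 * π ^ 2 / τ * ‖v‖) * (‖y‖ * heatKernel τ y))
  have hk : Measurable (Function.uncurry k) := by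
    refine Measurable.ennreal_ofReal (Measurable.mul (by fun_prop) (Measurable.mul (by fun_prop) ?_))
    exact measurable_heatKernel
  have hc := heatConst_pos (E := E)
  have htot : ∫⁻ y, ∫⁻ τ in Set.Ioi 0, k τ y ≤
      ENNReal.ofReal (2 * π ^ 2 * ‖v‖ * (heatConst E + 1) * Gamma (1 / 2)) := by
    rw [← lintegral_lintegral_swap hk.aemeasurable]
    calc ∫⁻ τ in Set.Ioi 0, ∫⁻ y, k τ y
        ≤ ∫⁻ τ in Set.Ioi 0, ENNReal.ofReal (2 * π ^ 2 * ‖v‖ * (heatConst E + 1) *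
            (τ ^ ((1 / 2 : ℝ) - 1) * rexp (-τ))) := by
          refine setLIntegral_mono' measurableSet_Ioi fun τ hτ => ?_
          have hτ' : (0 : ℝ) < τ := hτ
          have h1 : ∀ y : E, k τ y = ENNReal.ofReal (rexp (-τ) * (2 * π ^ 2 / τ * ‖v‖)) *
              ENNReal.ofReal (‖y‖ * heatKernel τ y) := fun y => by
            rw [← ENNReal.ofReal_mul (by positivity)]
          simp only [h1]
          rw [lintegral_const_mul' _ _ ENNReal.ofReal_ne_top]
          refine (mul_le_mul_right (lintegral_norm_mul_heatKernel_le hτ') _).trans (le_of_eq ?_)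
          rw [← ENNReal.ofReal_mul (by positivity)]
          congr 1
          rw [Real.rpow_sub hτ', Real.rpow_one, ← Real.sqrt_eq_rpow]
          field_simp
      _ = _ := by
          rw [← ofReal_integral_eq_lintegral_ofReal]
          · rw [integral_const_mul, integral_rpow_mul_exp_neg (by norm_num)]
          · exact (integrableOn_rpow_mul_exp_neg (by norm_num)).const_mul _
          · filter_upwards [ae_restrict_mem measurableSet_Ioi] with τ hτ
            have hτ' : (0 : ℝ) < τ := hτ
            simp only [Pi.zero_apply]
            positivity
  refine ⟨(2 * π ^ 2 * ‖v‖ * (heatConst E + 1) * Gamma (1 / 2)).toNNReal, fun q hq f => ?_⟩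
  refine eLpNorm_le_of_convolution_bound (measurable_lintegral_subordination hk) (by simp) htot
    f.continuous.aestronglyMeasurable (.of_forall fun x => ?_) hq
  have h1 := (besselS_neg_eq_integral_heat (E := E) two_pos (∂_{v} f) x).2
  rw [show (2 : ℝ) / 2 = 1 by norm_num, Real.Gamma_one, Complex.ofReal_one, one_mul] at h1
  rw [← h1, ← lintegral_subordination hk (h := fun y => ‖f y‖ₑ) f.continuous.measurable.enorm x]
  refine (enorm_integral_le_lintegral_enorm _).trans ?_
  refine setLIntegral_mono' measurableSet_Ioi fun τ hτ => ?_
  have hτ' : (0 : ℝ) < τ := hτ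
  have h2 : heat τ (∂_{v} f) x = (-(2 * π ^ 2 / τ) : ℝ) *
      ∫ y, ((inner ℝ y v * heatKernel τ y : ℝ) : ℂ) * f (x - y) := by
    rw [integral_inner_mul_heatKernel hτ', ← mul_assoc]
    have : (π : ℂ) ≠ 0 := by exact_mod_cast Real.pi_ne_zero
    have : (τ : ℂ) ≠ 0 := by exact_mod_cast hτ'.ne'
    push_cast
    field_simp
  rw [h2, ← mul_assoc, ← integral_const_mul]
  refine (enorm_integral_le_lintegral_enorm _).trans (lintegral_mono fun y => ?_)
  rw [← mul_assoc, enorm_mul]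
  gcongr
  simp only [k]
  rw [← Complex.ofReal_mul, ← Complex.ofReal_mul, ← ofReal_norm, Complex.norm_real, norm_mul,
    norm_mul, norm_mul, norm_mul]
  refine ENNReal.ofReal_le_ofReal ?_
  rw [sub_self, Real.rpow_zero, norm_one, one_mul, Real.norm_of_nonneg (Real.exp_pos _).le,
    norm_neg, Real.norm_of_nonneg (by positivity), Real.norm_of_nonneg (heatKernel_nonneg hτ' y)]
  have h3 := norm_inner_le_norm (𝕜 := ℝ) y v
  have h4 := heatKernel_nonneg hτ' y
  calc rexp (-τ) * (2 * π ^ 2 / τ) * (‖inner ℝ y v‖ * heatKernel τ y)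
      ≤ rexp (-τ) * (2 * π ^ 2 / τ) * ((‖y‖ * ‖v‖) * heatKernel τ y) := by gcongr
    _ = _ := by ring

/-- The second-order Taylor remainder of `χ` at `x`, in the direction `-y`. -/
noncomputable def taylorRem (χ : 𝓢(E, ℂ)) (x y : E) : ℂ := χ (x - y) - χ x + fderiv ℝ χ x y

theorem exists_taylorRem_le (χ : 𝓢(E, ℂ)) : ∃ B, 0 ≤ B ∧ ∀ x y, ‖taylorRem χ x y‖ ≤ B * ‖y‖ ^ 2 := by
  set g := SchwartzMap.fderivCLM ℝ E ℂ χ with hg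
  set B := SchwartzMap.seminorm ℝ 0 0 (SchwartzMap.fderivCLM ℝ E _ g) with hB
  have hB0 : 0 ≤ B := apply_nonneg _ _
  refine ⟨B, hB0, fun x y => ?_⟩
  have h1 : ∀ z, ‖g z - g x‖ ≤ B * ‖z - x‖ := fun z =>
    convex_univ.norm_image_sub_le_of_norm_fderiv_le (𝕜 := ℝ)
      (fun w _ => (g.hasFDerivAt w).differentiableAt)
      (fun w _ => by
        have := SchwartzMap.norm_le_seminorm ℝ (SchwartzMap.fderivCLM ℝ E _ g) w
        simpa using this) (Set.mem_univ x) (Set.mem_univ z)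
  have h2 := (convex_closedBall x ‖y‖).norm_image_sub_le_of_norm_hasFDerivWithin_le' (𝕜 := ℝ)
    (f := χ) (f' := fun z => fderiv ℝ χ z) (φ := fderiv ℝ χ x) (C := B * ‖y‖)
    (x := x) (y := x - y)
    (fun z _ => (χ.hasFDerivAt z).hasFDerivWithinAt)
    (fun z hz => by
      have := h1 z
      simp only [hg, SchwartzMap.fderivCLM_apply] at this
      refine this.trans ?_
      gcongr
      simpa [dist_eq_norm] using hz)
    (by simp) (by simp)
  unfold taylorRem
  rw [show x - y - x = -y by abel, map_neg, sub_neg_eq_add, norm_neg] at h2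
  rw [sq, ← mul_assoc]
  exact h2

theorem taylorRem_eq_zero {χ : 𝓢(E, ℂ)} {x y : E} (hx : x ∉ tsupport χ)
    (hxy : x - y ∉ tsupport χ) : taylorRem χ x y = 0 := by
  unfold taylorRem
  rw [image_eq_zero_of_notMem_tsupport hx, image_eq_zero_of_notMem_tsupport hxy,
    fderiv_of_notMem_tsupport ℝ hx]
  simp

/-- The commutator of `J^s`, `0 < s < 2`, with multiplication by `χ`: a first-order term plus an
operator whose kernel carries a second-order Taylor remainder of `χ`. -/
theorem besselS_mulS_eq {ι : Type*} [Fintype ι] (e : OrthonormalBasis ι ℝ E) {s : ℝ} (hs0 : 0 < s)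
    (hs2 : s < 2) (χ u : 𝓢(E, ℂ)) (x : E) :
    fracConst s * (besselS E s (mulS χ u) x - χ x * besselS E s u x) =
      (Gamma ((2 - s) / 2) / (2 * π ^ 2) : ℝ) *
        ∑ j, ∂_{e j} χ x * besselS E (-(2 - s)) (∂_{e j} u) x +
      ∫ τ in Set.Ioi 0, ((τ ^ (-(s / 2) - 1) * rexp (-τ) : ℝ) : ℂ) *
        ∫ y, heatKernel τ y * (taylorRem χ x y * u (x - y)) := by
  obtain ⟨h1i, h1⟩ := besselS_eq_integral_heat_sub hs0 hs2 (mulS χ u) x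
  obtain ⟨h2i, h2⟩ := besselS_eq_integral_heat_sub hs0 hs2 u x
  have h3 := fun j => besselS_neg_eq_integral_heat (by linarith : 0 < 2 - s) (∂_{e j} u) x
  have h4i : IntegrableOn (fun τ => ∑ j, ∂_{e j} χ x * (((1 / (2 * π ^ 2) : ℝ) : ℂ) *
      (((τ ^ ((2 - s) / 2 - 1) * rexp (-τ) : ℝ) : ℂ) * heat τ (∂_{e j} u) x))) (Set.Ioi 0) :=
    integrable_finsetSum _ fun j _ => (((h3 j).1.const_mul _).const_mul _)
  have h4 : ∫ τ in Set.Ioi 0, ∑ j, ∂_{e j} χ x * (((1 / (2 * π ^ 2) : ℝ) : ℂ) *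
      (((τ ^ ((2 - s) / 2 - 1) * rexp (-τ) : ℝ) : ℂ) * heat τ (∂_{e j} u) x)) =
      (Gamma ((2 - s) / 2) / (2 * π ^ 2) : ℝ) *
        ∑ j, ∂_{e j} χ x * besselS E (-(2 - s)) (∂_{e j} u) x := by
    rw [integral_finsetSum _ fun j _ => (((h3 j).1.const_mul _).const_mul _), Finset.mul_sum]
    refine Finset.sum_congr rfl fun j _ => ?_
    rw [integral_const_mul, integral_const_mul, (h3 j).2]
    push_cast; ring
  have key : ∀ τ ∈ Set.Ioi (0 : ℝ), ((τ ^ (-(s / 2) - 1) * rexp (-τ) : ℝ) : ℂ) *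
        ∫ y, heatKernel τ y * (taylorRem χ x y * u (x - y)) =
      ((τ ^ (-(s / 2) - 1) : ℝ) : ℂ) * (rexp (-τ) * heat τ (mulS χ u) x - mulS χ u x) -
      χ x * (((τ ^ (-(s / 2) - 1) : ℝ) : ℂ) * (rexp (-τ) * heat τ u x - u x)) -
      ∑ j, ∂_{e j} χ x * (((1 / (2 * π ^ 2) : ℝ) : ℂ) *
      (((τ ^ ((2 - s) / 2 - 1) * rexp (-τ) : ℝ) : ℂ) * heat τ (∂_{e j} u) x)) := by
    intro τ hτ
    have hτ' : (0 : ℝ) < τ := hτ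
    have hm : ∀ j, Integrable fun y => ((inner ℝ y (e j) * heatKernel τ y : ℝ) : ℂ) * u (x - y) := by
      intro j
      refine integrable_mul_schwartz ?_ u x
      refine (integrable_norm_mul_heatKernel hτ').mono' ?_ (.of_forall fun y => ?_)
      · exact ((continuous_id.inner continuous_const).mul
          (continuous_heatKernel τ)).aestronglyMeasurable
      · rw [norm_mul, Real.norm_of_nonneg (heatKernel_nonneg hτ' y)]
        gcongr
        · exact heatKernel_nonneg hτ' y
        · simpa using norm_inner_le_norm (𝕜 := ℝ) y (e j)
    have hA := integrable_mul_schwartz (integrable_heatKernel (E := E) hτ') (mulS χ u) x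
    have hB := integrable_mul_schwartz (integrable_heatKernel (E := E) hτ') u x
    have hAB : Integrable fun y => (heatKernel τ y : ℂ) * mulS χ u (x - y) -
        χ x * (heatKernel τ y * u (x - y)) := hA.sub (hB.const_mul _)
    have hsplit : ∫ y, heatKernel τ y * (taylorRem χ x y * u (x - y)) =
        heat τ (mulS χ u) x - χ x * heat τ u x +
          ∑ j, ∂_{e j} χ x * ∫ y, ((inner ℝ y (e j) * heatKernel τ y : ℝ) : ℂ) * u (x - y) := by
      simp only [heat, ← integral_const_mul]
      rw [← integral_finsetSum _ fun j _ => (hm j).const_mul _, ← integral_sub hA (hB.const_mul _),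
        ← integral_add hAB
          (integrable_finsetSum _ fun j _ => (hm j).const_mul _)]
      refine integral_congr_ae (.of_forall fun y => ?_)
      have hy : fderiv ℝ χ x y = ∑ j, (inner ℝ y (e j) : ℂ) * ∂_{e j} χ x := by
        conv_lhs => rw [← e.sum_repr y, map_sum]
        refine Finset.sum_congr rfl fun j _ => ?_
        rw [map_smul, SchwartzMap.lineDerivOp_apply_eq_fderiv, e.repr_apply_apply,
          real_inner_comm, Complex.real_smul]
      simp only [taylorRem, hy, mulS_apply]
      rw [add_mul, Finset.sum_mul, mul_add, Finset.mul_sum]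
      congr 1
      · ring
      · refine Finset.sum_congr rfl fun j _ => ?_
        push_cast; ring
    simp only [integral_inner_mul_heatKernel hτ'] at hsplit
    rw [hsplit, mulS_apply]
    have hp : τ ^ ((2 - s) / 2 - 1) = τ ^ (-(s / 2) - 1) * τ := by
      conv_rhs => rw [← Real.rpow_one τ, ← Real.rpow_mul hτ'.le, one_mul, ← Real.rpow_add hτ']
      congr 1; ring
    rw [hp, mul_add, Finset.mul_sum, sub_eq_add_neg _ (∑ j, _), ← Finset.sum_neg_distrib]
    congr 1
    · push_cast; ring
    · refine Finset.sum_congr rfl fun j _ => ?_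
      push_cast; ring
  have h12 : IntegrableOn (fun τ =>
      ((τ ^ (-(s / 2) - 1) : ℝ) : ℂ) * (rexp (-τ) * heat τ (mulS χ u) x - mulS χ u x) -
      χ x * (((τ ^ (-(s / 2) - 1) : ℝ) : ℂ) * (rexp (-τ) * heat τ u x - u x))) (Set.Ioi 0) :=
    h1i.sub (h2i.const_mul _)
  rw [setIntegral_congr_fun measurableSet_Ioi key, integral_sub h12 h4i,
    integral_sub h1i (h2i.const_mul _), integral_const_mul, h1, h2, h4]
  ring

end Commutator

section Localization

variable {E : Type*} [NormedAddCommGroup E] [InnerProductSpace ℝ E] [FiniteDimensional ℝ E]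
  [MeasurableSpace E] [BorelSpace E]
  {ι : Type*} [Countable ι] [MeasurableSpace ι] [DiscreteMeasurableSpace ι]

open LineDeriv

/-! ### Localization of Bessel potential norms -/

/-- The translates of a compact set by the points `Z i` overlap boundedly often. -/
def FiniteOverlap (Z : ι → E) : Prop :=
  ∀ K : Set E, IsCompact K → ∃ M : ℝ≥0, ∀ x, Measure.count {i | x - Z i ∈ K} ≤ M

/-- The family of operators `f ↦ J^s(χ(· - Z_i) J^{-s} f)` is bounded from `L^q(E)` to
`L^q(ι × E)`, uniformly in `1 ≤ q ≤ ∞`. -/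
def LocBdd (Z : ι → E) (s : ℝ) (χ : 𝓢(E, ℂ)) : Prop :=
  ∃ C : ℝ≥0, ∀ q : ℝ≥0∞, 1 ≤ q → ∀ f : 𝓢(E, ℂ),
    eLpNorm (fun x : ι × E => besselS E s (mulS (shiftS (Z x.1) χ) (besselS E (-s) f)) x.2) q
      ((Measure.count : Measure ι).prod volume) ≤ C * eLpNorm f q volume

theorem aestronglyMeasurable_family {F : ι → E → ℂ} (hF : ∀ i, Continuous (F i))
    {μ : Measure (ι × E)} : AEStronglyMeasurable (fun x : ι × E => F x.1 x.2) μ :=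
  (measurable_from_prod_countable_right fun i => (hF i).measurable).aestronglyMeasurable

theorem measurableSet_overlap (Z : ι → E) {K : Set E} (hK : IsCompact K) :
    MeasurableSet {x : ι × E | x.2 - Z x.1 ∈ K} := by
  have hm : Measurable fun x : ι × E => x.2 - Z x.1 :=
    measurable_snd.sub ((measurable_of_countable Z).comp measurable_fst)
  exact hm hK.measurableSet

theorem locBdd_zero {Z : ι → E} (hZ : FiniteOverlap Z) {χ : 𝓢(E, ℂ)} (hχ : HasCompactSupport χ) :
    LocBdd Z 0 χ := by
  obtain ⟨M, hM⟩ := hZ _ hχ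
  obtain ⟨B, hB0, hB⟩ := exists_norm_le_schwartz χ
  refine ⟨B.toNNReal * max 1 M, fun q hq f => ?_⟩
  simp only [neg_zero, besselS_zero, mulS_apply]
  refine eLpNorm_family_mul_le (S := {x : ι × E | x.2 - Z x.1 ∈ tsupport χ})
    (measurableSet_overlap Z hχ) hM f.continuous.aestronglyMeasurable (fun x => ?_) hq
  rw [enorm_mul]
  gcongr
  rw [SchwartzMap.compSubConstCLM_apply]
  by_cases hx : x.2 - Z x.1 ∈ tsupport χ
  · rw [Set.indicator_of_mem (by exact hx), mul_one, ← ofReal_norm]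
    exact ENNReal.ofReal_le_ofReal (hB _)
  · rw [image_eq_zero_of_notMem_tsupport hx]; simp

theorem lineDeriv_shiftS (v z : E) (f : 𝓢(E, ℂ)) : ∂_{v} (shiftS z f) = shiftS z (∂_{v} f) := by
  ext x
  rw [SchwartzMap.compSubConstCLM_apply, SchwartzMap.lineDerivOp_apply_eq_fderiv,
    SchwartzMap.lineDerivOp_apply_eq_fderiv]
  have h : (shiftS z f : E → ℂ) = fun x => f (x - z) := rfl
  rw [h, fderiv_comp_sub]

theorem fderiv_shiftS (z : E) (f : 𝓢(E, ℂ)) (x : E) :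
    fderiv ℝ (shiftS z f) x = fderiv ℝ f (x - z) := by
  have h : (shiftS z f : E → ℂ) = fun x => f (x - z) := rfl
  rw [h, fderiv_comp_sub]

theorem taylorRem_shiftS (χ : 𝓢(E, ℂ)) (z x y : E) :
    taylorRem (shiftS z χ) x y = taylorRem χ (x - z) y := by
  unfold taylorRem
  rw [fderiv_shiftS, SchwartzMap.compSubConstCLM_apply, SchwartzMap.compSubConstCLM_apply,
    sub_right_comm]

theorem hasCompactSupport_lineDeriv {χ : 𝓢(E, ℂ)} (hχ : HasCompactSupport χ) (v : E) :
    HasCompactSupport (∂_{v} χ : 𝓢(E, ℂ)) :=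
  IsCompact.of_isClosed_subset hχ (isClosed_tsupport _) (SchwartzMap.tsupport_lineDerivOp_subset v χ)

/-- The part of the commutator carrying the Taylor remainder is bounded: its kernel is dominated
by an integrable convolution kernel, and it is supported near the support of `χ(· - Z_i)`. -/
theorem exists_taylorRem_family_le {Z : ι → E} (hZ : FiniteOverlap Z) {s : ℝ}
    (hs2 : s < 2) {χ : 𝓢(E, ℂ)} (hχ : HasCompactSupport χ) :
    ∃ C : ℝ≥0, ∀ q : ℝ≥0∞, 1 ≤ q → ∀ u : 𝓢(E, ℂ),
      eLpNorm (fun x : ι × E => ∫ τ in Set.Ioi 0, ((τ ^ (-(s / 2) - 1) * rexp (-τ) : ℝ) : ℂ) *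
        ∫ y, heatKernel τ y * (taylorRem (shiftS (Z x.1) χ) x.2 y * u (x.2 - y))) q
        ((Measure.count : Measure ι).prod volume) ≤ C * eLpNorm u q volume := by
  obtain ⟨M, hM⟩ := hZ _ hχ
  obtain ⟨B, hB0, hB⟩ := exists_taylorRem_le χ
  have hc := heatConst_pos (E := E)
  have hs3 : 0 < 1 - s / 2 := by linarith
  set K := tsupport χ with hK
  let k : ℝ → E → ℝ≥0∞ := fun τ y =>
    ENNReal.ofReal (τ ^ (-(s / 2) - 1) * rexp (-τ) * B * (‖y‖ ^ 2 * heatKernel τ y))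
  have hk : Measurable (Function.uncurry k) := by
    refine Measurable.ennreal_ofReal (Measurable.mul (by fun_prop) (Measurable.mul (by fun_prop) ?_))
    exact measurable_heatKernel
  set T : ℝ≥0 := (B * heatConst E * Gamma (1 - s / 2)).toNNReal with hT
  have htot : ∫⁻ y, ∫⁻ τ in Set.Ioi 0, k τ y ≤ T := by
    rw [← lintegral_lintegral_swap hk.aemeasurable]
    calc ∫⁻ τ in Set.Ioi 0, ∫⁻ y, k τ y
        ≤ ∫⁻ τ in Set.Ioi 0, ENNReal.ofReal (B * heatConst E *
            (τ ^ ((1 - s / 2) - 1) * rexp (-τ))) := by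
          refine setLIntegral_mono' measurableSet_Ioi fun τ hτ => ?_
          have hτ' : (0 : ℝ) < τ := hτ
          have h1 : ∀ y : E, k τ y = ENNReal.ofReal (τ ^ (-(s / 2) - 1) * rexp (-τ) * B) *
              ENNReal.ofReal (‖y‖ ^ 2 * heatKernel τ y) := fun y => by
            rw [← ENNReal.ofReal_mul (by positivity)]
          simp only [h1]
          rw [lintegral_const_mul' _ _ ENNReal.ofReal_ne_top]
          refine (mul_le_mul_right (lintegral_sq_norm_mul_heatKernel_le hτ') _).trans (le_of_eq ?_)
          rw [← ENNReal.ofReal_mul (by positivity)]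
          congr 1
          have hp : τ ^ ((1 - s / 2) - 1) = τ ^ (-(s / 2) - 1) * τ := by
            conv_rhs => rw [← Real.rpow_one τ, ← Real.rpow_mul hτ'.le, one_mul,
              ← Real.rpow_add hτ']
            congr 1; ring
          rw [hp]; ring
      _ = _ := by
          rw [← ofReal_integral_eq_lintegral_ofReal]
          · rw [integral_const_mul, integral_rpow_mul_exp_neg hs3]; rfl
          · exact (integrableOn_rpow_mul_exp_neg hs3).const_mul _
          · filter_upwards [ae_restrict_mem measurableSet_Ioi] with τ hτ
            have hτ' : (0 : ℝ) < τ := hτ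
            simp only [Pi.zero_apply]
            positivity
  let κ : E → ℝ≥0∞ := fun y => ∫⁻ τ in Set.Ioi 0, k τ y
  have hκ : Measurable κ := measurable_lintegral_subordination hk
  let I : ι × E → ℝ≥0∞ := Set.indicator {x : ι × E | x.2 - Z x.1 ∈ K} fun _ => 1
  have hI : Measurable I := measurable_const.indicator (measurableSet_overlap Z hχ)
  have hI1 : ∀ x, I x ≤ 1 := fun x => Set.indicator_le_self' (by simp) x
  have hIM : ∀ x : E, ∫⁻ i, I (i, x) ∂Measure.count ≤ M := fun x => by
    have : (fun i => I (i, x)) = Set.indicator {i | x - Z i ∈ K} fun _ => 1 := rfl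
    rw [this, lintegral_indicator_const (Set.to_countable _).measurableSet, one_mul]
    exact hM x
  refine ⟨2 * T * max 1 M, fun q hq u => ?_⟩
  -- the remainder vanishes unless `x` or `y` lies in the translated support, whence the two
  -- indicators; summed over the family, each of them contributes at most `M`
  refine eLpNorm_le_of_schur (K := fun (x : ι × E) y => κ (x.2 - y) * (I x + I (x.1, y)))
    ?_ ENNReal.coe_ne_top (fun x => ?_) (fun y => ?_) u.continuous.aestronglyMeasurable
    (.of_forall fun x => ?_) hq
  · refine (hκ.comp ((measurable_snd.comp measurable_fst).sub measurable_snd)).mul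
      ((hI.comp measurable_fst).add (hI.comp ?_))
    exact (measurable_fst.comp measurable_fst).prodMk measurable_snd
  · calc ∫⁻ y, κ (x.2 - y) * (I x + I (x.1, y)) ≤ ∫⁻ y, κ (x.2 - y) * 2 := by
          gcongr with y
          calc I x + I (x.1, y) ≤ 1 + 1 := add_le_add (hI1 _) (hI1 _)
            _ = 2 := one_add_one_eq_two
      _ = (∫⁻ y, κ y) * 2 := by
          rw [lintegral_mul_const' _ _ (by simp), lintegral_sub_left_eq_self κ x.2]
      _ ≤ T * 2 := by gcongr
      _ ≤ _ := by
          push_cast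
          rw [mul_comm (T : ℝ≥0∞)]
          exact le_mul_of_one_le_right (by simp) (le_max_left _ _)
  · have hmeas : Measurable fun x : ι × E => κ (x.2 - y) * (I x + I (x.1, y)) := by
      refine (hκ.comp (measurable_snd.sub measurable_const)).mul (hI.add (hI.comp ?_))
      exact measurable_fst.prodMk measurable_const
    rw [lintegral_prod_symm' _ hmeas]
    calc ∫⁻ x, ∫⁻ i, κ (x - y) * (I (i, x) + I (i, y)) ∂Measure.count
        ≤ ∫⁻ x, κ (x - y) * (2 * M) := by
          gcongr with x
          rw [lintegral_const_mul _ (measurable_of_countable _),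
            lintegral_add_left (measurable_of_countable _)]
          gcongr
          rw [two_mul]
          exact add_le_add (hIM x) (hIM y)
      _ = (∫⁻ x, κ x) * (2 * M) := by
          rw [lintegral_mul_const' _ _ (ENNReal.mul_ne_top (by simp) ENNReal.coe_ne_top),
            lintegral_sub_right_eq_self κ y]
      _ ≤ T * (2 * M) := by gcongr
      _ ≤ _ := by
          push_cast
          rw [mul_left_comm, ← mul_assoc]
          gcongr
          exact le_max_right _ _
  · have hh : Measurable fun y => (I x + I (x.1, y)) * ‖u y‖ₑ :=
      (measurable_const.add (hI.comp measurable_prodMk_left)).mul u.continuous.measurable.enorm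
    have hsub := lintegral_subordination hk hh x.2
    simp only [mul_assoc]
    change _ ≤ ∫⁻ y, (∫⁻ τ in Set.Ioi 0, k τ (x.2 - y)) * ((I x + I (x.1, y)) * ‖u y‖ₑ)
    rw [← hsub]
    refine (enorm_integral_le_lintegral_enorm _).trans ?_
    refine setLIntegral_mono' measurableSet_Ioi fun τ hτ => ?_
    have hτ' : (0 : ℝ) < τ := hτ
    rw [← integral_const_mul]
    refine (enorm_integral_le_lintegral_enorm _).trans (lintegral_mono fun y => ?_)
    have hrem : ‖taylorRem (shiftS (Z x.1) χ) x.2 y‖ₑ ≤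
        ENNReal.ofReal (B * ‖y‖ ^ 2) * (I x + I (x.1, x.2 - y)) := by
      rw [taylorRem_shiftS]
      by_cases h1 : x.2 - Z x.1 ∈ K
      · have : I x = 1 := Set.indicator_of_mem (by exact h1) _
        rw [this, ← ofReal_norm]
        refine (ENNReal.ofReal_le_ofReal (hB _ y)).trans ?_
        exact le_mul_of_one_le_right (by simp) (by simp)
      · by_cases h2 : x.2 - y - Z x.1 ∈ K
        · have : I (x.1, x.2 - y) = 1 := Set.indicator_of_mem (by exact h2) _
          rw [this, ← ofReal_norm]
          refine (ENNReal.ofReal_le_ofReal (hB _ y)).trans ?_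
          exact le_mul_of_one_le_right (by simp) (by simp)
        · rw [taylorRem_eq_zero h1 (by rwa [sub_right_comm])]; simp
    have h4 := heatKernel_nonneg hτ' y
    calc ‖((τ ^ (-(s / 2) - 1) * rexp (-τ) : ℝ) : ℂ) * (heatKernel τ y *
          (taylorRem (shiftS (Z x.1) χ) x.2 y * u (x.2 - y)))‖ₑ
        = ENNReal.ofReal (τ ^ (-(s / 2) - 1) * rexp (-τ)) * (ENNReal.ofReal (heatKernel τ y) *
          (‖taylorRem (shiftS (Z x.1) χ) x.2 y‖ₑ * ‖u (x.2 - y)‖ₑ)) := by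
          rw [enorm_mul, enorm_mul, enorm_mul, ← ofReal_norm, Complex.norm_real,
            Real.norm_of_nonneg (by positivity), ← ofReal_norm (heatKernel τ y : ℂ),
            Complex.norm_real, Real.norm_of_nonneg h4]
      _ ≤ ENNReal.ofReal (τ ^ (-(s / 2) - 1) * rexp (-τ)) * (ENNReal.ofReal (heatKernel τ y) *
          ((ENNReal.ofReal (B * ‖y‖ ^ 2) * (I x + I (x.1, x.2 - y))) * ‖u (x.2 - y)‖ₑ)) := by
          gcongr
      _ = (ENNReal.ofReal (τ ^ (-(s / 2) - 1) * rexp (-τ)) * ENNReal.ofReal (heatKernel τ y) *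
          ENNReal.ofReal (B * ‖y‖ ^ 2)) * ((I x + I (x.1, x.2 - y)) * ‖u (x.2 - y)‖ₑ) := by ring
      _ = _ := by
          congr 1
          rw [← ENNReal.ofReal_mul (by positivity), ← ENNReal.ofReal_mul (by positivity)]
          congr 1; ring

end Localization

section Localization

variable {E : Type*} [NormedAddCommGroup E] [InnerProductSpace ℝ E] [FiniteDimensional ℝ E]
  [MeasurableSpace E] [BorelSpace E]
  {ι : Type*} [Countable ι] [MeasurableSpace ι] [DiscreteMeasurableSpace ι]

open LineDeriv

/-- The operator `F` maps Schwartz functions to measurable functions on `ι × E` and is bounded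
from `L^q(E)` to `L^q(ι × E)`, uniformly in `1 ≤ q ≤ ∞`. -/
def BddFamily (F : 𝓢(E, ℂ) → ι × E → ℂ) : Prop :=
  ∃ C : ℝ≥0, ∀ q : ℝ≥0∞, 1 ≤ q → ∀ f : 𝓢(E, ℂ),
    AEStronglyMeasurable (F f) ((Measure.count : Measure ι).prod volume) ∧
    eLpNorm (F f) q ((Measure.count : Measure ι).prod volume) ≤ C * eLpNorm f q volume

theorem BddFamily.add {F G : 𝓢(E, ℂ) → ι × E → ℂ} (hF : BddFamily F) (hG : BddFamily G) :
    BddFamily fun f x => F f x + G f x := by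
  obtain ⟨C, hC⟩ := hF
  obtain ⟨D, hD⟩ := hG
  refine ⟨C + D, fun q hq f => ⟨(hC q hq f).1.add (hD q hq f).1, ?_⟩⟩
  refine (eLpNorm_add_le (hC q hq f).1 (hD q hq f).1 hq).trans ?_
  push_cast
  rw [add_mul]
  exact add_le_add (hC q hq f).2 (hD q hq f).2

theorem BddFamily.const_mul {F : 𝓢(E, ℂ) → ι × E → ℂ} (hF : BddFamily F) (c : ℂ) :
    BddFamily fun f x => c * F f x := by
  obtain ⟨C, hC⟩ := hF
  refine ⟨‖c‖₊ * C, fun q hq f => ⟨(hC q hq f).1.const_mul c, ?_⟩⟩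
  refine (eLpNorm_const_smul_le (c := c) (f := F f)).trans ?_
  push_cast
  rw [mul_assoc]
  exact mul_le_mul_right (hC q hq f).2 _

theorem BddFamily.sum {J : Type*} (t : Finset J) {F : J → 𝓢(E, ℂ) → ι × E → ℂ}
    (hF : ∀ j, BddFamily (F j)) : BddFamily fun f x => ∑ j ∈ t, F j f x := by
  classical
  induction t using Finset.induction_on with
  | empty => exact ⟨0, fun q hq f => ⟨by simpa using aestronglyMeasurable_const, by simp⟩⟩
  | insert a t ha ih =>
    simp only [Finset.sum_insert ha]
    exact (hF a).add ih

theorem BddFamily.comp {F : 𝓢(E, ℂ) → ι × E → ℂ} (hF : BddFamily F) {L : 𝓢(E, ℂ) → 𝓢(E, ℂ)}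
    (hL : ∃ C : ℝ≥0, ∀ q : ℝ≥0∞, 1 ≤ q → ∀ f, eLpNorm (L f) q volume ≤ C * eLpNorm f q volume) :
    BddFamily fun f => F (L f) := by
  obtain ⟨C, hC⟩ := hF
  obtain ⟨D, hD⟩ := hL
  refine ⟨C * D, fun q hq f => ⟨(hC q hq _).1, (hC q hq _).2.trans ?_⟩⟩
  push_cast
  rw [mul_assoc]
  exact mul_le_mul_right (hD q hq f) _

theorem LocBdd.bddFamily {Z : ι → E} {s : ℝ} {χ : 𝓢(E, ℂ)} (h : LocBdd Z s χ) :
    BddFamily fun f (x : ι × E) => besselS E s (mulS (shiftS (Z x.1) χ) (besselS E (-s) f)) x.2 := by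
  obtain ⟨C, hC⟩ := h
  exact ⟨C, fun q hq f => ⟨aestronglyMeasurable_family
    (F := fun i => besselS E s (mulS (shiftS (Z i) χ) (besselS E (-s) f)))
    fun i => SchwartzMap.continuous _, hC q hq f⟩⟩

theorem BddFamily.locBdd {Z : ι → E} {s : ℝ} {χ : 𝓢(E, ℂ)} (h : BddFamily fun f (x : ι × E) =>
    besselS E s (mulS (shiftS (Z x.1) χ) (besselS E (-s) f)) x.2) : LocBdd Z s χ := by
  obtain ⟨C, hC⟩ := h
  exact ⟨C, fun q hq f => (hC q hq f).2⟩

/-- For `0 < s < 2` the localization bound follows from the commutator formula, all of whose terms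
are bounded, with `J^{-2}∂_j` in place of `J^{s-2}∂_j J^{-s}`. -/
theorem locBdd_of_lt_two {Z : ι → E} (hZ : FiniteOverlap Z) {s : ℝ} (hs0 : 0 < s) (hs2 : s < 2)
    {χ : 𝓢(E, ℂ)} (hχ : HasCompactSupport χ) : LocBdd Z s χ := by
  set e := stdOrthonormalBasis ℝ E
  have hc := fracConst_ne_zero hs0 hs2
  set c : ℂ := ((Gamma ((2 - s) / 2) / (2 * π ^ 2) : ℝ) : ℂ)
  let G0 : 𝓢(E, ℂ) → ι × E → ℂ := fun f x => shiftS (Z x.1) χ x.2 * f x.2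
  let G1 : 𝓢(E, ℂ) → ι × E → ℂ := fun f x =>
    ∑ j, shiftS (Z x.1) (∂_{e j} χ) x.2 * besselS E (-2) (∂_{e j} f) x.2
  let G : 𝓢(E, ℂ) → ι × E → ℂ := fun f x =>
    besselS E s (mulS (shiftS (Z x.1) χ) (besselS E (-s) f)) x.2
  let R : 𝓢(E, ℂ) → ι × E → ℂ := fun f x =>
    ∫ τ in Set.Ioi 0, ((τ ^ (-(s / 2) - 1) * rexp (-τ) : ℝ) : ℂ) *
      ∫ y, heatKernel τ y * (taylorRem (shiftS (Z x.1) χ) x.2 y * besselS E (-s) f (x.2 - y))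
  have key : ∀ f x, fracConst s * (G f x - G0 f x) = c * G1 f x + R f x := fun f x => by
    have := besselS_mulS_eq e hs0 hs2 (shiftS (Z x.1) χ) (besselS E (-s) f) x.2
    simp only [besselS_besselS, add_neg_cancel, besselS_zero, lineDeriv_shiftS,
      ← besselS_lineDeriv] at this
    have h2 : -(2 - s) + -s = -2 := by ring
    simpa only [h2] using this
  have hmul : ∀ {χ : 𝓢(E, ℂ)}, HasCompactSupport χ →
      BddFamily fun f (x : ι × E) => shiftS (Z x.1) χ x.2 * f x.2 := fun hχ => by
    simpa using (locBdd_zero hZ hχ).bddFamily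
  have hG0 : BddFamily G0 := hmul hχ
  have hG1 : BddFamily G1 := BddFamily.sum _ fun j =>
    (hmul (hasCompactSupport_lineDeriv hχ (e j))).comp
      (L := fun f => besselS E (-2) (∂_{e j} f)) (exists_eLpNorm_besselS_neg_two_lineDeriv_le (e j))
  have hR : BddFamily R := by
    obtain ⟨C, hC⟩ := exists_taylorRem_family_le hZ hs2 hχ
    refine ⟨C, fun q hq f => ⟨?_, (hC q hq _).trans (mul_le_mul_right
      (eLpNorm_besselS_neg_le hs0.le f hq) _)⟩⟩
    have hRe : R f = fun x => fracConst s * (G f x - G0 f x) - c * G1 f x := by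
      funext x; rw [key]; ring
    rw [hRe]
    have hGm : AEStronglyMeasurable (G f) ((Measure.count : Measure ι).prod volume) :=
      aestronglyMeasurable_family
        (F := fun i => besselS E s (mulS (shiftS (Z i) χ) (besselS E (-s) f)))
        fun i => SchwartzMap.continuous _
    exact ((hGm.sub (hG0.choose_spec q hq f).1).const_mul _).sub
      ((hG1.choose_spec q hq f).1.const_mul _)
  refine BddFamily.locBdd ?_
  have hsum := hG0.add (((hG1.const_mul c).add hR).const_mul (fracConst s : ℂ)⁻¹)
  convert hsum using 3 with f x
  rw [← key, inv_mul_cancel_left₀ (by exact_mod_cast hc)]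
  exact (add_sub_cancel _ _).symm

/-- `J² = 1 - Δ/(4π²)`. -/
theorem besselS_two (e : OrthonormalBasis (Fin (Module.finrank ℝ E)) ℝ E) (w : 𝓢(E, ℂ)) :
    besselS E 2 w = w - ((4 * π ^ 2 : ℝ) : ℂ)⁻¹ • ∑ j, ∂_{e j} (∂_{e j} w) := by
  rw [← SchwartzMap.laplacian_eq_sum e, SchwartzMap.laplacian_eq_fourierMultiplierCLM]
  rw [← SchwartzMap.fourierMultiplierCLM_ofReal ℂ (by fun_prop)]
  apply (FourierTransform.fourierCLE ℂ 𝓢(E, ℂ)).injective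
  rw [map_sub]
  simp only [FourierTransform.fourierCLE_apply]
  ext ξ
  rw [sub_apply, fourier_besselS, FourierTransform.fourier_smul,
    FourierTransform.fourier_smul, SchwartzMap.fourierMultiplierCLM_apply,
    FourierTransform.fourier_fourierInv_eq, smul_apply, smul_apply,
    SchwartzMap.smulLeftCLM_apply_apply (by fun_prop)]
  have hb : besselSymbol 2 ξ = 1 + ‖ξ‖ ^ 2 := by simp [besselSymbol]
  have hpi : (π : ℂ) ≠ 0 := by exact_mod_cast Real.pi_ne_zero
  rw [hb, Complex.real_smul, smul_eq_mul, smul_eq_mul]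
  have hr : ∀ r : ℝ, (RCLike.ofReal r : ℂ) = (r : ℂ) := fun _ => rfl
  rw [hr]
  push_cast
  field_simp
  ring

theorem lineDeriv_mulS (v : E) (f g : 𝓢(E, ℂ)) :
    ∂_{v} (mulS f g) = mulS (∂_{v} f) g + mulS f (∂_{v} g) := by
  ext x
  rw [SchwartzMap.lineDerivOp_apply_eq_fderiv, add_apply, mulS_apply, mulS_apply,
    SchwartzMap.lineDerivOp_apply_eq_fderiv, SchwartzMap.lineDerivOp_apply_eq_fderiv]
  have h : (mulS f g : E → ℂ) = fun x => f x * g x := rfl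
  rw [h, fderiv_fun_mul f.differentiableAt g.differentiableAt]
  simp [mul_comm, add_comm]

/-- The step from order `s` to order `s + 2`. Write `J^{s+2} = J^s J²` with `J² = 1 - cΔ` and move `Δ`
past the multiplication by the Leibniz rule: the derivatives of `χ` are again admissible, and the
term in which `Δ` falls on `J^{-(s+2)} f` recombines to `χ J^{-s} f`. -/
theorem LocBdd.add_two {Z : ι → E} {s : ℝ}
    (h : ∀ χ : 𝓢(E, ℂ), HasCompactSupport χ → LocBdd Z s χ)
    (χ : 𝓢(E, ℂ)) (hχ : HasCompactSupport χ) : LocBdd Z (s + 2) χ := by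
  set e := stdOrthonormalBasis ℝ E
  obtain ⟨c, hB⟩ : ∃ c : ℂ, ∀ w, besselS E 2 w = w - c • ∑ j, ∂_{e j} (∂_{e j} w) :=
    ⟨_, besselS_two e⟩
  have hd := fun j => hasCompactSupport_lineDeriv hχ (e j)
  have h1 : ∀ j, BddFamily fun f (x : ι × E) => besselS E s (mulS (shiftS (Z x.1) (∂_{e j} χ))
      (besselS E (-s) (besselS E (-2) (∂_{e j} f)))) x.2 := fun j =>
    (h _ (hd j)).bddFamily.comp (L := fun f => besselS E (-2) (∂_{e j} f))
      (exists_eLpNorm_besselS_neg_two_lineDeriv_le (e j))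
  have h2 : ∀ j, BddFamily fun f (x : ι × E) => besselS E s
      (mulS (shiftS (Z x.1) (∂_{e j} (∂_{e j} χ))) (besselS E (-s) (besselS E (-2) f))) x.2 :=
    fun j => (h _ (hasCompactSupport_lineDeriv (hd j) (e j))).bddFamily.comp
      (L := fun f => besselS E (-2) f)
      ⟨1, fun q hq f => by simpa using eLpNorm_besselS_neg_le (by norm_num) f hq⟩
  have hsum := (h χ hχ).bddFamily.add ((BddFamily.sum Finset.univ fun j =>
    (h2 j).add ((h1 j).const_mul 2)).const_mul (-c))
  refine BddFamily.locBdd ?_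
  convert hsum using 3 with f x
  rw [← besselS_besselS, hB]
  have h3 : besselS E (-(s + 2)) f = besselS E (-s) (besselS E (-2) f) := by
    rw [besselS_besselS]; congr 2; ring
  have h4 : ∀ j, ∂_{e j} (∂_{e j} (mulS (shiftS (Z x.1) χ) (besselS E (-(s + 2)) f))) =
      mulS (shiftS (Z x.1) (∂_{e j} (∂_{e j} χ))) (besselS E (-s) (besselS E (-2) f)) +
      (2 : ℂ) • mulS (shiftS (Z x.1) (∂_{e j} χ)) (besselS E (-s) (besselS E (-2) (∂_{e j} f))) +
      mulS (shiftS (Z x.1) χ) (∂_{e j} (∂_{e j} (besselS E (-(s + 2)) f))) := fun j => by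
    simp only [lineDeriv_mulS, lineDeriv_shiftS, h3, besselS_lineDeriv, LineDeriv.lineDerivOp_add]
    ext y
    simp; ring
  have h5 : mulS (shiftS (Z x.1) χ) (besselS E (-(s + 2)) f) =
      mulS (shiftS (Z x.1) χ) (besselS E (-s) f) +
      c • ∑ j, mulS (shiftS (Z x.1) χ) (∂_{e j} (∂_{e j} (besselS E (-(s + 2)) f))) := by
    have : besselS E (-s) f = besselS E 2 (besselS E (-(s + 2)) f) := by
      rw [besselS_besselS]; congr 2; ring
    rw [this, hB]
    ext y
    simp [← Finset.mul_sum]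
    ring
  simp only [h4, Finset.sum_add_distrib]
  rw [h5]
  simp only [map_sub, map_add, map_smul, map_sum, sub_apply, add_apply, smul_apply, sum_apply,
    smul_add, smul_eq_mul, mul_add, ← Finset.mul_sum]
  ring

/-- Localization is bounded for all orders `s ≥ 0`. -/
theorem locBdd {Z : ι → E} (hZ : FiniteOverlap Z) {s : ℝ} (hs : 0 ≤ s) {χ : 𝓢(E, ℂ)}
    (hχ : HasCompactSupport χ) : LocBdd Z s χ := by
  have key : ∀ (k : ℕ) (t : ℝ), 0 ≤ t → t < 2 → ∀ χ : 𝓢(E, ℂ), HasCompactSupport χ →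
      LocBdd Z (t + 2 * k) χ := by
    intro k t ht0 ht2
    induction k with
    | zero =>
      intro χ hχ
      rw [Nat.cast_zero, mul_zero, add_zero]
      rcases ht0.eq_or_lt with rfl | h
      · exact locBdd_zero hZ hχ
      · exact locBdd_of_lt_two hZ h ht2 hχ
    | succ k ih =>
      have : t + 2 * ((k + 1 : ℕ) : ℝ) = t + 2 * k + 2 := by push_cast; ring
      rw [this]
      exact LocBdd.add_two ih
  have h0 := Int.floor_le (s / 2)
  have h1 := Int.lt_floor_add_one (s / 2)
  have hk : ((⌊s / 2⌋₊ : ℕ) : ℝ) = ⌊s / 2⌋ := natCast_floor_eq_intCast_floor (by positivity)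
  have := key ⌊s / 2⌋₊ (s - 2 * ⌊s / 2⌋₊) (by rw [hk]; linarith) (by rw [hk]; linarith) χ hχ
  rwa [sub_add_cancel] at this

end Localization

section Multiplication

variable {E : Type*} [NormedAddCommGroup E] [InnerProductSpace ℝ E] [FiniteDimensional ℝ E]
  [MeasurableSpace E] [BorelSpace E]

/-! ### Multiplication by test functions on Bessel potential spaces -/

theorem one_le_of_inv_add_inv {q q' : ℝ≥0∞} (h : q⁻¹ + q'⁻¹ = 1) : 1 ≤ q := by
  rw [← ENNReal.inv_le_inv, inv_one, ← h]
  exact le_self_add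

theorem exists_inv_add_inv_eq_one {q : ℝ≥0∞} (hq : 1 ≤ q) : ∃ q' : ℝ≥0∞, q⁻¹ + q'⁻¹ = 1 := by
  refine ⟨(1 - q⁻¹)⁻¹, ?_⟩
  rw [inv_inv]
  exact add_tsub_cancel_of_le (ENNReal.inv_le_one.2 hq)

theorem lintegral_enorm_mul_le {X : Type*} [MeasurableSpace X] {μ : Measure X} {f g : X → ℂ}
    (hf : AEStronglyMeasurable f μ)
    (hg : AEStronglyMeasurable g μ) {q q' : ℝ≥0∞} (h : q⁻¹ + q'⁻¹ = 1) :
    ∫⁻ x, ‖f x * g x‖ₑ ∂μ ≤ eLpNorm f q μ * eLpNorm g q' μ := by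
  have : ENNReal.HolderConjugate q q' := ENNReal.holderConjugate_iff.2 h
  have := eLpNorm_smul_le_mul_eLpNorm (p := q) (q := q') (r := 1) hg hf
  rw [eLpNorm_one_eq_lintegral_enorm] at this
  exact this

theorem enorm_integral_mul_le {X : Type*} [MeasurableSpace X] {μ : Measure X} {f g : X → ℂ}
    (hf : AEStronglyMeasurable f μ)
    (hg : AEStronglyMeasurable g μ) {q q' : ℝ≥0∞} (h : q⁻¹ + q'⁻¹ = 1) :
    ‖∫ x, f x * g x ∂μ‖ₑ ≤ eLpNorm f q μ * eLpNorm g q' μ :=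
  (enorm_integral_le_lintegral_enorm _).trans (lintegral_enorm_mul_le hf hg h)

theorem eLpNorm_schwartz_lt_top (f : 𝓢(E, ℂ)) (q : ℝ≥0∞) : eLpNorm f q volume < ∞ :=
  (f.memLp q volume).2

theorem finiteOverlap_unit : FiniteOverlap fun _ : Unit => (0 : E) := fun K _ =>
  ⟨1, fun x => (measure_mono (Set.subset_univ _)).trans (by simp [Measure.count_univ])⟩

/-- Multiplication by translates of a test function is uniformly bounded on `H^s_q`. For `s < 0`
this is dual to the case of `-s`. -/
theorem exists_eLpNorm_besselS_mulS_le (s : ℝ) {χ : 𝓢(E, ℂ)} (hχ : HasCompactSupport χ) :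
    ∃ C : ℝ≥0, ∀ q : ℝ≥0∞, 1 ≤ q → ∀ (z : E) (f : 𝓢(E, ℂ)),
      eLpNorm (besselS E s (mulS (shiftS z χ) f)) q volume ≤
        C * eLpNorm (besselS E s f) q volume := by
  have nonneg : ∀ s : ℝ, 0 ≤ s → ∃ C : ℝ≥0, ∀ q : ℝ≥0∞, 1 ≤ q → ∀ f : 𝓢(E, ℂ),
      eLpNorm (besselS E s (mulS χ f)) q volume ≤ C * eLpNorm (besselS E s f) q volume := by
    intro s hs
    have hloc := locBdd finiteOverlap_unit hs hχ
    obtain ⟨C, hC⟩ := hloc.bddFamily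
    refine ⟨C, fun q hq f => ?_⟩
    obtain ⟨h1, h2⟩ := hC q hq (besselS E s f)
    refine le_trans (le_of_eq ?_) ((eLpNorm_component_le h1 q ()).trans h2)
    simp
  have main : ∃ C : ℝ≥0, ∀ q : ℝ≥0∞, 1 ≤ q → ∀ f : 𝓢(E, ℂ),
      eLpNorm (besselS E s (mulS χ f)) q volume ≤ C * eLpNorm (besselS E s f) q volume := by
    rcases le_total 0 s with hs | hs
    · exact nonneg s hs
    · obtain ⟨C, hC⟩ := nonneg (-s) (by linarith)
      refine ⟨C, fun q hq f => ?_⟩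
      obtain ⟨q', hqq'⟩ := exists_inv_add_inv_eq_one hq
      have hq' : 1 ≤ q' := one_le_of_inv_add_inv (by rwa [add_comm] at hqq')
      have hfin : eLpNorm (besselS E s f) q volume ≠ ∞ := (eLpNorm_schwartz_lt_top _ q).ne
      have hcoe : (C : ℝ≥0∞) * eLpNorm (besselS E s f) q volume =
          ((C * (eLpNorm (besselS E s f) q volume).toNNReal : ℝ≥0) : ℝ≥0∞) := by
        push_cast
        rw [ENNReal.coe_toNNReal hfin]
      rw [hcoe]
      refine eLpNorm_le_of_schwartz_pairing (SchwartzMap.continuous _).locallyIntegrable hqq'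
        fun φ _ => ?_
      rw [← hcoe, integral_besselS_mul]
      have h1 : ∫ x, mulS χ f x * besselS E s φ x =
          ∫ x, besselS E s f x * besselS E (-s) (mulS χ (besselS E s φ)) x := by
        rw [integral_besselS_mul, besselS_besselS, add_neg_cancel, besselS_zero]
        refine integral_congr_ae (.of_forall fun x => ?_)
        simp only [mulS_apply]; ring
      rw [h1]
      refine (enorm_integral_mul_le (SchwartzMap.continuous _).aestronglyMeasurable
        (SchwartzMap.continuous _).aestronglyMeasurable hqq').trans ?_
      refine (mul_le_mul_right (hC q' hq' _) _).trans (le_of_eq ?_)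
      rw [besselS_besselS, neg_add_cancel, besselS_zero]
      ring
  obtain ⟨C, hC⟩ := main
  refine ⟨C, fun q hq z f => ?_⟩
  have h : mulS (shiftS z χ) f = shiftS z (mulS χ (shiftS (-z) f)) := by ext x; simp
  rw [h, besselS_shiftS, eLpNorm_shiftS]
  refine (hC q hq _).trans (le_of_eq ?_)
  rw [besselS_shiftS, eLpNorm_shiftS]

/-- The Bessel potential of order `b ≥ 0` of an `L^r` function is again an `L^r` function. -/
theorem exists_besselPotential_memLp {r : ℝ≥0∞} (hr : 1 ≤ r) {b : ℝ} (hb : 0 ≤ b) {f : E → ℂ}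
    (hf : MemLp f r volume) : ∃ g : E → ℂ, LocallyIntegrable g volume ∧
      ∀ h : 𝓢(E, ℂ), ∫ x, f x * besselS E (-b) h x = ∫ x, g x * h x := by
  rcases hb.eq_or_lt with rfl | hb
  · exact ⟨f, hf.locallyIntegrable hr, fun h => by simp⟩
  obtain ⟨r', hrr'⟩ := exists_inv_add_inv_eq_one hr
  -- replace `f` by a measurable representative
  obtain ⟨f', hf'm, hff'⟩ : ∃ f', Measurable f' ∧ f =ᵐ[volume] f' :=
    ⟨_, hf.1.stronglyMeasurable_mk.measurable, hf.1.ae_eq_mk⟩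
  have hf' : MemLp f' r volume := hf.ae_eq hff'
  have hκm := measurable_besselKernel (E := E) b
  let κ : E → ℝ≥0∞ := fun y => ENNReal.ofReal (besselKernel b y)
  have hκ : Measurable κ := hκm.ennreal_ofReal
  let g : E → ℂ := fun x => ∫ y, besselKernel b (x - y) * f' y
  have hker : Measurable fun q : E × E => (besselKernel b (q.1 - q.2) : ℂ) * f' q.2 :=
    (Complex.measurable_ofReal.comp (hκm.comp (measurable_fst.sub measurable_snd))).mul
      (hf'm.comp measurable_snd)
  have hgm : AEStronglyMeasurable g volume := by
    refine AEStronglyMeasurable.integral_prod_right' (f := fun q : E × E =>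
      (besselKernel b (q.1 - q.2) : ℂ) * f' q.2) hker.aestronglyMeasurable
  have hen : ∀ y, ‖(besselKernel b y : ℂ)‖ₑ = κ y := fun y => by
    rw [← ofReal_norm, Complex.norm_real, Real.norm_of_nonneg (besselKernel_nonneg hb y)]
  have hg : MemLp g r volume := by
    refine ⟨hgm, lt_of_le_of_lt (eLpNorm_le_of_convolution_bound hκ ENNReal.one_ne_top
      (lintegral_besselKernel hb).le hf'.1 (.of_forall fun x => ?_) hr)
      (ENNReal.mul_lt_top ENNReal.one_lt_top hf'.2)⟩
    refine (enorm_integral_le_lintegral_enorm _).trans (le_of_eq (lintegral_congr fun y => ?_))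
    rw [enorm_mul, hen]
  refine ⟨g, hg.locallyIntegrable hr, fun h => ?_⟩
  have hint : Integrable (Function.uncurry fun x y : E =>
      (besselKernel b (x - y) : ℂ) * f' y * h x) (volume.prod volume) := by
    have hm : Measurable (Function.uncurry fun x y : E =>
      (besselKernel b (x - y) : ℂ) * f' y * h x) := by
      exact hker.mul (h.continuous.measurable.comp measurable_fst)
    refine ⟨hm.aestronglyMeasurable, ?_⟩
    rw [hasFiniteIntegral_iff_enorm, lintegral_prod _ hm.enorm.aemeasurable]
    have hsub : ∀ x : E, ∫⁻ y, ‖(besselKernel b (x - y) : ℂ) * f' y * h x‖ₑ =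
        ∫⁻ y, κ y * ‖f' (x - y) * h x‖ₑ := fun x => by
      rw [← lintegral_sub_left_eq_self _ x]
      refine lintegral_congr fun y => ?_
      rw [sub_sub_cancel, mul_assoc, enorm_mul, hen]
    simp only [Function.uncurry_apply_pair, hsub]
    rw [lintegral_lintegral_swap]
    · calc ∫⁻ y, ∫⁻ x, κ y * ‖f' (x - y) * h x‖ₑ
          ≤ ∫⁻ y, κ y * (eLpNorm f' r volume * eLpNorm h r' volume) := by
            refine lintegral_mono fun y => ?_
            rw [lintegral_const_mul' _ _ ENNReal.ofReal_ne_top]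
            gcongr
            refine (lintegral_enorm_mul_le (f := fun x => f' (x - y)) ?_
              h.continuous.aestronglyMeasurable hrr').trans (le_of_eq ?_)
            · exact (hf'm.comp (measurable_id.sub_const y)).aestronglyMeasurable
            · congr 1
              exact eLpNorm_comp_measurePreserving (f := fun x : E => x - y) hf'.1
                (measurePreserving_sub_right volume y)
        _ < ∞ := by
            rw [lintegral_mul_const _ hκ, lintegral_besselKernel hb, one_mul]
            exact ENNReal.mul_lt_top hf'.2 (eLpNorm_schwartz_lt_top h r')
    · refine Measurable.aemeasurable ((hκ.comp measurable_snd).mul (Measurable.enorm ?_))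
      exact (hf'm.comp (measurable_fst.sub measurable_snd)).mul
        (h.continuous.measurable.comp measurable_fst)
  calc ∫ x, f x * besselS E (-b) h x = ∫ y, f' y * besselS E (-b) h y :=
        integral_congr_ae (hff'.mul (ae_eq_refl _))
    _ = ∫ y, ∫ x, (besselKernel b (x - y) : ℂ) * f' y * h x := by
        refine integral_congr_ae (.of_forall fun y => ?_)
        simp only
        rw [besselS_neg_eq_convolution hb, ← integral_const_mul, ← integral_sub_left_eq_self _ _ y]
        refine integral_congr_ae (.of_forall fun x => ?_)
        simp only [sub_sub_cancel]
        rw [← besselKernel_neg, neg_sub]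
        ring
    _ = ∫ x, ∫ y, (besselKernel b (x - y) : ℂ) * f' y * h x :=
        (integral_integral_swap hint).symm
    _ = ∫ x, g x * h x := by
        simp only [g, ← integral_mul_const]

end Multiplication

section Density

variable {E : Type*} [NormedAddCommGroup E] [InnerProductSpace ℝ E] [FiniteDimensional ℝ E]
  [MeasurableSpace E] [BorelSpace E]

/-! ### Density of compactly supported functions in the Schwartz space -/

/-- All derivatives of `χ(ε ·) - χ(0)` are `O(ε (1 + |x|))`. -/
theorem exists_norm_iteratedFDeriv_dilation_le (χ : 𝓢(E, ℂ)) (i : ℕ) :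
    ∃ B : ℝ, 0 ≤ B ∧ ∀ ε : ℝ, 0 < ε → ε ≤ 1 → ∀ x : E,
      ‖iteratedFDeriv ℝ i (fun x => χ (ε • x) - χ 0) x‖ ≤ ε * (B * (1 + ‖x‖)) := by
  rcases Nat.eq_zero_or_pos i with rfl | hi
  · refine ⟨SchwartzMap.seminorm ℝ 0 1 χ, apply_nonneg _ _, fun ε hε hε1 x => ?_⟩
    rw [norm_iteratedFDeriv_zero]
    have hL : ‖χ (ε • x) - χ 0‖ ≤ SchwartzMap.seminorm ℝ 0 1 χ * ‖ε • x - 0‖ := by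
      refine Convex.norm_image_sub_le_of_norm_fderiv_le (𝕜 := ℝ) (s := Set.univ)
        (fun y _ => χ.differentiableAt) (fun y _ => ?_) convex_univ (Set.mem_univ _)
        (Set.mem_univ _)
      have := SchwartzMap.norm_iteratedFDeriv_le_seminorm ℝ χ 1 y
      rwa [norm_iteratedFDeriv_one] at this
    refine hL.trans ?_
    rw [sub_zero, norm_smul, Real.norm_of_nonneg hε.le, mul_left_comm]
    gcongr
    linarith [norm_nonneg x]
  · refine ⟨SchwartzMap.seminorm ℝ 0 i χ, apply_nonneg _ _, fun ε hε hε1 x => ?_⟩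
    have hd : ContDiff ℝ i fun x : E => χ (ε • x) := (χ.smooth i).comp (contDiff_const_smul ε)
    have h1 : iteratedFDeriv ℝ i (fun x : E => χ (ε • x) - χ 0) x =
        ε ^ i • iteratedFDeriv ℝ i χ (ε • x) := by
      have := iteratedFDeriv_sub_apply (x := x) hd.contDiffAt
        (contDiff_const (c := χ 0)).contDiffAt
      rw [iteratedFDeriv_const_of_ne hi.ne'] at this
      have h2 := congrFun (iteratedFDeriv_comp_const_smul ε (χ.smooth i)) x
      simp only [Pi.zero_apply, sub_zero] at this
      rw [← h2, ← this]
      rfl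
    rw [h1, norm_smul, norm_pow, Real.norm_of_nonneg hε.le]
    have h3 := SchwartzMap.norm_iteratedFDeriv_le_seminorm ℝ χ i (ε • x)
    have h4 : ε ^ i ≤ ε := pow_le_of_le_one hε.le hε1 hi.ne'
    have h5 : 0 ≤ SchwartzMap.seminorm ℝ 0 i χ := apply_nonneg _ _
    calc ε ^ i * ‖iteratedFDeriv ℝ i χ (ε • x)‖ ≤ ε * SchwartzMap.seminorm ℝ 0 i χ := by gcongr
      _ ≤ ε * (SchwartzMap.seminorm ℝ 0 i χ * (1 + ‖x‖)) := by
        gcongr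
        exact le_mul_of_one_le_right h5 (by linarith [norm_nonneg x])

/-- The approximations are the products of `f` with dilated cutoff functions. -/
theorem exists_seq_hasCompactSupport_tendsto (f : 𝓢(E, ℂ)) :
    ∃ ψ : ℕ → 𝓢(E, ℂ), (∀ k, HasCompactSupport (ψ k)) ∧ Tendsto ψ atTop (𝓝 f) := by
  let β : ContDiffBump (0 : E) := ⟨1, 2, one_pos, one_lt_two⟩
  have hβc : HasCompactSupport fun x => (β x : ℂ) :=
    β.hasCompactSupport.comp_left (g := fun t : ℝ => (t : ℂ)) Complex.ofReal_zero
  have hβs : ContDiff ℝ (⊤ : ℕ∞) fun x => (β x : ℂ) := Complex.ofRealCLM.contDiff.comp β.contDiff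
  let χ : 𝓢(E, ℂ) := hβc.toSchwartzMap hβs
  have hχ0 : χ 0 = 1 := by
    change ((β (0 : E) : ℝ) : ℂ) = 1
    rw [β.one_of_mem_closedBall (Metric.mem_closedBall_self β.rIn_pos.le)]; simp
  let ε : ℕ → ℝ := fun k => 1 / (k + 1)
  have hε : ∀ k, 0 < ε k := fun k => Nat.one_div_pos_of_nat
  have hε1 : ∀ k, ε k ≤ 1 := fun k => by
    simp only [ε, one_div]
    exact inv_le_one_of_one_le₀ (by linarith [(Nat.cast_nonneg k : (0 : ℝ) ≤ k)])
  have hc : ∀ k, HasCompactSupport fun x : E => χ (ε k • x) := fun k =>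
    HasCompactSupport.comp_smul hβc (hε k).ne'
  have hs : ∀ k, ContDiff ℝ (⊤ : ℕ∞) fun x : E => χ (ε k • x) := fun k =>
    (χ.smooth ⊤).comp (contDiff_const_smul (ε k))
  refine ⟨fun k => mulS ((hc k).toSchwartzMap (hs k)) f, fun k => (hc k).mul_right, ?_⟩
  rw [(schwartz_withSeminorms ℝ E ℂ).tendsto_nhds]
  rintro ⟨j, m⟩ δ hδ
  choose B hB0 hB using exists_norm_iteratedFDeriv_dilation_le χ
  set A : ℝ := ∑ i ∈ Finset.range (m + 1), (m.choose i : ℝ) * B i *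
    (SchwartzMap.seminorm ℝ j (m - i) f + SchwartzMap.seminorm ℝ (j + 1) (m - i) f) with hA
  have hA0 : 0 ≤ A := Finset.sum_nonneg fun i _ => by
    have h1 : 0 ≤ SchwartzMap.seminorm ℝ j (m - i) f := apply_nonneg _ _
    have h2 : 0 ≤ SchwartzMap.seminorm ℝ (j + 1) (m - i) f := apply_nonneg _ _
    have := hB0 i
    positivity
  have hlim : Tendsto (fun k => ε k * A) atTop (𝓝 (0 * A)) :=
    tendsto_one_div_add_atTop_nhds_zero_nat.mul_const A
  rw [zero_mul] at hlim
  filter_upwards [hlim.eventually_lt_const hδ] with k hk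
  refine lt_of_le_of_lt ?_ hk
  refine SchwartzMap.seminorm_le_bound ℝ j m _ (mul_nonneg (hε k).le hA0) fun x => ?_
  have hfun : ((mulS ((hc k).toSchwartzMap (hs k)) f - f : 𝓢(E, ℂ)) : E → ℂ) =
      fun x => (χ (ε k • x) - χ 0) * f x := by
    funext x
    rw [sub_apply, mulS_apply, hχ0, sub_mul, one_mul]
    rfl
  rw [hfun]
  have hmul := norm_iteratedFDeriv_mul_le (((hs k).of_le (m := (m : ℕ∞)) (by
    exact_mod_cast le_top)).sub (contDiff_const (c := χ 0))) (f.smooth m) x (n := m) le_rfl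
  refine (mul_le_mul_of_nonneg_left hmul (by positivity)).trans ?_
  rw [Finset.mul_sum, hA, Finset.mul_sum]
  refine Finset.sum_le_sum fun i _ => ?_
  have h1 := SchwartzMap.le_seminorm ℝ j (m - i) f x
  have h2 := SchwartzMap.le_seminorm ℝ (j + 1) (m - i) f x
  calc ‖x‖ ^ j * ((m.choose i : ℝ) * ‖iteratedFDeriv ℝ i (fun x => χ (ε k • x) - χ 0) x‖ *
        ‖iteratedFDeriv ℝ (m - i) f x‖)
      ≤ ‖x‖ ^ j * ((m.choose i : ℝ) * (ε k * (B i * (1 + ‖x‖))) *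
        ‖iteratedFDeriv ℝ (m - i) f x‖) := by
        gcongr
        exact hB i _ (hε k) (hε1 k) x
    _ = ε k * ((m.choose i : ℝ) * B i * (‖x‖ ^ j * ‖iteratedFDeriv ℝ (m - i) f x‖ +
        ‖x‖ ^ (j + 1) * ‖iteratedFDeriv ℝ (m - i) f x‖)) := by ring
    _ ≤ _ := by
        have := hB0 i
        have := hε k
        gcongr

/-- A bound of a continuous functional by a Sobolev norm extends from compactly supported to all
Schwartz functions. -/
theorem enorm_apply_le_of_hasCompactSupport {T : 𝓢(E, ℂ) → ℂ} (hT : Continuous T) {α : ℝ}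
    {q : ℝ≥0∞} (hq : 1 ≤ q) {C : ℝ≥0}
    (h : ∀ ψ : 𝓢(E, ℂ), HasCompactSupport ψ → ‖T ψ‖ₑ ≤ C * eLpNorm (besselS E α ψ) q volume)
    (f : 𝓢(E, ℂ)) : ‖T f‖ₑ ≤ C * eLpNorm (besselS E α f) q volume := by
  obtain ⟨ψ, hψ, hlim⟩ := exists_seq_hasCompactSupport_tendsto f
  have : Fact (1 ≤ q) := ⟨hq⟩
  have hn : ∀ g : 𝓢(E, ℂ), ‖g.toLp q volume‖ₑ = eLpNorm g q volume := fun g => by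
    rw [Lp.enorm_def]
    exact eLpNorm_congr_ae (g.coeFn_toLp q volume)
  have hcont : Continuous fun g : 𝓢(E, ℂ) => eLpNorm (besselS E α g) q volume := by
    simp only [← hn]
    exact (SchwartzMap.continuous_toLp.comp (besselS E α).continuous).enorm
  refine le_of_tendsto_of_tendsto' ((hT.tendsto f).comp hlim).enorm
    (ENNReal.Tendsto.const_mul ((hcont.tendsto f).comp hlim) (Or.inr ENNReal.coe_ne_top))
    fun k => h _ (hψ k)

end Density

/-! ### Sobolev norms of distributions -/

section Distributions

variable {n : ℕ}

/-- A function `f` in `L^p` that represents `J^s T`, tested on Schwartz functions, bounds the norm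
of `T`. -/
theorem temperedSobolevNorm_le {s : ℝ} {p : ℝ≥0∞} [Fact (1 ≤ p)]
    {T : 𝓢'(EuclideanSpace ℝ (Fin n), ℂ)} {f : EuclideanSpace ℝ (Fin n) → ℂ}
    (hf : MemLp f p volume) (hT : ∀ h, T (besselS _ s h) = ∫ x, f x * h x) :
    TemperedDistribution.MemSobolev s p T ∧ temperedSobolevNorm s p T ≤ eLpNorm f p volume := by
  have hrep : TemperedDistribution.besselPotential (EuclideanSpace ℝ (Fin n)) ℂ s T =
      ((hf.toLp f : Lp ℂ p (volume : Measure (EuclideanSpace ℝ (Fin n)))) :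
        𝓢'(EuclideanSpace ℝ (Fin n), ℂ)) := by
    ext h
    rw [besselPotential_apply_apply, hT, Lp.toTemperedDistribution_apply]
    refine integral_congr_ae ?_
    filter_upwards [hf.coeFn_toLp] with x hx
    rw [hx, smul_eq_mul, mul_comm]
  refine ⟨⟨_, hrep⟩, (iInf₂_le (hf.toLp f) hrep).trans (le_of_eq (Lp.enorm_toLp hf))⟩

theorem exists_of_besselPotential_eq {s : ℝ} {p : ℝ≥0∞} [Fact (1 ≤ p)]
    {T : 𝓢'(EuclideanSpace ℝ (Fin n), ℂ)} {f : Lp ℂ p (volume : Measure (EuclideanSpace ℝ (Fin n)))}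
    (hT : TemperedDistribution.besselPotential (EuclideanSpace ℝ (Fin n)) ℂ s T =
      (f : 𝓢'(EuclideanSpace ℝ (Fin n), ℂ))) (h : 𝓢(EuclideanSpace ℝ (Fin n), ℂ)) :
    T (besselS _ s h) = ∫ x, f x * h x := by
  rw [← besselPotential_apply_apply, hT, Lp.toTemperedDistribution_apply]
  simp only [smul_eq_mul, mul_comm]

theorem temperedSobolevNorm_coe (s : ℝ) (p : ℝ≥0∞) [Fact (1 ≤ p)]
    (g : 𝓢(EuclideanSpace ℝ (Fin n), ℂ)) :
    temperedSobolevNorm s p (g : 𝓢'(EuclideanSpace ℝ (Fin n), ℂ)) =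
      eLpNorm (besselS _ s g) p volume := by
  refine le_antisymm (temperedSobolevNorm_le ((besselS _ s g).memLp p volume) fun h => ?_).2
    (le_iInf₂ fun f hf => ?_)
  · rw [SchwartzMap.coe_apply, integral_besselS_mul]
    simp only [smul_eq_mul, mul_comm]
  · rw [besselPotential_coe, ← Lp.toTemperedDistribution_toLp_eq (p := p)] at hf
    have hinj := LinearMap.ker_eq_bot.1 (Lp.ker_toTemperedDistributionCLM_eq_bot (F := ℂ)
      (μ := (volume : Measure (EuclideanSpace ℝ (Fin n)))) (p := p))
    have hfe : (besselS _ s g).toLp p volume = f := hinj hf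
    rw [← hfe, Lp.enorm_def, eLpNorm_congr_ae ((besselS _ s g).coeFn_toLp p volume)]

theorem TestFn.sobolevNorm_eq (s : ℝ) (p : ℝ≥0∞) [Fact (1 ≤ p)] (φ : TestFn n) :
    φ.sobolevNorm s p = eLpNorm (besselS _ s φ.toSchwartz) p volume :=
  temperedSobolevNorm_coe s p _

theorem TestFn.sobolevNorm_lt_top (s : ℝ) (p : ℝ≥0∞) [Fact (1 ≤ p)] (φ : TestFn n) :
    φ.sobolevNorm s p < ∞ := by
  rw [TestFn.sobolevNorm_eq]
  exact eLpNorm_schwartz_lt_top _ _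

/-- A compactly supported Schwartz function, seen as a test function. -/
noncomputable def TestFn.ofSchwartz (f : 𝓢(EuclideanSpace ℝ (Fin n), ℂ)) (hf : HasCompactSupport f) :
    TestFn n :=
  ⟨f, f.smooth _, hf, Set.subset_univ _⟩

theorem TestFn.toSchwartz_translate (z : EuclideanSpace ℝ (Fin n)) (φ : TestFn n) :
    (TestFn.translate z φ).toSchwartz = shiftS z φ.toSchwartz := by
  ext x
  rw [SchwartzMap.compSubConstCLM_apply]
  rfl

theorem TestFn.toSchwartz_mulCLM (φ ψ : TestFn n) :
    (TestFn.mulCLM φ ψ).toSchwartz = mulS φ.toSchwartz ψ.toSchwartz := rfl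

theorem TestFn.hasCompactSupport_toSchwartz (φ : TestFn n) : HasCompactSupport φ.toSchwartz :=
  φ.hasCompactSupport

theorem TestFn.sobolevNorm_translate (s : ℝ) (p : ℝ≥0∞) [Fact (1 ≤ p)] (φ : TestFn n)
    (z : EuclideanSpace ℝ (Fin n)) :
    (TestFn.translate z φ).sobolevNorm s p = φ.sobolevNorm s p := by
  rw [TestFn.sobolevNorm_eq, TestFn.sobolevNorm_eq, TestFn.toSchwartz_translate, besselS_shiftS,
    eLpNorm_shiftS]

namespace Distr

theorem MemSobolev.exists_rep {s : ℝ} {p : ℝ≥0∞} [Fact (1 ≤ p)] {u : Distr n}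
    (hu : u.MemSobolev s p) : ∃ (T : 𝓢'(EuclideanSpace ℝ (Fin n), ℂ))
      (f : EuclideanSpace ℝ (Fin n) → ℂ), u.IsRestrictionOf T ∧ MemLp f p volume ∧
      ∀ h, T (besselS _ s h) = ∫ x, f x * h x := by
  obtain ⟨T, hT, f, hf⟩ := hu
  exact ⟨T, f, hT, Lp.memLp f, exists_of_besselPotential_eq hf⟩

/-- The pairing of `H^s_p` with `H^{-s}_{p'}`. -/
theorem enorm_apply_le (s : ℝ) {p p' : ℝ≥0∞} [Fact (1 ≤ p)] [Fact (1 ≤ p')]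
    (hpp' : p⁻¹ + p'⁻¹ = 1) (u : Distr n) (ψ : TestFn n) (hu : u.sobolevNorm s p ≠ ∞) :
    ‖u ψ‖ₑ ≤ u.sobolevNorm s p * ψ.sobolevNorm (-s) p' := by
  by_contra! hlt
  have hψ := (ψ.sobolevNorm_lt_top (-s) p').ne
  have key : ∀ c, u.sobolevNorm s p < c → ‖u ψ‖ₑ ≤ c * ψ.sobolevNorm (-s) p' := by
    intro c hc
    simp only [sobolevNorm, temperedSobolevNorm, iInf_lt_iff] at hc
    obtain ⟨T, hT, f, hf, hfc⟩ := hc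
    have h1 : u ψ = ∫ x, f x * besselS _ (-s) ψ.toSchwartz x := by
      rw [← exists_of_besselPotential_eq hf, besselS_besselS, add_neg_cancel, besselS_zero]
      exact hT ψ
    rw [h1, TestFn.sobolevNorm_eq]
    refine (enorm_integral_mul_le (Lp.aestronglyMeasurable f)
      (SchwartzMap.continuous _).aestronglyMeasurable hpp').trans ?_
    gcongr
    rw [← Lp.enorm_def]
    exact hfc.le
  have hlim : ‖u ψ‖ₑ ≤ u.sobolevNorm s p * ψ.sobolevNorm (-s) p' := by
    have htend : Tendsto (fun c => c * ψ.sobolevNorm (-s) p') (𝓝[>] (u.sobolevNorm s p))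
        (𝓝 (u.sobolevNorm s p * ψ.sobolevNorm (-s) p')) :=
      (ENNReal.Tendsto.mul_const tendsto_id (Or.inr hψ)).mono_left nhdsWithin_le_nhds
    have : (𝓝[>] (u.sobolevNorm s p)).NeBot := by
      have : (u.sobolevNorm s p) < ∞ := lt_top_iff_ne_top.2 hu
      exact nhdsGT_neBot_of_exists_gt ⟨_, this⟩
    exact ge_of_tendsto htend (eventually_mem_nhdsWithin.mono fun c hc => key c hc)
  exact absurd hlt (not_lt.2 hlim)

/-- A distribution in some `H^s_r` that is bounded by the norm of `H^{-t}_{q'}` lies in `H^t_q` for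
the conjugate exponent `q`, also for `q = 1`. -/
theorem sobolevNorm_le_of_pairing {s t : ℝ} (hts : t ≤ s) {r q q' : ℝ≥0∞} [Fact (1 ≤ r)]
    [Fact (1 ≤ q)] [Fact (1 ≤ q')] (hqq' : q⁻¹ + q'⁻¹ = 1) {u : Distr n} (hu : u.MemSobolev s r)
    {C : ℝ≥0} (h : ∀ ψ : TestFn n, ‖u ψ‖ₑ ≤ C * ψ.sobolevNorm (-t) q') :
    u.MemSobolev t q ∧ u.sobolevNorm t q ≤ C := by
  obtain ⟨T, f, hT, hf, hTf⟩ := hu.exists_rep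
  obtain ⟨g, hg, hfg⟩ := exists_besselPotential_memLp Fact.out (sub_nonneg.2 hts) hf
  have hTg : ∀ φ, T (besselS _ t φ) = ∫ x, g x * φ x := fun φ => by
    rw [← hfg, ← hTf, besselS_besselS]
    congr 3; ring
  have hTb := enorm_apply_le_of_hasCompactSupport (T := T) T.continuous (α := -t) (q := q')
    Fact.out (C := C) fun ψ hψ => by
      have := h (TestFn.ofSchwartz ψ hψ)
      rwa [hT, TestFn.sobolevNorm_eq] at this
  have hgn : eLpNorm g q volume ≤ C := eLpNorm_le_of_schwartz_pairing hg hqq' fun φ _ => by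
    rw [← hTg]
    refine (hTb _).trans (le_of_eq ?_)
    rw [besselS_besselS, neg_add_cancel, besselS_zero]
  have hgm : MemLp g q volume := ⟨hg.aestronglyMeasurable, hgn.trans_lt ENNReal.coe_lt_top⟩
  obtain ⟨h1, h2⟩ := temperedSobolevNorm_le hgm hTg
  exact ⟨⟨T, hT, h1⟩, (iInf₂_le T hT).trans (h2.trans hgn)⟩

theorem mulTest_apply (φ : TestFn n) (u : Distr n) (ψ : TestFn n) :
    mulTest φ u ψ = u (TestFn.mulCLM φ ψ) := rfl

theorem mulTest_comm (φ ψ : TestFn n) (u : Distr n) : mulTest φ u ψ = mulTest ψ u φ := by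
  rw [mulTest_apply, mulTest_apply]
  congr 1
  ext x
  exact mul_comm _ _

theorem sobolevNorm_mulTest_le {α : ℝ} {p : ℝ≥0∞} [Fact (1 ≤ p)] {μ : Distr n}
    (hμ : μ ∈ multiplierSpace n α p) (φ : TestFn n) :
    sobolevNorm (-α) p (mulTest φ μ) ≤ multiplierNorm α p μ * φ.sobolevNorm α p := by
  obtain ⟨-, K, hK⟩ := hμ
  rcases eq_or_ne (φ.sobolevNorm α p) 0 with h0 | h0
  · refine (hK φ).trans ?_
    simp [h0]
  · rw [← ENNReal.div_le_iff h0 (φ.sobolevNorm_lt_top α p).ne]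
    refine le_iInf₂ fun C hC => ?_
    rw [ENNReal.div_le_iff h0 (φ.sobolevNorm_lt_top α p).ne]
    exact hC φ

/-- The distribution defined by a locally integrable function. -/
noncomputable def ofFun (g : EuclideanSpace ℝ (Fin n) → ℂ) : Distr n :=
  TestFunction.integralAgainstBilinCLM (ContinuousLinearMap.mul ℂ ℂ) volume g

theorem ofFun_apply (g : 𝓢(EuclideanSpace ℝ (Fin n), ℂ)) (φ : TestFn n) :
    ofFun g φ = ∫ x, φ x * g x := by
  unfold ofFun
  rw [TestFunction.integralAgainstBilinCLM_eq_integral]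
  · rfl
  · exact g.continuous.locallyIntegrable.locallyIntegrableOn _

theorem mulTest_ofFun_isRestrictionOf (g : 𝓢(EuclideanSpace ℝ (Fin n), ℂ)) (φ : TestFn n) :
    (mulTest φ (ofFun g)).IsRestrictionOf
      (mulS φ.toSchwartz g : 𝓢'(EuclideanSpace ℝ (Fin n), ℂ)) := by
  intro ψ
  rw [mulTest_apply, ofFun_apply, SchwartzMap.coe_apply]
  refine integral_congr_ae (.of_forall fun x => ?_)
  simp only [TestFn.mulCLM_apply, smul_eq_mul, mulS_apply, TestFn.toSchwartz_apply]
  ring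

theorem memSobolevLoc_ofFun (s : ℝ) (p : ℝ≥0∞) [Fact (1 ≤ p)]
    (g : 𝓢(EuclideanSpace ℝ (Fin n), ℂ)) : MemSobolevLoc s p (ofFun (n := n) g) := fun φ =>
  ⟨_, mulTest_ofFun_isRestrictionOf g φ, (besselS _ s (mulS φ.toSchwartz g)).toLp p volume, by
    rw [besselPotential_coe, Lp.toTemperedDistribution_toLp_eq]⟩

theorem sobolevNorm_mulTest_ofFun_le (s : ℝ) (p : ℝ≥0∞) [Fact (1 ≤ p)]
    (g : 𝓢(EuclideanSpace ℝ (Fin n), ℂ)) (φ : TestFn n) :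
    sobolevNorm s p (mulTest φ (ofFun (n := n) g)) ≤
      eLpNorm (besselS _ s (mulS φ.toSchwartz g)) p volume := by
  rw [← temperedSobolevNorm_coe]
  exact iInf₂_le _ (mulTest_ofFun_isRestrictionOf g φ)

end Distr

end Distributions

section Multipliers

variable {n : ℕ}

namespace Distr

/-! ### Multipliers are uniformly local distributions -/

theorem multiplierNorm_lt_top {α : ℝ} {p : ℝ≥0∞} [Fact (1 ≤ p)] {μ : Distr n}
    (hμ : μ ∈ multiplierSpace n α p) : multiplierNorm α p μ < ∞ := by
  obtain ⟨-, K, hK⟩ := hμ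
  exact (iInf₂_le K hK).trans_lt ENNReal.coe_lt_top

/-- A multiplier from `H^α_p` to `H^{-α}_p` is a multiplier from `H^α_{p'}` to `H^{-α}_{p'}`, because
the form `μ(φψ)` is symmetric in `φ` and `ψ`. -/
theorem sobolevNorm_mulTest_conj_le {α : ℝ} {p p' : ℝ≥0∞} [Fact (1 ≤ p)] [Fact (1 ≤ p')]
    (hpp' : p⁻¹ + p'⁻¹ = 1) {μ : Distr n} (hμ : μ ∈ multiplierSpace n α p) (φ : TestFn n) :
    (mulTest φ μ).MemSobolev (-α) p' ∧
      sobolevNorm (-α) p' (mulTest φ μ) ≤ multiplierNorm α p μ * φ.sobolevNorm α p' := by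
  have hM := multiplierNorm_lt_top hμ
  have hfin : multiplierNorm α p μ * φ.sobolevNorm α p' ≠ ∞ :=
    ENNReal.mul_ne_top hM.ne (φ.sobolevNorm_lt_top α p').ne
  rw [← ENNReal.coe_toNNReal hfin]
  refine sobolevNorm_le_of_pairing (r := p) (q' := p) le_rfl (by rwa [add_comm]) (hμ.1 φ)
    fun ψ => ?_
  rw [ENNReal.coe_toNNReal hfin, mulTest_comm, neg_neg]
  have hψ := sobolevNorm_mulTest_le hμ ψ
  refine (enorm_apply_le (-α) hpp' _ φ (hψ.trans_lt
    (ENNReal.mul_lt_top hM (ψ.sobolevNorm_lt_top α p))).ne).trans ?_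
  rw [neg_neg]
  refine (mul_le_mul_left hψ _).trans (le_of_eq ?_)
  ring

/-- Translation invariance of the norm of `η` turns a multiplier bound into a uniform bound. -/
theorem multiplierSpace_embedded (η : TestFn n) {α : ℝ} {p q : ℝ≥0∞} [Fact (1 ≤ p)]
    [Fact (1 ≤ q)] (h : ∀ μ ∈ multiplierSpace n α p, ∀ φ : TestFn n,
      (mulTest φ μ).MemSobolev (-α) q ∧
      sobolevNorm (-α) q (mulTest φ μ) ≤ multiplierNorm α p μ * φ.sobolevNorm α q) :
    ContinuouslyEmbedded (multiplierSpace n α p) (multiplierNorm α p)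
      (unifSpace η (-α) q) (unifNorm η (-α) q) := by
  have hη := (η.sobolevNorm_lt_top α q).ne
  have key : ∀ μ ∈ multiplierSpace n α p, unifNorm η (-α) q μ ≤
      (η.sobolevNorm α q).toNNReal * multiplierNorm α p μ := fun μ hμ => by
    refine iSup_le fun z => ?_
    rw [ENNReal.coe_toNNReal hη, mul_comm, ← TestFn.sobolevNorm_translate α q η z]
    exact (h μ hμ _).2
  exact ⟨fun μ hμ => ⟨fun φ => (h μ hμ φ).1, (key μ hμ).trans_lt
    (ENNReal.mul_lt_top ENNReal.coe_lt_top (multiplierNorm_lt_top hμ))⟩, _, key⟩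

theorem multiplierSpace_embedded_unifSpace (η : TestFn n) (α : ℝ) {p p' : ℝ≥0∞} [Fact (1 ≤ p)]
    [Fact (1 ≤ p')] (hpp' : p⁻¹ + p'⁻¹ = 1) :
    ContinuouslyEmbedded (multiplierSpace n α p) (multiplierNorm α p)
      (unifSpace η (-α) (max p p')) (unifNorm η (-α) (max p p')) := by
  refine multiplierSpace_embedded η fun μ hμ φ => ?_
  have key : ∀ q [Fact (1 ≤ q)], q = p ∨ q = p' → (mulTest φ μ).MemSobolev (-α) q ∧
      sobolevNorm (-α) q (mulTest φ μ) ≤ multiplierNorm α p μ * φ.sobolevNorm α q := by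
    rintro q _ (rfl | rfl)
    · exact ⟨hμ.1 φ, sobolevNorm_mulTest_le hμ φ⟩
    · exact sobolevNorm_mulTest_conj_le hpp' hμ φ
  exact key _ (max_choice p p')

/-! ### Necessity of the product inequality -/

/-- Testing the embedding on the functions `μ = J^γ h` gives the product inequality by duality. -/
theorem product_inequality_of_embedded (η : TestFn n) {α γ : ℝ} {p p' r r' : ℝ≥0∞}
    [Fact (1 ≤ p)] [Fact (1 ≤ p')] [Fact (1 ≤ r)] [Fact (1 ≤ r')] (hpp' : p⁻¹ + p'⁻¹ = 1)
    (hrr' : r⁻¹ + r'⁻¹ = 1)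
    (h : ContinuouslyEmbedded (unifSpace η (-γ) r) (unifNorm η (-γ) r)
      (multiplierSpace n α p) (multiplierNorm α p)) :
    ∃ C : ℝ≥0, ∀ φ ψ : TestFn n, (TestFn.mulCLM φ ψ).sobolevNorm γ r' ≤
      C * (φ.sobolevNorm α p * ψ.sobolevNorm α p') := by
  obtain ⟨hsub, C₀, hC₀⟩ := h
  obtain ⟨C₁, hC₁⟩ := exists_eLpNorm_besselS_mulS_le (-γ) η.hasCompactSupport_toSchwartz
  refine ⟨C₀ * C₁, fun φ ψ => ?_⟩
  have hfin : φ.sobolevNorm α p * ψ.sobolevNorm α p' ≠ ∞ :=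
    ENNReal.mul_ne_top (φ.sobolevNorm_lt_top α p).ne (ψ.sobolevNorm_lt_top α p').ne
  have hcoe : ((C₀ * C₁ : ℝ≥0) : ℝ≥0∞) * (φ.sobolevNorm α p * ψ.sobolevNorm α p') =
      ((C₀ * C₁ * (φ.sobolevNorm α p * ψ.sobolevNorm α p').toNNReal : ℝ≥0) : ℝ≥0∞) := by
    rw [ENNReal.coe_mul (C₀ * C₁), ENNReal.coe_toNNReal hfin]
  rw [TestFn.sobolevNorm_eq, hcoe]
  refine eLpNorm_le_of_schwartz_pairing (SchwartzMap.continuous _).locallyIntegrable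
    (q' := r) (by rwa [add_comm]) fun g _ => ?_
  rw [← hcoe]
  set μ : Distr n := ofFun (besselS _ γ g) with hμ
  have hunif : unifNorm η (-γ) r μ ≤ C₁ * eLpNorm g r volume := by
    refine iSup_le fun z => (sobolevNorm_mulTest_ofFun_le _ _ _ _).trans ?_
    rw [TestFn.toSchwartz_translate]
    refine (hC₁ r Fact.out z _).trans (le_of_eq ?_)
    rw [besselS_besselS, neg_add_cancel, besselS_zero]
  have hμu : μ ∈ unifSpace η (-γ) r := ⟨memSobolevLoc_ofFun _ _ _, hunif.trans_lt
    (ENNReal.mul_lt_top ENNReal.coe_lt_top (eLpNorm_schwartz_lt_top g r))⟩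
  have hμM := hsub hμu
  have hφ := sobolevNorm_mulTest_le hμM φ
  have hpair := enorm_apply_le (-α) hpp' (mulTest φ μ) ψ (hφ.trans_lt
    (ENNReal.mul_lt_top (multiplierNorm_lt_top hμM) (φ.sobolevNorm_lt_top α p))).ne
  rw [mulTest_apply, hμ, ofFun_apply, ← hμ, neg_neg] at hpair
  rw [integral_besselS_mul]
  refine hpair.trans ?_
  calc sobolevNorm (-α) p (mulTest φ μ) * ψ.sobolevNorm α p'
      ≤ (C₀ * (C₁ * eLpNorm g r volume)) * φ.sobolevNorm α p * ψ.sobolevNorm α p' := by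
        gcongr
        refine hφ.trans ?_
        gcongr
        refine (hC₀ μ hμu).trans ?_
        gcongr
    _ = _ := by push_cast; ring

end Distr

end Multipliers

section Lattice

variable {n : ℕ}

/-! ### A partition of unity by lattice translates -/

/-- The points `k / (n + 1)`, `k ∈ ℤⁿ`. The spacing is so small that the cube of half-width
`1 / (n + 1)`, which supports the functions of the partition of unity, lies in the unit ball. -/
noncomputable def latticePoint (n : ℕ) (k : Fin n → ℤ) : EuclideanSpace ℝ (Fin n) :=
  WithLp.toLp 2 fun j => (k j : ℝ) / (n + 1)

/-- The overlap is at most the number of lattice points in a cube of fixed size. -/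
theorem finiteOverlap_latticePoint (n : ℕ) : FiniteOverlap (latticePoint n) := by
  intro K hK
  obtain ⟨R, hR⟩ := hK.isBounded.subset_closedBall 0
  set ρ : ℝ := (n + 1) * R with hρ
  refine ⟨((⌈2 * ρ + 1⌉₊ ^ n : ℕ) : ℝ≥0), fun x => ?_⟩
  let t : Fin n → Finset ℤ := fun j =>
    Finset.Icc ⌈(n + 1) * x j - ρ⌉ ⌊(n + 1) * x j + ρ⌋
  have hsub : {k | x - latticePoint n k ∈ K} ⊆ (Fintype.piFinset t : Set (Fin n → ℤ)) := by
    intro k hk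
    have h1 : ‖x - latticePoint n k‖ ≤ R := by simpa using hR hk
    rw [Finset.mem_coe, Fintype.mem_piFinset]
    intro j
    have h2 : |x j - (k j : ℝ) / (n + 1)| ≤ R := (PiLp.norm_apply_le _ j).trans h1
    have hn : (0 : ℝ) < n + 1 := by positivity
    have h3 : x j - (k j : ℝ) / (n + 1) = ((n + 1) * x j - k j) / (n + 1) := by field_simp
    rw [h3, abs_div, abs_of_pos hn, div_le_iff₀ hn, mul_comm R, ← hρ, abs_le] at h2
    rw [Finset.mem_Icc, Int.ceil_le, Int.le_floor]
    constructor <;> linarith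
  have hcard : ∀ j, (t j).card ≤ ⌈2 * ρ + 1⌉₊ := fun j => by
    rw [Int.card_Icc, Int.toNat_le]
    have h1 := Int.le_ceil ((n + 1) * x j - ρ)
    have h2 := Int.floor_le ((n + 1) * x j + ρ)
    have h3 := Nat.le_ceil (2 * ρ + 1)
    have : ((⌊(n + 1) * x j + ρ⌋ + 1 - ⌈(n + 1) * x j - ρ⌉ : ℤ) : ℝ) ≤
        ((⌈2 * ρ + 1⌉₊ : ℤ) : ℝ) := by
      push_cast
      linarith
    exact_mod_cast this
  refine (measure_mono hsub).trans ?_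
  rw [Measure.count_apply_finset]
  refine le_trans (Nat.cast_le.2 ?_) (le_of_eq (ENNReal.coe_natCast _).symm)
  rw [Fintype.card_piFinset]
  refine (Finset.prod_le_pow_card _ _ _ fun j _ => hcard j).trans (by simp)

/-- A smooth function on `ℝ` supported in `[-1, 1]` whose integer translates sum to one. -/
noncomputable def hatFn (t : ℝ) : ℝ := Real.smoothTransition (t + 1) - Real.smoothTransition t

theorem hatFn_eq_zero {t : ℝ} (ht : 1 < |t|) : hatFn t = 0 := by
  unfold hatFn
  rcases lt_abs.1 ht with h | h
  · rw [Real.smoothTransition.one_of_one_le (by linarith),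
      Real.smoothTransition.one_of_one_le h.le, sub_self]
  · rw [Real.smoothTransition.zero_of_nonpos (by linarith),
      Real.smoothTransition.zero_of_nonpos (by linarith), sub_self]

theorem sum_hatFn {t : ℝ} {N : ℕ} (ht : |t| ≤ N) :
    ∑ k ∈ (Finset.range (2 * N + 1)).image (fun i : ℕ => (i : ℤ) - N), hatFn (t - k) = 1 := by
  rw [Finset.sum_image (by intro i _ j _ hij; simpa using hij)]
  have h1 : ∀ i : ℕ, hatFn (t - ((i : ℤ) - N : ℤ)) =
      Real.smoothTransition (t + N + 1 - i) - Real.smoothTransition (t + N + 1 - (i + 1 : ℕ)) := by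
    intro i
    unfold hatFn
    push_cast
    congr 2 <;> ring
  simp only [h1]
  rw [Finset.sum_range_sub' fun i : ℕ => Real.smoothTransition (t + N + 1 - i)]
  obtain ⟨h2, h3⟩ := abs_le.1 ht
  push_cast
  rw [Real.smoothTransition.one_of_one_le (by linarith),
    Real.smoothTransition.zero_of_nonpos (by linarith), sub_zero]

theorem contDiff_hatFn {m : ℕ∞} : ContDiff ℝ m hatFn := by
  unfold hatFn
  exact (Real.smoothTransition.contDiff.comp (contDiff_id.add contDiff_const)).sub
    Real.smoothTransition.contDiff

theorem norm_le_one_of_prod_hatFn_ne_zero {x : EuclideanSpace ℝ (Fin n)}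
    (hx : ((∏ j, hatFn ((n + 1) * x j) : ℝ) : ℂ) ≠ 0) : ‖x‖ ≤ 1 := by
  have h1 : ∀ j, x j ^ 2 ≤ (1 / (n + 1)) ^ 2 := fun j => by
    have hj : hatFn ((n + 1) * x j) ≠ 0 := by
      intro h0
      exact hx (by rw [Finset.prod_eq_zero (Finset.mem_univ j) h0, Complex.ofReal_zero])
    have hj' : |(n + 1) * x j| ≤ 1 := not_lt.1 fun h => hj (hatFn_eq_zero h)
    rw [abs_mul, abs_of_pos (by positivity : (0 : ℝ) < n + 1)] at hj'
    rw [← sq_abs (x j)]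
    gcongr
    rw [le_div_iff₀ (by positivity)]
    linarith
  rw [EuclideanSpace.norm_eq, Real.sqrt_le_one]
  calc ∑ j, ‖x j‖ ^ 2 ≤ ∑ _j : Fin n, (1 / ((n : ℝ) + 1)) ^ 2 := by
        refine Finset.sum_le_sum fun j _ => ?_
        rw [Real.norm_eq_abs, sq_abs]
        exact h1 j
    _ = n * (1 / ((n : ℝ) + 1)) ^ 2 := by simp
    _ ≤ 1 := by
        rw [div_pow, one_pow, mul_one_div, div_le_one (by positivity)]
        nlinarith [(Nat.cast_nonneg n : (0 : ℝ) ≤ n)]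

/-- The translates of this function by the lattice points form a partition of unity. -/
noncomputable def latticeBump (n : ℕ) : TestFn n where
  toFun x := ((∏ j, hatFn ((n + 1) * x j) : ℝ) : ℂ)
  contDiff' := by
    have h : ContDiff ℝ (⊤ : ℕ∞) fun x : EuclideanSpace ℝ (Fin n) =>
        ∏ j, hatFn ((n + 1) * x j) := contDiff_prod fun j _ => contDiff_hatFn.comp
      (contDiff_const.mul (EuclideanSpace.proj (𝕜 := ℝ) j).contDiff)
    exact Complex.ofRealCLM.contDiff.comp h
  hasCompactSupport' := HasCompactSupport.of_support_subset_isCompact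
    (isCompact_closedBall (0 : EuclideanSpace ℝ (Fin n)) 1) fun x hx => by
      simpa using norm_le_one_of_prod_hatFn_ne_zero hx
  tsupport_subset' := Set.subset_univ _

theorem latticeBump_apply (x : EuclideanSpace ℝ (Fin n)) :
    latticeBump n x = ((∏ j, hatFn ((n + 1) * x j) : ℝ) : ℂ) := rfl

theorem norm_le_one_of_latticeBump_ne_zero {x : EuclideanSpace ℝ (Fin n)}
    (hx : latticeBump n x ≠ 0) : ‖x‖ ≤ 1 :=
  norm_le_one_of_prod_hatFn_ne_zero hx

theorem exists_finset_sum_latticeBump (R : ℝ) : ∃ F : Finset (Fin n → ℤ),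
    ∀ x : EuclideanSpace ℝ (Fin n), ‖x‖ ≤ R → ∑ k ∈ F, latticeBump n (x - latticePoint n k) = 1 := by
  set N := ⌈(n + 1) * R⌉₊ with hN
  refine ⟨Fintype.piFinset fun _ =>
    (Finset.range (2 * N + 1)).image (fun i : ℕ => (i : ℤ) - N), fun x hx => ?_⟩
  have h1 : ∀ k : Fin n → ℤ, latticeBump n (x - latticePoint n k) =
      ((∏ j, hatFn ((n + 1) * x j - k j) : ℝ) : ℂ) := fun k => by
    rw [latticeBump_apply]
    congr 1
    refine Finset.prod_congr rfl fun j _ => ?_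
    congr 1
    have : (x - latticePoint n k) j = x j - (k j : ℝ) / (n + 1) := rfl
    rw [this]
    have hn : ((n : ℝ) + 1) ≠ 0 := by positivity
    field_simp
  simp only [h1]
  rw [← Complex.ofReal_sum, ← Finset.prod_univ_sum _ fun j (k : ℤ) => hatFn ((n + 1) * x j - k),
    Finset.prod_eq_one, Complex.ofReal_one]
  intro j _
  refine sum_hatFn ?_
  rw [abs_mul, abs_of_pos (by positivity : (0 : ℝ) < n + 1)]
  calc (n + 1) * |x j| ≤ (n + 1) * R := by
        gcongr
        exact (PiLp.norm_apply_le x j).trans hx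
    _ ≤ N := Nat.le_ceil _

end Lattice

section Sufficiency

variable {n : ℕ}

namespace Distr

/-! ### Sufficiency of the product inequality -/

/-- The cutoff `η` may be inserted twice since it equals one on the support of the partition
function. -/
theorem exists_finset_mulCLM_eq_sum (η : TestFn n) (hη : η.IsCutoff) (φ ψ : TestFn n) :
    ∃ F : Finset (Fin n → ℤ), TestFn.mulCLM φ ψ =
      ∑ k ∈ F, TestFn.mulCLM (TestFn.translate (latticePoint n k) η)
        (TestFn.mulCLM (TestFn.mulCLM (TestFn.translate (latticePoint n k) (latticeBump n)) φ)
          (TestFn.mulCLM (TestFn.translate (latticePoint n k) η) ψ)) := by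
  obtain ⟨R, hR⟩ := φ.hasCompactSupport.isBounded.subset_closedBall 0
  obtain ⟨F, hF⟩ := exists_finset_sum_latticeBump (n := n) R
  refine ⟨F, ?_⟩
  ext x
  rw [sum_apply]
  simp only [TestFn.mulCLM_apply, TestFn.translate_apply]
  have hterm : ∀ k, η (x - latticePoint n k) * (latticeBump n (x - latticePoint n k) * φ x *
      (η (x - latticePoint n k) * ψ x)) = latticeBump n (x - latticePoint n k) * (φ x * ψ x) := by
    intro k
    by_cases h : latticeBump n (x - latticePoint n k) = 0
    · rw [h]; ring
    · rw [hη.eq_one _ (norm_le_one_of_latticeBump_ne_zero h)]; ring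
  simp only [hterm]
  rw [← Finset.sum_mul]
  by_cases hx : x ∈ tsupport φ
  · rw [hF x (by simpa using hR hx), one_mul]
  · rw [image_eq_zero_of_notMem_tsupport hx]; ring

/-- The form `u(φψ)` is bounded: decompose it by the partition of unity, use the product inequality
for each piece, and sum up with Hölder's inequality and the localization bounds. -/
theorem exists_enorm_apply_mulCLM_le (η : TestFn n) (hη : η.IsCutoff) {α γ : ℝ} (hα : 0 ≤ α)
    {p p' r r' : ℝ≥0∞} [Fact (1 ≤ p)] [Fact (1 ≤ p')] [Fact (1 ≤ r)] [Fact (1 ≤ r')]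
    (hp : p ≠ ∞) (hpp' : p⁻¹ + p'⁻¹ = 1) (hrr' : r⁻¹ + r'⁻¹ = 1) {C : ℝ≥0}
    (hC : ∀ φ ψ : TestFn n, (TestFn.mulCLM φ ψ).sobolevNorm γ r' ≤
      C * (φ.sobolevNorm α p * ψ.sobolevNorm α p')) :
    ∃ K : ℝ≥0, ∀ u ∈ unifSpace η (-γ) r, ∀ φ ψ : TestFn n, ‖u (TestFn.mulCLM φ ψ)‖ₑ ≤
      K * unifNorm η (-γ) r u * (φ.sobolevNorm α p * ψ.sobolevNorm α p') := by
  obtain ⟨A, hA⟩ := (locBdd (finiteOverlap_latticePoint n) hα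
    (latticeBump n).hasCompactSupport_toSchwartz).bddFamily
  obtain ⟨B, hB⟩ := (locBdd (finiteOverlap_latticePoint n) hα
    η.hasCompactSupport_toSchwartz).bddFamily
  refine ⟨C * A * B, fun u hu φ ψ => ?_⟩
  set z := latticePoint n
  set U := unifNorm η (-γ) r u
  have hpiece : ∀ k, ‖u (TestFn.mulCLM (TestFn.translate (z k) η)
      (TestFn.mulCLM (TestFn.mulCLM (TestFn.translate (z k) (latticeBump n)) φ)
        (TestFn.mulCLM (TestFn.translate (z k) η) ψ)))‖ₑ ≤ U * (C *
      ((TestFn.mulCLM (TestFn.translate (z k) (latticeBump n)) φ).sobolevNorm α p *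
        (TestFn.mulCLM (TestFn.translate (z k) η) ψ).sobolevNorm α p')) := fun k => by
    have hk : sobolevNorm (-γ) r (mulTest (TestFn.translate (z k) η) u) ≤ U :=
      le_iSup (fun w => sobolevNorm (-γ) r (mulTest (TestFn.translate w η) u)) (z k)
    rw [← mulTest_apply]
    refine (enorm_apply_le (-γ) hrr' _ _ (hk.trans_lt hu.2).ne).trans ?_
    rw [neg_neg]
    exact mul_le_mul' hk (hC _ _)
  obtain ⟨F, hF⟩ := exists_finset_mulCLM_eq_sum η hη φ ψ
  rw [hF, map_sum]
  obtain ⟨hA1, hA2⟩ := hA p Fact.out (besselS _ α φ.toSchwartz)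
  obtain ⟨hB1, hB2⟩ := hB p' Fact.out (besselS _ α ψ.toSchwartz)
  calc ‖∑ k ∈ F, u (TestFn.mulCLM (TestFn.translate (z k) η)
      (TestFn.mulCLM (TestFn.mulCLM (TestFn.translate (z k) (latticeBump n)) φ)
        (TestFn.mulCLM (TestFn.translate (z k) η) ψ)))‖ₑ
      ≤ ∑ k ∈ F, U * (C *
      ((TestFn.mulCLM (TestFn.translate (z k) (latticeBump n)) φ).sobolevNorm α p *
        (TestFn.mulCLM (TestFn.translate (z k) η) ψ).sobolevNorm α p')) :=
        (enorm_sum_le _ _).trans (Finset.sum_le_sum fun k _ => hpiece k)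
    _ = U * (C * ∑ k ∈ F,
      ((TestFn.mulCLM (TestFn.translate (z k) (latticeBump n)) φ).sobolevNorm α p *
        (TestFn.mulCLM (TestFn.translate (z k) η) ψ).sobolevNorm α p')) := by
        rw [Finset.mul_sum, Finset.mul_sum]
    _ ≤ U * (C * (A * φ.sobolevNorm α p * (B * ψ.sobolevNorm α p'))) := by
        have := sum_eLpNorm_mul_le hA1 hB1 Fact.out hp hpp' F
        simp only [besselS_besselS, neg_add_cancel, besselS_zero] at this hA2 hB2
        simp only [TestFn.sobolevNorm_eq, TestFn.toSchwartz_mulCLM, TestFn.toSchwartz_translate]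
        gcongr
        exact this.trans (mul_le_mul' hA2 hB2)
    _ = _ := by push_cast; ring

/-- The bound for the form `u(φψ)` shows that `φu` lies in `H^{-α}_p`; the hypothesis `γ ≤ α` is what
makes duality applicable for `p = 1`. -/
theorem embedded_of_product_inequality (η : TestFn n) (hη : η.IsCutoff) {α γ : ℝ} (hα : 0 ≤ α)
    (hγα : γ ≤ α) {p p' r r' : ℝ≥0∞} [Fact (1 ≤ p)] [Fact (1 ≤ p')] [Fact (1 ≤ r)]
    [Fact (1 ≤ r')] (hp : p ≠ ∞) (hpp' : p⁻¹ + p'⁻¹ = 1) (hrr' : r⁻¹ + r'⁻¹ = 1) {C : ℝ≥0}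
    (hC : ∀ φ ψ : TestFn n, (TestFn.mulCLM φ ψ).sobolevNorm γ r' ≤
      C * (φ.sobolevNorm α p * ψ.sobolevNorm α p')) :
    ContinuouslyEmbedded (unifSpace η (-γ) r) (unifNorm η (-γ) r)
      (multiplierSpace n α p) (multiplierNorm α p) := by
  obtain ⟨K, hK⟩ := exists_enorm_apply_mulCLM_le η hη hα hp hpp' hrr' hC
  have key : ∀ u ∈ unifSpace η (-γ) r, ∀ φ, (mulTest φ u).MemSobolev (-α) p ∧
      sobolevNorm (-α) p (mulTest φ u) ≤
        (K * unifNorm η (-γ) r u).toNNReal * φ.sobolevNorm α p := by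
    intro u hu φ
    have hfin : K * unifNorm η (-γ) r u ≠ ∞ := ENNReal.mul_ne_top ENNReal.coe_ne_top hu.2.ne
    have hφ := (φ.sobolevNorm_lt_top α p).ne
    have hcoe : (K * unifNorm η (-γ) r u).toNNReal * φ.sobolevNorm α p =
        (((K * unifNorm η (-γ) r u).toNNReal * (φ.sobolevNorm α p).toNNReal : ℝ≥0) : ℝ≥0∞) := by
      rw [ENNReal.coe_mul, ENNReal.coe_toNNReal hφ]
    rw [hcoe]
    refine sobolevNorm_le_of_pairing (neg_le_neg hγα) hpp' (hu.1 φ) fun ψ => ?_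
    rw [← hcoe, mulTest_apply, neg_neg, ENNReal.coe_toNNReal hfin, mul_assoc _ (φ.sobolevNorm α p)]
    exact hK u hu φ ψ
  refine ⟨fun u hu => ⟨fun φ => (key u hu φ).1, _, fun φ => (key u hu φ).2⟩, K, fun u hu => ?_⟩
  have hfin : K * unifNorm η (-γ) r u ≠ ∞ := ENNReal.mul_ne_top ENNReal.coe_ne_top hu.2.ne
  rw [← ENNReal.coe_toNNReal hfin]
  exact iInf₂_le _ fun φ => (key u hu φ).2

end Distr

end Sufficiency

section Modulation

variable {E : Type*} [NormedAddCommGroup E] [InnerProductSpace ℝ E] [FiniteDimensional ℝ E]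
  [MeasurableSpace E] [BorelSpace E]

/-! ### High-frequency asymptotics of Bessel potentials -/

/-- The modulation `x ↦ e^{2πi⟨ξ, x⟩} f(x)` of a Schwartz function, defined as a translation on the
Fourier side. -/
noncomputable def modS (ξ : E) (f : 𝓢(E, ℂ)) : 𝓢(E, ℂ) := 𝓕⁻ (shiftS ξ (𝓕 f))

/-- The result of moving the modulation by `ξ` through `J^s`, normalized by the symbol at `ξ`. -/
noncomputable def modBessel (s : ℝ) (ξ : E) (f : 𝓢(E, ℂ)) (x : E) : ℂ :=
  ∫ ζ, fchar ζ x * ((besselSymbol s (ζ + ξ) / besselSymbol s ξ : ℝ) * 𝓕 f ζ)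

/-- `J^s` of a function modulated by `ξ`, after the substitution `ζ ↦ ζ + ξ` in Fourier space. -/
theorem besselS_modS_apply (s : ℝ) (ξ : E) (f : 𝓢(E, ℂ)) (x : E) :
    besselS E s (modS ξ f) x = fchar ξ x * (besselSymbol s ξ * modBessel s ξ f x) := by
  rw [besselS_apply, modS, FourierTransform.fourier_fourierInv_eq, modBessel,
    ← integral_const_mul, ← integral_const_mul, ← integral_add_right_eq_self _ ξ]
  refine integral_congr_ae (.of_forall fun ζ => ?_)
  have h : (besselSymbol s ξ : ℂ) ≠ 0 := by exact_mod_cast (besselSymbol_pos s ξ).ne'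
  simp only [SchwartzMap.compSubConstCLM_apply, add_sub_cancel_right, fchar_add_left]
  push_cast
  field_simp

theorem modS_apply (ξ : E) (f : 𝓢(E, ℂ)) (x : E) : modS ξ f x = fchar ξ x * f x := by
  have h := besselS_modS_apply 0 ξ f x
  rw [besselS_zero] at h
  rw [h, schwartz_eq_integral_fourier f x]
  simp [modBessel]

theorem eLpNorm_modS (ξ : E) (f : 𝓢(E, ℂ)) (q : ℝ≥0∞) :
    eLpNorm (modS ξ f) q volume = eLpNorm f q volume :=
  eLpNorm_congr_norm_ae (.of_forall fun x => by rw [modS_apply, norm_mul, norm_fchar, one_mul])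

/-- **Peetre's inequality**. -/
theorem besselSymbol_add_le (s : ℝ) (ζ ξ : E) :
    besselSymbol s (ζ + ξ) / besselSymbol s ξ ≤ 2 ^ (|s| / 2) * besselSymbol |s| ζ := by
  have key : ∀ t : ℝ, 0 ≤ t → ∀ a b : E,
      besselSymbol t (a + b) ≤ 2 ^ (t / 2) * besselSymbol t a * besselSymbol t b := by
    intro t ht a b
    unfold besselSymbol
    rw [← Real.mul_rpow (by positivity) (by positivity),
      ← Real.mul_rpow (by positivity) (by positivity)]
    refine Real.rpow_le_rpow (by positivity) ?_ (by positivity)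
    have h1 : ‖a + b‖ ^ 2 ≤ (‖a‖ + ‖b‖) ^ 2 := by gcongr; exact norm_add_le a b
    nlinarith [sq_nonneg (‖a‖ - ‖b‖), sq_nonneg (‖a‖ * ‖b‖)]
  rcases le_total 0 s with hs | hs
  · rw [abs_of_nonneg hs, div_le_iff₀ (besselSymbol_pos _ _)]
    exact key s hs ζ ξ
  · rw [abs_of_nonpos hs]
    have h := key (-s) (by linarith) (-ζ) (ζ + ξ)
    rw [neg_add_cancel_left, besselSymbol_neg, besselSymbol_neg s (ζ + ξ)] at h
    have hn : besselSymbol (-s) (-ζ) = besselSymbol (-s) ζ := by simp [besselSymbol]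
    rw [hn] at h
    rw [div_eq_mul_inv]
    calc besselSymbol s (ζ + ξ) * (besselSymbol s ξ)⁻¹
        ≤ besselSymbol s (ζ + ξ) *
          (2 ^ (-s / 2) * besselSymbol (-s) ζ * (besselSymbol s (ζ + ξ))⁻¹) := by
          gcongr
          exact (besselSymbol_pos _ _).le
      _ = _ := by
          have := (besselSymbol_pos s (ζ + ξ)).ne'
          field_simp

theorem tendsto_besselSymbol_div (s : ℝ) (ζ : E) {e : E} (he : ‖e‖ = 1) :
    Tendsto (fun N : ℕ => besselSymbol s (ζ + (N : ℝ) • e) / besselSymbol s ((N : ℝ) • e)) atTop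
      (𝓝 1) := by
  have hcont : Continuous fun t : ℝ => ((t ^ 2 + ‖t • ζ + e‖ ^ 2) / (t ^ 2 + 1)) :=
    Continuous.div (by fun_prop) (by fun_prop) fun t => by positivity
  have h0 : Tendsto (fun N : ℕ => ((((N : ℝ)⁻¹) ^ 2 + ‖(N : ℝ)⁻¹ • ζ + e‖ ^ 2) /
      (((N : ℝ)⁻¹) ^ 2 + 1))) atTop (𝓝 1) := by
    have := (hcont.tendsto 0).comp (tendsto_inv_atTop_nhds_zero_nat (𝕜 := ℝ))
    simpa [he, Function.comp_def] using this
  have h1 := h0.rpow_const (p := s / 2) (Or.inl one_ne_zero)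
  rw [Real.one_rpow] at h1
  refine h1.congr' ?_
  filter_upwards [eventually_gt_atTop 0] with N hN
  have hN' : (0 : ℝ) < N := by exact_mod_cast hN
  unfold besselSymbol
  rw [← Real.div_rpow (by positivity) (by positivity)]
  congr 1
  have h2 : ζ + (N : ℝ) • e = (N : ℝ) • ((N : ℝ)⁻¹ • ζ + e) := by
    rw [smul_add, smul_inv_smul₀ hN'.ne']
  rw [h2, norm_smul, norm_smul, Real.norm_of_nonneg hN'.le, he]
  field_simp

theorem exists_norm_modBessel_le (s : ℝ) (f : 𝓢(E, ℂ)) :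
    ∃ B, ∀ ξ x, ‖modBessel s ξ f x‖ ≤ B := by
  refine ⟨∫ ζ, 2 ^ (|s| / 2) * ‖(besselSymbol |s| ζ * 𝓕 f ζ : ℂ)‖, fun ξ x => ?_⟩
  refine norm_integral_le_of_norm_le
    ((integrable_besselSymbol_mul_fourier |s| f).norm.const_mul _) (.of_forall fun ζ => ?_)
  rw [norm_mul, norm_fchar, one_mul, norm_mul, norm_mul, Complex.norm_real, Complex.norm_real,
    Real.norm_of_nonneg (div_pos (besselSymbol_pos _ _) (besselSymbol_pos _ _)).le,
    Real.norm_of_nonneg (besselSymbol_pos _ _).le, ← mul_assoc]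
  gcongr
  exact besselSymbol_add_le s ζ ξ

theorem continuous_modBessel (s : ℝ) (ξ : E) (f : 𝓢(E, ℂ)) : Continuous (modBessel s ξ f) := by
  have h : modBessel s ξ f = fun x =>
      (fchar (-ξ) x) * ((besselSymbol s ξ : ℂ)⁻¹ * besselS E s (modS ξ f) x) := by
    funext x
    have h0 : (besselSymbol s ξ : ℂ) ≠ 0 := by exact_mod_cast (besselSymbol_pos s ξ).ne'
    rw [besselS_modS_apply, mul_left_comm _ (fchar ξ x), ← mul_assoc (fchar (-ξ) x),
      fchar_neg_mul, one_mul, inv_mul_cancel_left₀ h0]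
  rw [h]
  exact (continuous_fchar_right _).mul (continuous_const.mul (SchwartzMap.continuous _))

theorem tendsto_modBessel (s : ℝ) (f : 𝓢(E, ℂ)) {e : E} (he : ‖e‖ = 1) (x : E) :
    Tendsto (fun N : ℕ => modBessel s ((N : ℝ) • e) f x) atTop (𝓝 (f x)) := by
  rw [schwartz_eq_integral_fourier f x]
  refine tendsto_integral_of_dominated_convergence
    (fun ζ => 2 ^ (|s| / 2) * ‖(besselSymbol |s| ζ * 𝓕 f ζ : ℂ)‖) (fun N => ?_)
    ((integrable_besselSymbol_mul_fourier |s| f).norm.const_mul _)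
    (fun N => .of_forall fun ζ => ?_) (.of_forall fun ζ => ?_)
  · refine Continuous.aestronglyMeasurable ?_
    have h1 := continuous_fchar_left x
    have h2 := (continuous_besselSymbol (E := E) s).comp (continuous_add_const ((N : ℝ) • e))
    have h3 := (𝓕 f : 𝓢(E, ℂ)).continuous
    exact h1.mul ((Complex.continuous_ofReal.comp (h2.div_const _)).mul h3)
  · rw [norm_mul, norm_fchar, one_mul, norm_mul, norm_mul, Complex.norm_real, Complex.norm_real,
      Real.norm_of_nonneg (div_pos (besselSymbol_pos _ _) (besselSymbol_pos _ _)).le,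
      Real.norm_of_nonneg (besselSymbol_pos _ _).le, ← mul_assoc]
    gcongr
    exact besselSymbol_add_le s ζ _
  · have := (Complex.continuous_ofReal.tendsto 1).comp (tendsto_besselSymbol_div s ζ he)
    simpa using (this.mul_const (𝓕 f ζ)).const_mul (fchar ζ x)

end Modulation

section Necessary

variable {n : ℕ}

/-- The product inequality forces `γ ≤ α`: test it on functions oscillating at frequency `N → ∞`.
The product of a fixed function with a modulated one, normalized in `H^α_{p'}`, has a norm of order
`N^{γ-α}` in `H^γ_{r'}`. -/
theorem le_of_product_inequality (hn : 1 ≤ n) {η : TestFn n} (hη : η.IsCutoff) {α γ : ℝ}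
    {p p' r r' : ℝ≥0∞} [Fact (1 ≤ p)] [Fact (1 ≤ p')] [Fact (1 ≤ r)] [Fact (1 ≤ r')]
    (hrr' : r⁻¹ + r'⁻¹ = 1) {C : ℝ≥0}
    (hC : ∀ φ ψ : TestFn n, (TestFn.mulCLM φ ψ).sobolevNorm γ r' ≤
      C * (φ.sobolevNorm α p * ψ.sobolevNorm α p')) : γ ≤ α := by
  by_contra! hlt
  -- the functions `ψ N = η J^{-α}(e^{2πi⟨ξ_N, ·⟩} η)` are bounded in `H^α_{p'}`; `J^γ(η ψ N)` is paired
  -- with `e^{-2πi⟨ξ_N, ·⟩} η`, which gives the factor `⟨ξ_N⟩^{γ-α}` times a convergent integral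
  set e : EuclideanSpace ℝ (Fin n) := EuclideanSpace.single ⟨0, hn⟩ 1 with he
  have he1 : ‖e‖ = 1 := by simp [he]
  have he2 : ‖-e‖ = 1 := by rw [norm_neg, he1]
  set g := η.toSchwartz
  obtain ⟨A, hA⟩ := exists_eLpNorm_besselS_mulS_le α η.hasCompactSupport_toSchwartz
  have hshift : shiftS 0 η.toSchwartz = η.toSchwartz := by ext; simp
  let ξ : ℕ → EuclideanSpace ℝ (Fin n) := fun N => (N : ℝ) • e
  let a : ℕ → EuclideanSpace ℝ (Fin n) → ℂ := fun N => modBessel (-α) (ξ N) g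
  let b : ℕ → EuclideanSpace ℝ (Fin n) → ℂ := fun N => modBessel γ (-ξ N) g
  let ψ : ℕ → TestFn n := fun N => TestFn.ofSchwartz
    (mulS g (besselS _ (-α) (modS (ξ N) g))) η.hasCompactSupport_toSchwartz.mul_right
  have hψ : ∀ N, (ψ N).sobolevNorm α p' ≤ A * eLpNorm g p' volume := fun N => by
    rw [TestFn.sobolevNorm_eq]
    change eLpNorm (besselS _ α (mulS g (besselS _ (-α) (modS (ξ N) g)))) p' volume ≤ _
    have := hA p' Fact.out 0 (besselS _ (-α) (modS (ξ N) g))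
    rwa [hshift, besselS_besselS, add_neg_cancel, besselS_zero, eLpNorm_modS] at this
  set D : ℝ≥0∞ := C * (η.sobolevNorm α p * (A * eLpNorm g p' volume)) * eLpNorm g r volume
  have hD : D ≠ ∞ := by
    refine ENNReal.mul_ne_top (ENNReal.mul_ne_top ENNReal.coe_ne_top (ENNReal.mul_ne_top
      (η.sobolevNorm_lt_top α p).ne (ENNReal.mul_ne_top ENNReal.coe_ne_top ?_))) ?_
    · exact (eLpNorm_schwartz_lt_top _ _).ne
    · exact (eLpNorm_schwartz_lt_top _ _).ne
  let I : ℕ → ℂ := fun N => ∫ x, η x * η x * (a N x * b N x)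
  have hbound : ∀ N, besselSymbol (γ - α) (ξ N) * ‖I N‖ ≤ D.toReal := fun N => by
    have h1 : ∫ x, besselS _ γ (TestFn.mulCLM η (ψ N)).toSchwartz x * modS (-ξ N) g x =
        (besselSymbol (γ - α) (ξ N) : ℂ) * I N := by
      rw [integral_besselS_mul, ← integral_const_mul]
      refine integral_congr_ae (.of_forall fun x => ?_)
      have hx : (TestFn.mulCLM η (ψ N)).toSchwartz x =
          η x * (η x * besselS _ (-α) (modS (ξ N) g) x) := rfl
      simp only [hx, besselS_modS_apply, sub_eq_add_neg γ, besselSymbol_add]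
      have hs : besselSymbol γ (-ξ N) = besselSymbol γ (ξ N) := by simp [besselSymbol]
      have hf := fchar_neg_mul (ξ N) x
      rw [hs]
      push_cast
      linear_combination (η x * η x * besselSymbol (-α) (ξ N) * a N x * besselSymbol γ (ξ N) *
        b N x) * hf
    have h2 := enorm_integral_mul_le
      (besselS _ γ (TestFn.mulCLM η (ψ N)).toSchwartz).continuous.aestronglyMeasurable
      (modS (-ξ N) g).continuous.aestronglyMeasurable (μ := volume) (q := r') (q' := r)
      (by rwa [add_comm])
    rw [h1, eLpNorm_modS, ← TestFn.sobolevNorm_eq] at h2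
    have h3 : ‖(besselSymbol (γ - α) (ξ N) : ℂ) * I N‖ₑ ≤ D := by
      refine h2.trans (mul_le_mul_left ((hC _ _).trans ?_) _)
      gcongr
      exact hψ N
    rw [← ofReal_norm, norm_mul, Complex.norm_real,
      Real.norm_of_nonneg (besselSymbol_pos _ _).le] at h3
    exact (ENNReal.ofReal_le_iff_le_toReal hD).1 h3
  have hlim : Tendsto I atTop (𝓝 (∫ x, η x * η x * (η x * η x))) := by
    obtain ⟨Ba, hBa⟩ := exists_norm_modBessel_le (-α) g
    obtain ⟨Bb, hBb⟩ := exists_norm_modBessel_le γ g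
    have hint : Integrable fun x => ‖η x * η x‖ * (Ba * Bb) :=
      (mulS g g).integrable.norm.mul_const _
    refine tendsto_integral_of_dominated_convergence _ (fun N => ?_) hint
      (fun N => .of_forall fun x => ?_) (.of_forall fun x => ?_)
    · exact ((η.continuous.mul η.continuous).mul ((continuous_modBessel _ _ _).mul
        (continuous_modBessel _ _ _))).aestronglyMeasurable
    · rw [norm_mul, norm_mul (a N x)]
      gcongr
      · exact (norm_nonneg _).trans (hBa 0 0)
      · exact hBa _ _
      · exact hBb _ _
    · have h1 := tendsto_modBessel (-α) g he1 x
      have h2 := tendsto_modBessel γ g he2 x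
      have h3 : ∀ N : ℕ, (N : ℝ) • -e = -ξ N := fun N => smul_neg _ _
      simp only [h3] at h2
      exact (h1.mul h2).const_mul _
  have hne : ∫ x, η x * η x * (η x * η x) ≠ 0 := by
    have hre : ∀ x, η x * η x * (η x * η x) = ((‖η x‖ ^ 4 : ℝ) : ℂ) := fun x => by
      obtain ⟨t, ht0, ht⟩ := hη.nonneg x
      rw [ht, Complex.norm_real, Real.norm_of_nonneg ht0]
      push_cast; ring
    simp only [hre]
    rw [integral_complex_ofReal, Complex.ofReal_ne_zero]
    refine ne_of_gt ((Continuous.integral_pos_of_hasCompactSupport_nonneg_nonzero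
      (x := 0) (by have := η.continuous; fun_prop) ?_ (fun x => by positivity) ?_))
    · exact η.hasCompactSupport.comp_left (g := fun z : ℂ => ‖z‖ ^ 4) (by simp)
    · rw [hη.eq_one 0 (by simp)]; simp
  have hsym : Tendsto (fun N => besselSymbol (γ - α) (ξ N)) atTop atTop := by
    have h1 : ∀ N, besselSymbol (γ - α) (ξ N) = (1 + (N : ℝ) ^ 2) ^ ((γ - α) / 2) := fun N => by
      simp [besselSymbol, ξ, norm_smul, he1]
    simp only [h1]
    refine (tendsto_rpow_atTop (by linarith)).comp (tendsto_atTop_add_const_left _ _ ?_)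
    exact (tendsto_pow_atTop two_ne_zero).comp tendsto_natCast_atTop_atTop
  have htop := hsym.atTop_mul_pos (norm_pos_iff.2 hne) hlim.norm
  obtain ⟨N, hN⟩ := (htop.eventually_gt_atTop D.toReal).exists
  exact absurd (hbound N) (not_le.2 hN)

end Necessary

theorem mainTheorem5 (n : ℕ) (hn : 1 ≤ n) (η : TestFn n) (hη : η.IsCutoff)
    (α : ℝ) (hα : 0 ≤ α)
    (p p' : ℝ≥0∞) [Fact (1 ≤ p)] [Fact (1 ≤ p')] (hp : p ≠ ∞) (hpp' : p⁻¹ + p'⁻¹ = 1) :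
    Distr.ContinuouslyEmbedded
        (Distr.multiplierSpace n α p) (Distr.multiplierNorm α p)
        (Distr.unifSpace η (-α) (max p p')) (Distr.unifNorm η (-α) (max p p')) ∧
    ∀ (γ : ℝ) (r r' : ℝ≥0∞) [Fact (1 ≤ r)] [Fact (1 ≤ r')], r⁻¹ + r'⁻¹ = 1 →
      (Distr.ContinuouslyEmbedded
          (Distr.unifSpace η (-γ) r) (Distr.unifNorm η (-γ) r)
          (Distr.multiplierSpace n α p) (Distr.multiplierNorm α p) ↔
        ∃ C : ℝ≥0, ∀ φ ψ : TestFn n,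
          (TestFn.mulCLM φ ψ).sobolevNorm γ r' ≤
            C * (φ.sobolevNorm α p * ψ.sobolevNorm α p')) := by
  refine ⟨Distr.multiplierSpace_embedded_unifSpace η α hpp', fun γ r r' _ _ hrr' =>
    ⟨Distr.product_inequality_of_embedded η hpp' hrr', ?_⟩⟩
  rintro ⟨C, hC⟩
  exact Distr.embedded_of_product_inequality η hη hα (le_of_product_inequality hn hη hrr' hC) hp
    hpp' hrr' hC
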